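/- Let $\Lambda$ be the von Mangoldt function, $\gamma$ Euler's constant, and let $\theta\in(0,1]$. Assume that $\Lambda$ has level of distribution $\theta$: for every $A>0$ there is $B=B(A)$ such that for all $X\ge 3$ and all $Q\le X^\theta/(\log X)^B$, $$\sum_{q\le Q}\ \max_{(a,q)=1}\Bigl|\sum_{\substack{X<n\le 2X\\ n\equiv a\,(\mathrm{mod}\ q)}}\Lambda(n)-\frac{X}{\varphi(q)}\Bigr|\ \ll_A\ \frac{X}{(\log X)^A}.$$ For a real $\kappa\ge 0$ let $F_\kappa(s)=1/j_\kappa(s)$ be the Selberg upper-bound sieve function of dimension $\kappa$, where $j_\kappa$ is the continuous function on $(0,\infty)$ with $j_\kappa(s)=\dfrac{e^{-\gamma\kappa}}{\Gamma(\kappa+1)}\,s^\kappa$ for $0<s\le 1$ and $\bigl(s^{-\kappa}j_\kappa(s)\bigr)'=-\kappa\, s^{-\kappa-1}j_\kappa(s-1)$ for $s>1$. Let $X\ge 3$ and $z\ge 2$ be real, let $W_0\ge 1$ and $b$ be integers with $(b,W_0)=1$, and for every prime $p\le z$ with $p\nmid W_0$ let $\Omega(p)\subseteq(\mathbb Z/p\mathbb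 Z)^\times$ be a set of forbidden reduced residue classes, $\omega(p)=|\Omega(p)|$. Let $$\mathrm{Weak}_{\mathrm{loc}}(\Omega;z)=\prod_{p\le z,\ p\nmid W_0}\Bigl(1-\frac{\omega(p)}{p-1}\Bigr),$$ and let $\pi_\Omega(X;W_0,b,z)$ be the number of primes $n\in[X,2X]$ with $n\equiv b\pmod{W_0}$ and $n\bmod p\notin\Omega(p)$ for all primes $p\le z$ with $p\nmid W_0$. **Theorem.** Let $\kappa\ge 0$ and $s>1$ be fixed real numbers and let $A>0$. Then there is $B_0=B_0(A,\kappa,s,\theta)$ such that for every $B\ge B_0$ the following holds. If $\omega(p)\le\kappa$ for all primes $p\le z$ with $p\nmid W_0$, and $R=z^s$ satisfies $W_0R^2\le X^\theta/(\log X)^B$, then $$\pi_\Omega(X;W_0,b,z)\le\bigl(F_\kappa(s)+o(1)\bigr)\,\mathrm{Weak}_{\mathrm{loc}}(\Omega;z)\,\frac{X}{\varphi(W_0)\log X}+O_A\!\left(\frac{X}{(\log X)^{A+1}}\right).$$ Here $o(1)$ is a quantity depending only on $X,\kappa,s,\theta$ that tends to $0$ as $X\to\infty$; in particular it is uniform in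 $z,W_0,b,\Omega$. The constant implied by $O_A$ depends only on $A$ and $\theta$. -/

import Mathlib

open Filter Topology
open scoped BigOperators

noncomputable section

/-- The von Mangoldt function `Λ` has level of distribution `θ`: for every `A > 0` there are
`B` and `C` such that, for all `X ≥ 3` and all `Q ≤ X ^ θ / (log X) ^ B`,
`∑_{q ≤ Q} max_{(a, q) = 1} |∑_{X < n ≤ 2X, n ≡ a (q)} Λ(n) - X / φ(q)| ≤ C X / (log X) ^ A`.
For `q ≥ 1` the supremum below ranges over the finite nonempty type of reduced classes
modulo `q`, so it is a maximum. -/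
def HasLevelOfDistribution (θ : ℝ) : Prop :=
  ∀ A : ℝ, 0 < A → ∃ B C : ℝ, ∀ X : ℝ, 3 ≤ X → ∀ Q : ℝ, Q ≤ X ^ θ / Real.log X ^ B →
    ∑ q ∈ Finset.Icc 1 ⌊Q⌋₊,
      (⨆ a : (ZMod q)ˣ,
        |∑ n ∈ (Finset.Ioc ⌊X⌋₊ ⌊2 * X⌋₊).filter (fun n : ℕ => (n : ZMod q) = (a : ZMod q)),
            ArithmeticFunction.vonMangoldt n - X / (Nat.totient q : ℝ)|)
      ≤ C * (X / Real.log X ^ A)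

/-- A family of sets `Ω(p)` of forbidden reduced residue classes modulo `p`. Only the values at
primes `p ≤ z` with `p ∤ W₀` are ever used. -/
abbrev ObstructionPattern : Type := ∀ p : ℕ, Finset (ZMod p)ˣ

/-- The primes `p ≤ z` with `p ∤ W₀`. -/
def sievingPrimes (W₀ : ℕ) (z : ℝ) : Finset ℕ :=
  (Finset.Icc 1 ⌊z⌋₊).filter (fun p => p.Prime ∧ ¬ p ∣ W₀)

/-- The sifted set: integers `n ∈ [X, 2X]` with `n ≡ b (mod W₀)` and `n mod p ∉ Ω(p)` for every
prime `p ≤ z` with `p ∤ W₀`. (It is used for `X ≥ 3`, so natural numbers suffice.) -/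
def siftedSet (Ω : ObstructionPattern) (X : ℝ) (W₀ : ℕ) (b : ℤ) (z : ℝ) : Set ℕ :=
  {n : ℕ | X ≤ (n : ℝ) ∧ (n : ℝ) ≤ 2 * X ∧ (n : ℤ) ≡ b [ZMOD (W₀ : ℤ)] ∧
    ∀ p ∈ sievingPrimes W₀ z, ∀ u ∈ Ω p, (n : ZMod p) ≠ (u : ZMod p)}

/-- `π_Ω(X; W₀, b, z)`: the number of primes in the sifted set. -/
def sievedPrimeCount (Ω : ObstructionPattern) (X : ℝ) (W₀ : ℕ) (b : ℤ) (z : ℝ) : ℕ :=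
  Set.ncard {n : ℕ | n.Prime ∧ n ∈ siftedSet Ω X W₀ b z}

/-- The local weakness `∏_{p ≤ z, p ∤ W₀} (1 - ω(p) / (p - 1))`, where `ω(p) = |Ω(p)|`. -/
def localWeakness (Ω : ObstructionPattern) (W₀ : ℕ) (z : ℝ) : ℝ :=
  ∏ p ∈ sievingPrimes W₀ z, (1 - ((Ω p).card : ℝ) / ((p : ℝ) - 1))

/-- Method of steps for the function `j_κ` below: `selbergStep κ n` agrees with `j_κ` on
`(-∞, n + 1]`. -/
def selbergStep (κ : ℝ) : ℕ → ℝ → ℝ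
  | 0, s => if s ≤ 0 then 0 else
      Real.exp (-(κ * Real.eulerMascheroniConstant)) / Real.Gamma (κ + 1) * s ^ κ
  | n + 1, s => if s ≤ 0 then 0 else if s ≤ 1 then
      Real.exp (-(κ * Real.eulerMascheroniConstant)) / Real.Gamma (κ + 1) * s ^ κ
    else s ^ κ * (Real.exp (-(κ * Real.eulerMascheroniConstant)) / Real.Gamma (κ + 1)
      - κ * ∫ t in (1 : ℝ)..s, t ^ (-κ - 1) * selbergStep κ n (t - 1))

/-- The Selberg (Ankeny--Onishi) function of dimension `κ`, `j_κ(s) = σ_κ(2s)`: the continuous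
function on `(0, ∞)` with `j_κ(s) = e^{-γκ} s^κ / Γ(κ + 1)` for `0 < s ≤ 1` and
`(s^{-κ} j_κ(s))' = -κ s^{-κ-1} j_κ(s - 1)` for `s > 1`. -/
def selbergJ (κ s : ℝ) : ℝ := selbergStep κ ⌈s⌉₊ s

/-- The upper-bound sieve function of dimension `κ` of Selberg's sieve, `F_κ(s) = 1 / j_κ(s)`,
in the normalization `s = log R / log z`, where the coefficients `λ_d` are supported on
`d ≤ R` (so that the moduli `[d₁, d₂]` go up to `R ^ 2 = z ^ (2 s)`). -/
def upperSieveFunction (κ s : ℝ) : ℝ := 1 / selbergJ κ s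

end

/-! Put g(p) = ω(p)/(p-1) and V = ∏ (1 - g(p)). Selberg's sieve majorises the indicator of the
sifted set by the square of ∑ λ_S 1[n is in a forbidden class at every p ∈ S], where λ_∅ = 1 and S
runs over sets of sieving primes of product at most R. The optimal weights make the quadratic form
equal to 1/G, where G is the sum of ∏_{p ∈ U} g(p)/(1 - g(p)) over sets U of product at most R. The
key observation is that V·G is a probability: it is the chance that a random set of primes,
containing each p independently with probability g(p), has product at most R
(`productProb_eq_mul_sum`). The main term is therefore V divided by this probability, and the
theorem reduces to a lower bound j_κ(s) - o(1) for it, uniform in all data.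

Uniformity comes from monotonicity (`productProb_anti`): raising probabilities or adding primes
makes the random product larger, so only one extremal model per z is needed, with probability
κ/(p-1) at every large p ≤ z and 1 at the small ones. In that model the variable log(product)/log z
has, by independence and Mertens' first theorem, a Laplace transform tending to exp(-κ Ein(m)), with
Ein(x) = ∫₀ˣ (1 - e^{-u})/u du. The delay equation for j_κ gives a first-order differential equation
for its Laplace transform, whose solution, normalised by the behaviour at infinity, is exp(-κ
Ein(x))/x (`laplaceTransform_selbergJ`). A continuity theorem for Laplace transforms then yields
convergence of the distribution functions to j_κ. Bounded z is handled by replacing R with R log X,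
which costs only two powers of log X in the level.

The remainder involves the moduli W₀d with d ≤ R² and divisor-type coefficients. Cauchy–Schwarz
separates these coefficients, controlled by a trivial bound for the discrepancy, from the pure
discrepancy sum, controlled by the level of distribution. -/

/-! ### Random sets of primes and Selberg's optimal weights -/

/-- The expectation of `F T`, where `T ⊆ P` is a random subset containing each `p ∈ P`
independently with probability `g p`. -/
noncomputable def bernoulliSum (g : ℕ → ℝ) (P : Finset ℕ) (F : Finset ℕ → ℝ) : ℝ :=
  ∑ T ∈ P.powerset, ((∏ p ∈ T, g p) * ∏ p ∈ P \ T, (1 - g p)) * F T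

/-- The probability that the product of the random subset of `P` is at most `y`. -/
noncomputable def productProb (g : ℕ → ℝ) (P : Finset ℕ) (y : ℝ) : ℝ :=
  bernoulliSum g P fun T => if ((∏ p ∈ T, p : ℕ) : ℝ) ≤ y then 1 else 0

/-- The subsets of `P` of product at most `y`. -/
noncomputable def boundedSubsets (P : Finset ℕ) (y : ℝ) : Finset (Finset ℕ) :=
  P.powerset.filter fun T => ((∏ p ∈ T, p : ℕ) : ℝ) ≤ y

theorem mem_boundedSubsets {P : Finset ℕ} {y : ℝ} {T : Finset ℕ} :
    T ∈ boundedSubsets P y ↔ T ⊆ P ∧ ((∏ p ∈ T, p : ℕ) : ℝ) ≤ y := by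
  simp [boundedSubsets]

/-- Independence: multiplying out the right-hand side by `Finset.prod_add` produces one term per
subset. The identity is algebraic, so `g` need not take values in [0, 1]. -/
theorem bernoulliSum_prod (g a b : ℕ → ℝ) (P : Finset ℕ) :
    bernoulliSum g P (fun T => ∏ p ∈ P, if p ∈ T then a p else b p) =
      ∏ p ∈ P, (g p * a p + (1 - g p) * b p) := by
  rw [Finset.prod_add, bernoulliSum]
  refine Finset.sum_congr rfl fun T hT => ?_
  rw [Finset.mem_powerset] at hT
  rw [← Finset.prod_sdiff hT, Finset.prod_mul_distrib, Finset.prod_mul_distrib,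
    Finset.prod_congr rfl (fun p hp => if_pos hp : ∀ p ∈ T, (if p ∈ T then a p else b p) = a p),
    Finset.prod_congr rfl (fun p hp => if_neg (Finset.mem_sdiff.1 hp).2 :
      ∀ p ∈ P \ T, (if p ∈ T then a p else b p) = b p)]
  ring

theorem bernoulliSum_congr {g : ℕ → ℝ} {P : Finset ℕ} {F F' : Finset ℕ → ℝ}
    (h : ∀ T ⊆ P, F T = F' T) : bernoulliSum g P F = bernoulliSum g P F' :=
  Finset.sum_congr rfl fun T hT => by rw [h T (Finset.mem_powerset.1 hT)]

theorem bernoulliSum_sum {ι : Type*} (g : ℕ → ℝ) (P : Finset ℕ) (s : Finset ι) (c : ι → ℝ)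
    (F : ι → Finset ℕ → ℝ) :
    bernoulliSum g P (fun T => ∑ i ∈ s, c i * F i T) = ∑ i ∈ s, c i * bernoulliSum g P (F i) := by
  simp only [bernoulliSum, Finset.mul_sum]
  rw [Finset.sum_comm]
  refine Finset.sum_congr rfl fun i _ => Finset.sum_congr rfl fun T _ => by ring

theorem bernoulliSum_one (g : ℕ → ℝ) (P : Finset ℕ) : bernoulliSum g P (fun _ => 1) = 1 := by
  have := bernoulliSum_prod g 1 1 P
  simpa using this

theorem bernoulliSum_mono {g : ℕ → ℝ} {P : Finset ℕ} {F F' : Finset ℕ → ℝ}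
    (h0 : ∀ p ∈ P, 0 ≤ g p) (h1 : ∀ p ∈ P, g p ≤ 1) (h : ∀ T ⊆ P, F T ≤ F' T) :
    bernoulliSum g P F ≤ bernoulliSum g P F' := by
  refine Finset.sum_le_sum fun T hT => ?_
  rw [Finset.mem_powerset] at hT
  refine mul_le_mul_of_nonneg_left (h T hT) (mul_nonneg ?_ ?_)
  · exact Finset.prod_nonneg fun p hp => h0 p (hT hp)
  · exact Finset.prod_nonneg fun p hp => sub_nonneg.2 (h1 p (Finset.mem_sdiff.1 hp).1)

/-- The indicator is a product of local factors that vanish only at points of `D` missed by `T`.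
Applied to `D = S ∪ S'`, it turns the sieve's quadratic form into the expectation of a square. -/
theorem bernoulliSum_subset_indicator (g : ℕ → ℝ) {P D : Finset ℕ} (hD : D ⊆ P) :
    bernoulliSum g P (fun T => if D ⊆ T then 1 else 0) = ∏ p ∈ D, g p := by
  have h := bernoulliSum_prod g 1 (fun p => if p ∈ D then 0 else 1) P
  rw [← Finset.prod_sdiff hD] at h
  rw [Finset.prod_congr rfl (g := fun _ => (1 : ℝ)) (s₁ := P \ D), Finset.prod_const_one, one_mul,
    Finset.prod_congr rfl (g := g)] at h
  · rw [← h]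
    refine bernoulliSum_congr fun T hT => ?_
    split_ifs with hDT
    · symm
      refine Finset.prod_eq_one fun p _ => ?_
      by_cases hp : p ∈ D
      · simp [hDT hp]
      · simp [hp]
    · symm
      obtain ⟨p, hpD, hpT⟩ := Finset.not_subset.1 hDT
      refine Finset.prod_eq_zero (hD hpD) ?_
      simp [hpD, hpT]
  · intro p hp; simp [hp]
  · intro p hp; simp [(Finset.mem_sdiff.1 hp).2]

/-- The orthogonal functions diagonalizing Selberg's quadratic form. -/
noncomputable def selbergBasis (h : ℕ → ℝ) (U T : Finset ℕ) : ℝ :=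
  ∏ p ∈ U, if p ∈ T then -1 else h p

/-- With h = g/(1-g), independence reduces this to one prime. At a prime in exactly one of the two
sets the mean is -g + (1-g)h = 0; at a prime in both it is g + (1-g)h² = h. -/
theorem bernoulliSum_selbergBasis_mul {g : ℕ → ℝ} {P : Finset ℕ}
    (h1 : ∀ p ∈ P, g p < 1) {U V : Finset ℕ} (hU : U ⊆ P) (hV : V ⊆ P) :
    bernoulliSum g P (fun T => selbergBasis (fun p => g p / (1 - g p)) U T *
        selbergBasis (fun p => g p / (1 - g p)) V T) =
      if U = V then ∏ p ∈ U, g p / (1 - g p) else 0 := by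
  set h : ℕ → ℝ := fun p => g p / (1 - g p) with hh
  have e1 : ∀ W ⊆ P, ∀ T, selbergBasis h W T =
      ∏ p ∈ P, if p ∈ W then (if p ∈ T then -1 else h p) else 1 := by
    intro W hW T
    rw [selbergBasis, Finset.prod_ite_mem, Finset.inter_eq_right.2 hW]
  have e2 : ∀ T, selbergBasis h U T * selbergBasis h V T = ∏ p ∈ P, if p ∈ T then
      (if p ∈ U then (-1 : ℝ) else 1) * (if p ∈ V then -1 else 1) else
      (if p ∈ U then h p else 1) * (if p ∈ V then h p else 1) := by
    intro T
    rw [e1 U hU, e1 V hV, ← Finset.prod_mul_distrib]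
    refine Finset.prod_congr rfl fun p _ => ?_
    split_ifs <;> rfl
  simp_rw [e2]
  rw [bernoulliSum_prod]
  have key : ∀ p ∈ P, g p * ((if p ∈ U then (-1 : ℝ) else 1) * (if p ∈ V then -1 else 1)) +
      (1 - g p) * ((if p ∈ U then h p else 1) * (if p ∈ V then h p else 1)) =
      if p ∈ U then (if p ∈ V then h p else 0) else (if p ∈ V then 0 else 1) := by
    intro p hp
    have : (1 - g p) ≠ 0 := (sub_pos.2 (h1 p hp)).ne'
    split_ifs <;> (try simp only [hh]) <;> field_simp <;> ring
  rw [Finset.prod_congr rfl key]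
  split_ifs with hUV
  · subst hUV
    rw [Finset.prod_congr rfl (g := fun p => if p ∈ U then h p else 1)
      (fun p _ => by split_ifs <;> rfl), Finset.prod_ite_mem, Finset.inter_eq_right.2 hU]
  · obtain ⟨p, hp⟩ : ∃ p, ¬ (p ∈ U ↔ p ∈ V) := by
      by_contra hcon
      push Not at hcon
      exact hUV (Finset.ext hcon)
    have hpP : p ∈ P := by
      by_contra hpP
      exact hp ⟨fun h => absurd (hU h) hpP, fun h => absurd (hV h) hpP⟩
    refine Finset.prod_eq_zero hpP ?_
    split_ifs <;> first | rfl | tauto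

theorem boundedSubsets_of_subset {P : Finset ℕ} (hP : ∀ p ∈ P, 1 ≤ p) {y : ℝ} {S U : Finset ℕ}
    (hU : U ∈ boundedSubsets P y) (hSU : S ⊆ U) : S ∈ boundedSubsets P y := by
  rw [mem_boundedSubsets] at hU ⊢
  refine ⟨hSU.trans hU.1, le_trans ?_ hU.2⟩
  exact_mod_cast Finset.prod_le_prod_of_subset_of_one_le' hSU fun p hp _ => hP p (hU.1 hp)

theorem empty_mem_boundedSubsets {P : Finset ℕ} {y : ℝ} (hy : 1 ≤ y) : ∅ ∈ boundedSubsets P y := by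
  simp [mem_boundedSubsets, hy]

theorem productProb_eq_sum (g : ℕ → ℝ) (P : Finset ℕ) (y : ℝ) :
    productProb g P y =
      ∑ T ∈ boundedSubsets P y, (∏ p ∈ T, g p) * ∏ p ∈ P \ T, (1 - g p) := by
  rw [productProb, bernoulliSum, boundedSubsets, Finset.sum_filter]
  refine Finset.sum_congr rfl fun T _ => ?_
  split_ifs <;> simp

/-- Dividing the weight of `T` by the product of all 1 - g(p) leaves ∏_{p ∈ T} g/(1-g). This
identifies the denominator in Selberg's bound with a distribution function. -/
theorem productProb_eq_mul_sum {g : ℕ → ℝ} {P : Finset ℕ} (h1 : ∀ p ∈ P, g p < 1) (y : ℝ) :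
    productProb g P y =
      (∏ p ∈ P, (1 - g p)) * ∑ U ∈ boundedSubsets P y, ∏ p ∈ U, g p / (1 - g p) := by
  rw [productProb_eq_sum, Finset.mul_sum]
  refine Finset.sum_congr rfl fun T hT => ?_
  have hTP := (mem_boundedSubsets.1 hT).1
  have : ∏ p ∈ T, (1 - g p) ≠ 0 :=
    Finset.prod_ne_zero_iff.2 fun p hp => (sub_pos.2 (h1 p (hTP hp))).ne'
  rw [← Finset.prod_sdiff hTP, Finset.prod_div_distrib]
  field_simp

/-- The optimal weights of Selberg's upper-bound sieve. -/
theorem exists_selberg_weights {P : Finset ℕ} (hP : ∀ p ∈ P, 1 ≤ p) {g : ℕ → ℝ}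
    (h0 : ∀ p ∈ P, 0 ≤ g p) (h1 : ∀ p ∈ P, g p < 1) {R : ℝ} (hR : 1 ≤ R) :
    ∃ lam : Finset ℕ → ℝ, lam ∅ = 1 ∧ (∀ S ∈ boundedSubsets P R, |lam S| ≤ 1) ∧
      ∑ S ∈ boundedSubsets P R, ∑ S' ∈ boundedSubsets P R, lam S * lam S' * ∏ p ∈ S ∪ S', g p =
        (∏ p ∈ P, (1 - g p)) / productProb g P R := by
  set 𝒟 := boundedSubsets P R with h𝒟
  set h : ℕ → ℝ := fun p => g p / (1 - g p) with hh
  set G := ∑ U ∈ 𝒟, ∏ p ∈ U, h p with hG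
  have hn : ∀ p ∈ P, 0 ≤ h p := fun p hp => div_nonneg (h0 p hp) (sub_pos.2 (h1 p hp)).le
  have hsub : ∀ U ∈ 𝒟, U ⊆ P := fun U hU => (mem_boundedSubsets.1 hU).1
  have hnU : ∀ U ⊆ P, 0 ≤ ∏ p ∈ U, h p := fun U hU =>
    Finset.prod_nonneg fun p hp => hn p (hU hp)
  have hempty : ∅ ∈ 𝒟 := empty_mem_boundedSubsets hR
  have hG1 : 1 ≤ G := by
    have := Finset.single_le_sum (f := fun U => ∏ p ∈ U, h p)
      (fun U hU => hnU U (hsub U hU)) hempty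
    simpa using this
  have hG0 : G ≠ 0 := by positivity
  -- These are the coefficients obtained by expanding the normalised sum of all basis functions in
  -- the indicators of S ⊆ T, since each local factor is -(1 + h) 1[p ∈ T] + h.
  set lam : Finset ℕ → ℝ := fun S => G⁻¹ * ∑ U ∈ 𝒟 with S ⊆ U,
    (∏ p ∈ S, (-(1 + h p))) * ∏ p ∈ U \ S, h p with hlam
  refine ⟨lam, ?_, ?_, ?_⟩
  · simp only [hlam, Finset.empty_subset, Finset.filter_true, Finset.prod_empty, one_mul,
      Finset.sdiff_empty]
    exact inv_mul_cancel₀ hG0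
  · intro S hS
    have hSP := hsub S hS
    -- Expanding ∏_{p ∈ S} (1 + h) over L ⊆ S, the pair (U, L) is recovered from (U \ S) ∪ L, which
    -- is a subset of U and hence again of bounded product. The sum is thus a subsum of `G`.
    have hle : ∑ U ∈ 𝒟 with S ⊆ U, (∏ p ∈ S, (1 + h p)) * ∏ p ∈ U \ S, h p ≤ G := by
      have : ∑ U ∈ 𝒟 with S ⊆ U, (∏ p ∈ S, (1 + h p)) * ∏ p ∈ U \ S, h p =
          ∑ x ∈ (𝒟.filter (S ⊆ ·)) ×ˢ S.powerset, ∏ p ∈ (x.1 \ S) ∪ x.2, h p := by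
        rw [Finset.sum_product]
        refine Finset.sum_congr rfl fun U _ => ?_
        rw [Finset.prod_one_add, Finset.sum_mul]
        refine Finset.sum_congr rfl fun L hL => ?_
        rw [Finset.prod_union, mul_comm]
        exact Finset.disjoint_of_subset_right (Finset.mem_powerset.1 hL) Finset.sdiff_disjoint
      rw [this]
      have hinj : Set.InjOn (fun x : Finset ℕ × Finset ℕ => (x.1 \ S) ∪ x.2)
          ((𝒟.filter (S ⊆ ·)) ×ˢ S.powerset : Finset _) := by
        rintro ⟨U, L⟩ hx ⟨U', L'⟩ hx' hxx
        simp only [Finset.coe_product, Set.mem_prod, Finset.mem_coe, Finset.mem_filter,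
          Finset.mem_powerset] at hx hx' hxx
        have e : ∀ p, ((p ∈ U ∧ p ∉ S) ∨ p ∈ L) ↔ ((p ∈ U' ∧ p ∉ S) ∨ p ∈ L') := by
          intro p
          have := Finset.ext_iff.1 hxx p
          simpa using this
        refine Prod.ext (Finset.ext fun p => ?_) (Finset.ext fun p => ?_)
        · have := e p
          have a1 := @hx.1.2 p
          have a2 := @hx'.1.2 p
          have a3 := @hx.2 p
          have a4 := @hx'.2 p
          simp only; tauto
        · have := e p
          have a3 := @hx.2 p
          have a4 := @hx'.2 p
          simp only; tauto
      rw [← Finset.sum_image hinj (f := fun W => ∏ p ∈ W, h p)]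
      refine Finset.sum_le_sum_of_subset_of_nonneg ?_ fun U hU _ => hnU U (hsub U hU)
      intro W hW
      obtain ⟨⟨U, L⟩, hx, rfl⟩ := Finset.mem_image.1 hW
      simp only [Finset.mem_product, Finset.mem_filter, Finset.mem_powerset] at hx
      refine boundedSubsets_of_subset hP hx.1.1 ?_
      exact Finset.union_subset Finset.sdiff_subset (hx.2.trans hx.1.2)
    have : lam S = (-1) ^ S.card * (G⁻¹ *
        ∑ U ∈ 𝒟 with S ⊆ U, (∏ p ∈ S, (1 + h p)) * ∏ p ∈ U \ S, h p) := by
      simp only [hlam, Finset.prod_neg, mul_assoc, ← Finset.mul_sum]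
      ring
    rw [this, abs_mul, abs_pow, abs_neg, abs_one, one_pow, one_mul, abs_of_nonneg]
    · rw [inv_mul_le_iff₀ (by positivity), mul_one]; exact hle
    · refine mul_nonneg (by positivity) (Finset.sum_nonneg fun U hU => mul_nonneg ?_ ?_)
      · exact Finset.prod_nonneg fun p hp => by linarith [hn p (hSP hp)]
      · exact hnU _ (Finset.sdiff_subset.trans (hsub U (Finset.mem_filter.1 hU).1))
  · have expand : ∀ T, ∑ S ∈ 𝒟, lam S * (if S ⊆ T then 1 else 0) =
        ∑ U ∈ 𝒟, G⁻¹ * selbergBasis h U T := by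
      intro T
      have hb : ∀ U ∈ 𝒟, selbergBasis h U T = ∑ S ∈ 𝒟, if S ⊆ U then
          ((∏ p ∈ S, (-(1 + h p))) * ∏ p ∈ U \ S, h p) * (if S ⊆ T then 1 else 0) else 0 := by
        intro U hU
        have hUe : U.powerset = 𝒟.filter (· ⊆ U) := by
          ext S
          simp only [Finset.mem_powerset, Finset.mem_filter]
          exact ⟨fun hS => ⟨boundedSubsets_of_subset hP hU hS, hS⟩, fun hS => hS.2⟩
        rw [← Finset.sum_filter, ← hUe, selbergBasis,
          Finset.prod_congr rfl (g := fun p => (-(1 + h p)) * (if p ∈ T then 1 else 0) + h p)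
          (fun p _ => by split_ifs <;> ring), Finset.prod_add]
        refine Finset.sum_congr rfl fun S _ => ?_
        rw [Finset.prod_mul_distrib, Finset.prod_boole]
        simp only [Finset.subset_iff]
        ring
      symm
      rw [Finset.sum_congr rfl fun U hU => by rw [hb U hU, Finset.mul_sum], Finset.sum_comm]
      refine Finset.sum_congr rfl fun S _ => ?_
      simp only [hlam, Finset.sum_filter, Finset.mul_sum, Finset.sum_mul]
      refine Finset.sum_congr rfl fun U _ => ?_
      split_ifs <;> ring
    have hquad : ∑ S ∈ 𝒟, ∑ S' ∈ 𝒟, lam S * lam S' * ∏ p ∈ S ∪ S', g p =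
        bernoulliSum g P fun T => (∑ S ∈ 𝒟, lam S * (if S ⊆ T then 1 else 0)) *
          ∑ S ∈ 𝒟, lam S * (if S ⊆ T then 1 else 0) := by
      have e : ∀ T, (∑ S ∈ 𝒟, lam S * (if S ⊆ T then 1 else 0)) *
          (∑ S ∈ 𝒟, lam S * (if S ⊆ T then 1 else 0)) =
          ∑ x ∈ 𝒟 ×ˢ 𝒟, lam x.1 * lam x.2 * (if x.1 ∪ x.2 ⊆ T then 1 else 0) := by
        intro T
        rw [Finset.sum_mul_sum, Finset.sum_product]
        refine Finset.sum_congr rfl fun S _ => Finset.sum_congr rfl fun S' _ => ?_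
        simp only [Finset.union_subset_iff]
        by_cases a : S ⊆ T <;> by_cases b : S' ⊆ T <;> simp [a, b]
      simp_rw [e]
      rw [bernoulliSum_sum, Finset.sum_product]
      refine Finset.sum_congr rfl fun S hS => Finset.sum_congr rfl fun S' hS' => ?_
      rw [bernoulliSum_subset_indicator g (Finset.union_subset (hsub S hS) (hsub S' hS'))]
    rw [hquad]
    simp_rw [expand]
    have e : ∀ T, (∑ U ∈ 𝒟, G⁻¹ * selbergBasis h U T) * (∑ U ∈ 𝒟, G⁻¹ * selbergBasis h U T) =
        ∑ x ∈ 𝒟 ×ˢ 𝒟, G⁻¹ * G⁻¹ * (selbergBasis h x.1 T * selbergBasis h x.2 T) := by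
      intro T
      rw [Finset.sum_mul_sum, Finset.sum_product]
      refine Finset.sum_congr rfl fun S _ => Finset.sum_congr rfl fun S' _ => by ring
    simp_rw [e]
    rw [bernoulliSum_sum, Finset.sum_product, productProb_eq_mul_sum h1]
    have hV0 : ∏ p ∈ P, (1 - g p) ≠ 0 :=
      Finset.prod_ne_zero_iff.2 fun p hp => (sub_pos.2 (h1 p hp)).ne'
    rw [show (∏ p ∈ P, (1 - g p)) / ((∏ p ∈ P, (1 - g p)) * ∑ U ∈ 𝒟, ∏ p ∈ U, h p) = G⁻¹ by
      rw [← hG]; field_simp]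
    -- Orthogonality keeps only the diagonal, so the form equals G⁻²·G = G⁻¹.
    have : ∀ U ∈ 𝒟, ∑ V ∈ 𝒟, G⁻¹ * G⁻¹ * bernoulliSum g P (fun T =>
        selbergBasis h U T * selbergBasis h V T) = G⁻¹ * G⁻¹ * ∏ p ∈ U, h p := by
      intro U hU
      rw [Finset.sum_congr rfl fun V hV => by
        rw [bernoulliSum_selbergBasis_mul h1 (hsub U hU) (hsub V hV)]]
      simp [hU, hh]
    rw [Finset.sum_congr rfl this, ← Finset.mul_sum, ← hG]
    field_simp

/-! ### Monotonicity of the distribution of the random product -/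

/-- Condition on whether the new prime is chosen; if it is, the rest must have product at most `y /
p`. -/
theorem productProb_insert (g : ℕ → ℝ) {P : Finset ℕ} {p : ℕ} (hp : p ∉ P) (hp0 : 0 < p) (y : ℝ) :
    productProb g (insert p P) y =
      (1 - g p) * productProb g P y + g p * productProb g P (y / p) := by
  rw [productProb, bernoulliSum, Finset.sum_powerset_insert hp, productProb, productProb,
    bernoulliSum, bernoulliSum, Finset.mul_sum, Finset.mul_sum]
  congr 1
  · refine Finset.sum_congr rfl fun T hT => ?_
    have hpT : p ∉ T := fun h => hp (Finset.mem_powerset.1 hT h)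
    rw [Finset.insert_sdiff_of_notMem _ hpT, Finset.prod_insert (by simp [hp])]
    ring
  · refine Finset.sum_congr rfl fun T hT => ?_
    have hpT : p ∉ T := fun h => hp (Finset.mem_powerset.1 hT h)
    rw [Finset.prod_insert hpT, Finset.prod_insert hpT, Finset.insert_sdiff_insert,
      Finset.sdiff_insert_of_notMem hp, Nat.cast_mul]
    simp only [le_div_iff₀ (show (0 : ℝ) < p by exact_mod_cast hp0), mul_comm (p : ℝ)]
    ring

theorem productProb_mono {g : ℕ → ℝ} {P : Finset ℕ} (h0 : ∀ p ∈ P, 0 ≤ g p)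
    (h1 : ∀ p ∈ P, g p ≤ 1) {y y' : ℝ} (h : y ≤ y') : productProb g P y ≤ productProb g P y' := by
  refine bernoulliSum_mono h0 h1 fun T _ => ?_
  split_ifs <;> first | (exfalso; linarith) | norm_num

theorem productProb_nonneg {g : ℕ → ℝ} {P : Finset ℕ} (h0 : ∀ p ∈ P, 0 ≤ g p)
    (h1 : ∀ p ∈ P, g p ≤ 1) (y : ℝ) : 0 ≤ productProb g P y := by
  have : bernoulliSum g P (fun _ => 0) = 0 := by simp [bernoulliSum]
  rw [← this]
  refine bernoulliSum_mono h0 h1 fun T _ => ?_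
  split_ifs <;> norm_num

theorem productProb_le_one {g : ℕ → ℝ} {P : Finset ℕ} (h0 : ∀ p ∈ P, 0 ≤ g p)
    (h1 : ∀ p ∈ P, g p ≤ 1) (y : ℝ) : productProb g P y ≤ 1 := by
  rw [← bernoulliSum_one g P]
  refine bernoulliSum_mono h0 h1 fun T _ => ?_
  split_ifs <;> norm_num

theorem productProb_eq_one {g : ℕ → ℝ} {P : Finset ℕ} (hP : ∀ p ∈ P, 1 ≤ p) {y : ℝ}
    (hy : ((∏ p ∈ P, p : ℕ) : ℝ) ≤ y) : productProb g P y = 1 := by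
  rw [← bernoulliSum_one g P, productProb]
  refine bernoulliSum_congr fun T hT => if_pos (le_trans ?_ hy)
  exact_mod_cast Finset.prod_le_prod_of_subset_of_one_le' hT fun p hp _ => hP p hp

/-- Enlarging the probabilities and the set of primes makes the random product larger. -/
theorem productProb_anti {g g' : ℕ → ℝ} {P P' : Finset ℕ} (hP' : ∀ p ∈ P', 0 < p) (hPP : P ⊆ P')
    (h0 : ∀ p ∈ P, 0 ≤ g p) (hgg : ∀ p ∈ P, g p ≤ g' p) (h0' : ∀ p ∈ P', 0 ≤ g' p)
    (h1' : ∀ p ∈ P', g' p ≤ 1) (y : ℝ) : productProb g' P' y ≤ productProb g P y := by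
  induction P' using Finset.induction_on generalizing P y with
  | empty =>
    rw [Finset.subset_empty.1 hPP]
    simp [productProb, bernoulliSum]
  | insert p P' hp ih =>
    have hp0 : 0 < p := hP' p (Finset.mem_insert_self _ _)
    have hp1 : (1 : ℝ) ≤ p := by exact_mod_cast hp0
    have hP'' : ∀ q ∈ P', 0 < q := fun q hq => hP' q (Finset.mem_insert_of_mem hq)
    have a0 : ∀ q ∈ P', 0 ≤ g' q := fun q hq => h0' q (Finset.mem_insert_of_mem hq)
    have a1 : ∀ q ∈ P', g' q ≤ 1 := fun q hq => h1' q (Finset.mem_insert_of_mem hq)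
    have b0 := h0' p (Finset.mem_insert_self _ _)
    have b1 := h1' p (Finset.mem_insert_self _ _)
    -- For negative `y` division by `p` increases the level, but then both probabilities are zero.
    have hyy : productProb g' P' (y / p) ≤ productProb g' P' y := by
      rcases le_or_gt 0 y with hy | hy
      · exact productProb_mono a0 a1 (div_le_self hy hp1)
      · have : ∀ z : ℝ, z < 0 → productProb g' P' z = 0 := by
          intro z hz
          rw [productProb, bernoulliSum]
          refine Finset.sum_eq_zero fun T _ => ?_
          rw [if_neg (not_le.2 (lt_of_lt_of_le hz (by positivity))), mul_zero]
        rw [this y hy, this _ (div_neg_of_neg_of_pos hy (by positivity))]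
    rw [productProb_insert g' hp hp0]
    by_cases hpP : p ∈ P
    · obtain ⟨Q, hQ, rfl⟩ : ∃ Q, p ∉ Q ∧ P = insert p Q :=
        ⟨P.erase p, Finset.notMem_erase p P, (Finset.insert_erase hpP).symm⟩
      have hQP : Q ⊆ P' := by
        intro q hq
        rcases Finset.mem_insert.1 (hPP (Finset.mem_insert_of_mem hq)) with rfl | h
        · exact absurd hq hQ
        · exact h
      rw [productProb_insert g hQ hp0]
      have c0 : ∀ q ∈ Q, 0 ≤ g q := fun q hq => h0 q (Finset.mem_insert_of_mem hq)
      have c1 : ∀ q ∈ Q, g q ≤ g' q := fun q hq => hgg q (Finset.mem_insert_of_mem hq)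
      have i1 := ih hP'' hQP c0 c1 a0 a1 y
      have i2 := ih hP'' hQP c0 c1 a0 a1 (y / p)
      have d0 := h0 p (Finset.mem_insert_self _ _)
      have d1 := hgg p (Finset.mem_insert_self _ _)
      -- The mixture of the values at `y` and `y / p` decreases as more weight is put on the smaller
      -- value at `y / p`; the two induction hypotheses do the rest.
      nlinarith [mul_nonneg (sub_nonneg.2 d1) (sub_nonneg.2 hyy),
        mul_nonneg d0 (sub_nonneg.2 i2), mul_nonneg (sub_nonneg.2 (d1.trans b1)) (sub_nonneg.2 i1)]
    · have hQP : P ⊆ P' := by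
        intro q hq
        rcases Finset.mem_insert.1 (hPP hq) with rfl | h
        · exact absurd hq hpP
        · exact h
      have i1 := ih hP'' hQP h0 hgg a0 a1 y
      nlinarith [mul_nonneg b0 (sub_nonneg.2 hyy)]

/-! ### The von Mangoldt function in residue classes -/

/-- The maximal error of the prime number theorem for `(X, 2X]` in reduced classes modulo `q`. -/
noncomputable def apDiscrepancy (X : ℝ) (q : ℕ) : ℝ :=
  ⨆ a : (ZMod q)ˣ,
    |∑ n ∈ (Finset.Ioc ⌊X⌋₊ ⌊2 * X⌋₊).filter (fun n : ℕ => (n : ZMod q) = (a : ZMod q)),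
      ArithmeticFunction.vonMangoldt n - X / (Nat.totient q : ℝ)|

theorem le_apDiscrepancy (X : ℝ) {q : ℕ} (hq : 0 < q) (a : (ZMod q)ˣ) :
    |∑ n ∈ (Finset.Ioc ⌊X⌋₊ ⌊2 * X⌋₊).filter (fun n : ℕ => (n : ZMod q) = (a : ZMod q)),
      ArithmeticFunction.vonMangoldt n - X / (Nat.totient q : ℝ)| ≤ apDiscrepancy X q := by
  have : NeZero q := ⟨hq.ne'⟩
  exact le_ciSup (f := fun a : (ZMod q)ˣ => |∑ n ∈ (Finset.Ioc ⌊X⌋₊ ⌊2 * X⌋₊).filter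
    (fun n : ℕ => (n : ZMod q) = (a : ZMod q)), ArithmeticFunction.vonMangoldt n
      - X / (Nat.totient q : ℝ)|) (Set.finite_range _).bddAbove a

theorem apDiscrepancy_nonneg (X : ℝ) (q : ℕ) : 0 ≤ apDiscrepancy X q :=
  Real.iSup_nonneg fun _ => abs_nonneg _

theorem card_Ioc_filter_zmod_le {X : ℝ} (hX : 1 ≤ X) {q : ℕ} (hq : 0 < q) (hqX : (q : ℝ) ≤ X)
    (a : ZMod q) :
    (((Finset.Ioc ⌊X⌋₊ ⌊2 * X⌋₊).filter (fun n : ℕ => (n : ZMod q) = a)).card : ℝ) ≤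
      3 * X / q := by
  have : NeZero q := ⟨hq.ne'⟩
  have hq0 : (0 : ℝ) < q := by exact_mod_cast hq
  have e : (Finset.Ioc ⌊X⌋₊ ⌊2 * X⌋₊).filter (fun n : ℕ => (n : ZMod q) = a) =
      (Finset.Ioc ⌊X⌋₊ ⌊2 * X⌋₊).filter (fun n : ℕ => n ≡ a.val [MOD q]) := by
    refine Finset.filter_congr fun n _ => ?_
    rw [← ZMod.natCast_eq_natCast_iff, ZMod.natCast_zmod_val]
  have h := Nat.Ioc_filter_modEq_card ⌊X⌋₊ ⌊2 * X⌋₊ hq a.val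
  rw [e]
  have h' : (((Finset.Ioc ⌊X⌋₊ ⌊2 * X⌋₊).filter (fun n : ℕ => n ≡ a.val [MOD q])).card : ℝ) =
    (((max (⌊((⌊2 * X⌋₊ : ℕ) - a.val : ℚ) / q⌋ - ⌊((⌊X⌋₊ : ℕ) - a.val : ℚ) / q⌋) 0 : ℤ)) : ℝ) := by
    rw [← h]; simp
  rw [h', Int.cast_max, Int.cast_sub]
  have u1 : ((⌊((⌊2 * X⌋₊ : ℕ) - a.val : ℚ) / q⌋ : ℤ) : ℝ) ≤ ((⌊2 * X⌋₊ : ℝ) - a.val) / q := by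
    have := Int.floor_le (((⌊2 * X⌋₊ : ℕ) - a.val : ℚ) / q)
    exact_mod_cast (Rat.cast_le (K := ℝ)).2 this
  have u2 : ((⌊X⌋₊ : ℝ) - a.val) / q - 1 < ((⌊((⌊X⌋₊ : ℕ) - a.val : ℚ) / q⌋ : ℤ) : ℝ) := by
    have := Int.sub_one_lt_floor (((⌊X⌋₊ : ℕ) - a.val : ℚ) / q)
    exact_mod_cast (Rat.cast_lt (K := ℝ)).2 this
  have v1 : (⌊2 * X⌋₊ : ℝ) ≤ 2 * X := Nat.floor_le (by linarith)
  have v2 : X - 1 < (⌊X⌋₊ : ℝ) := Nat.sub_one_lt_floor X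
  have w : 1 ≤ X / q := (one_le_div hq0).2 hqX
  have w' : 1 / q ≤ X / q := div_le_div_of_nonneg_right hX hq0.le
  refine max_le ?_ (by push_cast; positivity)
  have : ((⌊2 * X⌋₊ : ℝ) - a.val) / q - ((⌊X⌋₊ : ℝ) - a.val) / q ≤ X / q + 1 / q := by
    rw [← sub_div, ← add_div]
    exact div_le_div_of_nonneg_right (by linarith) hq0.le
  have e3 : 3 * X / q = X / q + X / q + X / q := by ring
  linarith

/-- Trivial estimate: at most 3X/q integers, each with Λ ≤ 2 log X, plus the expected term X/φ(q),
giving 6 + 1 = 7. It serves as the crude side of Cauchy–Schwarz. -/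
theorem apDiscrepancy_le {X : ℝ} (hX : 3 ≤ X) {q : ℕ} (hq : 0 < q) (hqX : (q : ℝ) ≤ X) :
    apDiscrepancy X q ≤ 7 * (X * Real.log X) / Nat.totient q := by
  have : NeZero q := ⟨hq.ne'⟩
  have hlog : 1 ≤ Real.log X := by
    rw [Real.le_log_iff_exp_le (by linarith)]
    linarith [Real.exp_one_lt_d9]
  have hφ : (0 : ℝ) < Nat.totient q := by exact_mod_cast Nat.totient_pos.2 hq
  have hφq : (Nat.totient q : ℝ) ≤ q := by exact_mod_cast Nat.totient_le q
  refine ciSup_le fun a => ?_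
  have h1 : ∑ n ∈ (Finset.Ioc ⌊X⌋₊ ⌊2 * X⌋₊).filter (fun n : ℕ => (n : ZMod q) = (a : ZMod q)),
      ArithmeticFunction.vonMangoldt n ≤ 3 * X / q * (2 * Real.log X) := by
    refine (Finset.sum_le_card_nsmul _ _ (2 * Real.log X) fun n hn => ?_).trans ?_
    · rw [Finset.mem_filter, Finset.mem_Ioc] at hn
      refine ArithmeticFunction.vonMangoldt_le_log.trans ?_
      have hn0 : (0 : ℝ) < n := by exact_mod_cast (Nat.zero_le _).trans_lt hn.1.1
      have hn2 : (n : ℝ) ≤ X ^ 2 := by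
        have : (n : ℝ) ≤ 2 * X := (Nat.le_floor_iff (by linarith)).1 hn.1.2
        nlinarith
      calc Real.log n ≤ Real.log (X ^ 2) := Real.log_le_log hn0 hn2
        _ = 2 * Real.log X := by rw [Real.log_pow]; norm_num
    · rw [nsmul_eq_mul]
      exact mul_le_mul_of_nonneg_right
        (card_Ioc_filter_zmod_le (by linarith) hq hqX _) (by linarith)
  have h0 : 0 ≤ ∑ n ∈ (Finset.Ioc ⌊X⌋₊ ⌊2 * X⌋₊).filter (fun n : ℕ => (n : ZMod q) = (a : ZMod q)),
      ArithmeticFunction.vonMangoldt n :=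
    Finset.sum_nonneg fun _ _ => ArithmeticFunction.vonMangoldt_nonneg
  have h2 : 3 * X / q * (2 * Real.log X) ≤ 6 * (X * Real.log X) / Nat.totient q := by
    rw [show 3 * X / q * (2 * Real.log X) = 6 * (X * Real.log X) / q by ring]
    exact div_le_div_of_nonneg_left (by positivity) hφ hφq
  have h3 : X / Nat.totient q ≤ X * Real.log X / Nat.totient q :=
    div_le_div_of_nonneg_right (by nlinarith) hφ.le
  have h4 : 0 ≤ X / Nat.totient q := by positivity
  rw [show 7 * (X * Real.log X) / (Nat.totient q : ℝ) =
    6 * (X * Real.log X) / Nat.totient q + X * Real.log X / Nat.totient q by ring]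
  rw [abs_le]
  constructor
  · have : 0 ≤ 6 * (X * Real.log X) / (Nat.totient q : ℝ) := by positivity
    linarith
  · linarith

/-- The reduced classes cut out by a congruence modulo `W₀` and by the condition of lying in
`Ω p` for the primes `p ∈ D`. -/
theorem exists_units_finset (Ω : ObstructionPattern) {W₀ : ℕ} {b : ℤ}
    (hb : IsCoprime b (W₀ : ℤ)) (D : Finset ℕ) (hD : ∀ p ∈ D, p.Prime ∧ ¬ p ∣ W₀) :
    ∃ 𝒜 : Finset (ZMod (W₀ * ∏ p ∈ D, p))ˣ, 𝒜.card = ∏ p ∈ D, (Ω p).card ∧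
      ∀ n : ℕ, ((n : ℤ) ≡ b [ZMOD (W₀ : ℤ)] ∧ ∀ p ∈ D, ∃ u ∈ Ω p, (n : ZMod p) = (u : ZMod p)) ↔
        ∃ a ∈ 𝒜, (n : ZMod (W₀ * ∏ p ∈ D, p)) = (a : ZMod (W₀ * ∏ p ∈ D, p)) := by
  induction D using Finset.induction_on with
  | empty =>
    rw [Finset.prod_empty, mul_one]
    have hu : IsUnit ((b : ℤ) : ZMod W₀) := by
      obtain ⟨x, y, hxy⟩ := hb
      have : ((x * b + y * W₀ : ℤ) : ZMod W₀) = 1 := by rw [hxy]; simp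
      push_cast at this
      simp only [ZMod.natCast_self, mul_zero, add_zero] at this
      exact IsUnit.of_mul_eq_one_right _ this
    refine ⟨{hu.unit}, by simp, fun n => ?_⟩
    simp only [Finset.notMem_empty, false_imp_iff, implies_true, and_true, Finset.mem_singleton,
      exists_eq_left, IsUnit.unit_spec]
    rw [← ZMod.intCast_eq_intCast_iff]
    simp
  | insert p D hp ih =>
    obtain ⟨𝒜, hcard, hmem⟩ := ih fun q hq => hD q (Finset.mem_insert_of_mem hq)
    have hpp := hD p (Finset.mem_insert_self _ _)
    have hcop : Nat.Coprime (W₀ * ∏ q ∈ D, q) p := by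
      refine (Nat.Coprime.mul_left ?_ ?_)
      · exact ((Nat.Prime.coprime_iff_not_dvd hpp.1).2 hpp.2).symm
      · refine Nat.Coprime.prod_left fun q hq => ?_
        refine (Nat.coprime_primes (hD q (Finset.mem_insert_of_mem hq)).1 hpp.1).2 ?_
        rintro rfl; exact hp hq
    have hq : W₀ * ∏ q ∈ insert p D, q = (W₀ * ∏ q ∈ D, q) * p := by
      rw [Finset.prod_insert hp]; ring
    rw [hq]
    let c := ZMod.chineseRemainder hcop
    let e : (ZMod ((W₀ * ∏ q ∈ D, q) * p))ˣ ≃ (ZMod (W₀ * ∏ q ∈ D, q))ˣ × (ZMod p)ˣ :=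
      ((Units.mapEquiv c.toMulEquiv).trans MulEquiv.prodUnits).toEquiv
    refine ⟨(𝒜 ×ˢ Ω p).map e.symm.toEmbedding, ?_, fun n => ?_⟩
    · rw [Finset.card_map, Finset.card_product, hcard, Finset.prod_insert hp, mul_comm]
    · have key : ∀ a : (ZMod ((W₀ * ∏ q ∈ D, q) * p))ˣ,
          ((n : ZMod ((W₀ * ∏ q ∈ D, q) * p)) = a ↔
            (n : ZMod (W₀ * ∏ q ∈ D, q)) = (e a).1 ∧ (n : ZMod p) = (e a).2) := by
        intro a
        have h1 : ((e a).1 : ZMod (W₀ * ∏ q ∈ D, q)) = (c a).1 := rfl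
        have h2 : ((e a).2 : ZMod p) = (c a).2 := rfl
        rw [h1, h2, ← c.injective.eq_iff, map_natCast, Prod.ext_iff]
        simp
      simp only [Finset.mem_map_equiv, Equiv.symm_symm, Finset.mem_product, key]
      constructor
      · rintro ⟨hn, hall⟩
        obtain ⟨a, ha, hna⟩ := (hmem n).1 ⟨hn, fun q hq => hall q (Finset.mem_insert_of_mem hq)⟩
        obtain ⟨u, hu, hnu⟩ := hall p (Finset.mem_insert_self _ _)
        exact ⟨e.symm (a, u), by simp [ha, hu], by simp [hna], by simp [hnu]⟩
      · rintro ⟨a, ⟨ha, hu⟩, hna, hnu⟩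
        obtain ⟨h1, h2⟩ := (hmem n).2 ⟨_, ha, hna⟩
        refine ⟨h1, fun q hq => ?_⟩
        rcases Finset.mem_insert.1 hq with rfl | hq
        · exact ⟨_, hu, hnu⟩
        · exact h2 q hq

theorem totient_prod_primes {D : Finset ℕ} (hD : ∀ p ∈ D, p.Prime) :
    (Nat.totient (∏ p ∈ D, p) : ℝ) = ∏ p ∈ D, ((p : ℝ) - 1) := by
  induction D using Finset.induction_on with
  | empty => simp
  | insert p D hp ih =>
    have hpp := hD p (Finset.mem_insert_self _ _)
    rw [Finset.prod_insert hp, Finset.prod_insert hp, Nat.totient_mul, Nat.totient_prime hpp,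
      Nat.cast_mul, ih fun q hq => hD q (Finset.mem_insert_of_mem hq), Nat.cast_pred hpp.pos]
    refine Nat.Coprime.prod_right fun q hq => ?_
    refine (Nat.coprime_primes hpp (hD q (Finset.mem_insert_of_mem hq))).2 ?_
    rintro rfl; exact hp hq

theorem totient_mul_prod_primes {W₀ : ℕ} {D : Finset ℕ} (hD : ∀ p ∈ D, p.Prime ∧ ¬ p ∣ W₀) :
    (Nat.totient (W₀ * ∏ p ∈ D, p) : ℝ) = Nat.totient W₀ * ∏ p ∈ D, ((p : ℝ) - 1) := by
  rw [Nat.totient_mul, Nat.cast_mul, totient_prod_primes fun p hp => (hD p hp).1]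
  exact Nat.Coprime.prod_right fun q hq =>
    ((Nat.Prime.coprime_iff_not_dvd (hD q hq).1).2 (hD q hq).2).symm

open Classical in
/-- The distribution of the sequence `Λ(n)`, `n ≡ b (mod W₀)`, among the classes `Ω p`, `p ∈ D`. -/
theorem abs_sum_vonMangoldt_sub_le (Ω : ObstructionPattern) {W₀ : ℕ} (hW : 0 < W₀) {b : ℤ}
    (hb : IsCoprime b (W₀ : ℤ)) {D : Finset ℕ} (hD : ∀ p ∈ D, p.Prime ∧ ¬ p ∣ W₀) (X : ℝ) :
    |∑ n ∈ (Finset.Ioc ⌊X⌋₊ ⌊2 * X⌋₊).filter (fun n : ℕ => (n : ℤ) ≡ b [ZMOD (W₀ : ℤ)] ∧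
        ∀ p ∈ D, ∃ u ∈ Ω p, (n : ZMod p) = (u : ZMod p)), ArithmeticFunction.vonMangoldt n -
      X / Nat.totient W₀ * ∏ p ∈ D, ((Ω p).card : ℝ) / ((p : ℝ) - 1)| ≤
      (∏ p ∈ D, ((Ω p).card : ℝ)) * apDiscrepancy X (W₀ * ∏ p ∈ D, p) := by
  have hex := exists_units_finset Ω hb D hD
  obtain ⟨q, hqdef⟩ : ∃ q, q = W₀ * ∏ p ∈ D, p := ⟨_, rfl⟩
  rw [← hqdef] at hex ⊢
  obtain ⟨𝒜, hcard, hmem⟩ := hex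
  have hq : 0 < q := hqdef ▸ Nat.mul_pos hW (Finset.prod_pos fun p hp => (hD p hp).1.pos)
  have e : (Finset.Ioc ⌊X⌋₊ ⌊2 * X⌋₊).filter (fun n : ℕ => (n : ℤ) ≡ b [ZMOD (W₀ : ℤ)] ∧
        ∀ p ∈ D, ∃ u ∈ Ω p, (n : ZMod p) = (u : ZMod p)) =
      𝒜.biUnion fun a => (Finset.Ioc ⌊X⌋₊ ⌊2 * X⌋₊).filter
        (fun n : ℕ => (n : ZMod q) = (a : ZMod q)) := by
    ext n
    simp only [Finset.mem_filter, hmem n, Finset.mem_biUnion]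
    tauto
  rw [e, Finset.sum_biUnion]
  · have h2 : X / Nat.totient W₀ * ∏ p ∈ D, ((Ω p).card : ℝ) / ((p : ℝ) - 1) =
        ∑ _a ∈ 𝒜, X / (Nat.totient q : ℝ) := by
      rw [Finset.sum_const, hcard, nsmul_eq_mul, hqdef, totient_mul_prod_primes hD,
        Finset.prod_div_distrib]
      push_cast
      rw [div_mul_div_comm, mul_div_assoc', mul_comm X]
    rw [h2, ← Finset.sum_sub_distrib]
    refine (Finset.abs_sum_le_sum_abs _ _).trans ?_
    refine (Finset.sum_le_card_nsmul _ _ _ fun a _ => le_apDiscrepancy X hq a).trans ?_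
    rw [hcard, nsmul_eq_mul]
    push_cast
    rfl
  · intro a _ a' _ haa
    refine Finset.disjoint_left.2 fun n hn hn' => haa ?_
    rw [Finset.mem_filter] at hn hn'
    exact Units.ext (hn.2.symm.trans hn'.2)

/-! ### Selberg's sieve inequality with remainder -/

open Classical in
/-- Selberg's upper-bound sieve for primes in `(X, 2X]`, with remainder term. -/
theorem sum_vonMangoldt_sifted_le (Ω : ObstructionPattern) {W₀ : ℕ} (hW : 0 < W₀) {b : ℤ}
    (hb : IsCoprime b (W₀ : ℤ)) {P : Finset ℕ} (hP : ∀ p ∈ P, p.Prime ∧ ¬ p ∣ W₀)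
    (h1 : ∀ p ∈ P, ((Ω p).card : ℝ) / ((p : ℝ) - 1) < 1) {X : ℝ} {R : ℝ} (hR : 1 ≤ R) :
    ∑ n ∈ (Finset.Ioc ⌊X⌋₊ ⌊2 * X⌋₊).filter (fun n : ℕ => (n : ℤ) ≡ b [ZMOD (W₀ : ℤ)] ∧
        ∀ p ∈ P, ∀ u ∈ Ω p, (n : ZMod p) ≠ (u : ZMod p)), ArithmeticFunction.vonMangoldt n ≤
      X / Nat.totient W₀ * ((∏ p ∈ P, (1 - ((Ω p).card : ℝ) / ((p : ℝ) - 1))) /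
        productProb (fun p => ((Ω p).card : ℝ) / ((p : ℝ) - 1)) P R) +
      ∑ D ∈ boundedSubsets P (R ^ 2), 4 ^ D.card * ((∏ p ∈ D, ((Ω p).card : ℝ)) *
        apDiscrepancy X (W₀ * ∏ p ∈ D, p)) := by
  set g : ℕ → ℝ := fun p => ((Ω p).card : ℝ) / ((p : ℝ) - 1) with hg
  have hP1 : ∀ p ∈ P, 1 ≤ p := fun p hp => (hP p hp).1.one_le
  have h0 : ∀ p ∈ P, 0 ≤ g p := fun p hp => by
    have : (1 : ℝ) ≤ p := by exact_mod_cast hP1 p hp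
    exact div_nonneg (Nat.cast_nonneg _) (by linarith)
  obtain ⟨lam, hlam0, hlam1, hquad⟩ := exists_selberg_weights hP1 h0 h1 hR
  rw [← hquad]
  set I := (Finset.Ioc ⌊X⌋₊ ⌊2 * X⌋₊).filter (fun n : ℕ => (n : ℤ) ≡ b [ZMOD (W₀ : ℤ)]) with hI
  set 𝒟 := boundedSubsets P R with h𝒟
  have hsub : ∀ U ∈ 𝒟, U ⊆ P := fun U hU => (mem_boundedSubsets.1 hU).1
  let mem : Finset ℕ → ℕ → Prop := fun D n => ∀ p ∈ D, ∃ u ∈ Ω p, (n : ZMod p) = (u : ZMod p)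
  have hmemU : ∀ S S' n, mem (S ∪ S') n ↔ mem S n ∧ mem S' n := by
    intro S S' n
    simp only [mem, Finset.mem_union]
    exact ⟨fun h => ⟨fun p hp => h p (Or.inl hp), fun p hp => h p (Or.inr hp)⟩,
      fun h p hp => hp.elim (h.1 p) (h.2 p)⟩
  -- On a sifted n only S = ∅ contributes, so the square is λ_∅² = 1; elsewhere it is nonnegative.
  have step1 : ∑ n ∈ (Finset.Ioc ⌊X⌋₊ ⌊2 * X⌋₊).filter (fun n : ℕ =>
      (n : ℤ) ≡ b [ZMOD (W₀ : ℤ)] ∧ ∀ p ∈ P, ∀ u ∈ Ω p, (n : ZMod p) ≠ (u : ZMod p)),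
      ArithmeticFunction.vonMangoldt n ≤
      ∑ n ∈ I, ArithmeticFunction.vonMangoldt n *
        ((∑ S ∈ 𝒟, lam S * if mem S n then 1 else 0) *
        (∑ S ∈ 𝒟, lam S * if mem S n then 1 else 0)) := by
    rw [hI, ← Finset.filter_filter, Finset.sum_filter]
    refine Finset.sum_le_sum fun n _ => ?_
    split_ifs with hn
    · have : ∑ S ∈ 𝒟, lam S * (if mem S n then (1 : ℝ) else 0) = 1 := by
        rw [Finset.sum_eq_single ∅]
        · simp [mem, hlam0]
        · intro S hS hS0
          obtain ⟨p, hp⟩ := Finset.nonempty_iff_ne_empty.2 hS0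
          rw [if_neg, mul_zero]
          intro hm
          obtain ⟨u, hu, hnu⟩ := hm p hp
          exact hn p (hsub S hS hp) u hu hnu
        · exact fun h => absurd (empty_mem_boundedSubsets hR) h
      rw [this]; simp
    · exact mul_nonneg ArithmeticFunction.vonMangoldt_nonneg (mul_self_nonneg _)
  have step2 : ∑ n ∈ I, ArithmeticFunction.vonMangoldt n *
        ((∑ S ∈ 𝒟, lam S * if mem S n then 1 else 0) *
        (∑ S ∈ 𝒟, lam S * if mem S n then 1 else 0)) =
      ∑ S ∈ 𝒟, ∑ S' ∈ 𝒟, lam S * lam S' * ∑ n ∈ (Finset.Ioc ⌊X⌋₊ ⌊2 * X⌋₊).filter (fun n : ℕ =>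
        (n : ℤ) ≡ b [ZMOD (W₀ : ℤ)] ∧ mem (S ∪ S') n), ArithmeticFunction.vonMangoldt n := by
    rw [Finset.sum_congr rfl fun n _ => by rw [Finset.sum_mul_sum, Finset.mul_sum],
      Finset.sum_comm]
    refine Finset.sum_congr rfl fun S _ => ?_
    rw [Finset.sum_congr rfl fun n _ => by rw [Finset.mul_sum], Finset.sum_comm]
    refine Finset.sum_congr rfl fun S' _ => ?_
    rw [Finset.mul_sum, ← Finset.filter_filter, Finset.sum_filter (p := mem (S ∪ S'))]
    refine Finset.sum_congr rfl fun n _ => ?_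
    simp only [hmemU]
    by_cases a : mem S n <;> by_cases c : mem S' n <;> simp [a, c]
    ring
  have step3 : ∀ S ∈ 𝒟, ∀ S' ∈ 𝒟, lam S * lam S' *
      ∑ n ∈ (Finset.Ioc ⌊X⌋₊ ⌊2 * X⌋₊).filter (fun n : ℕ =>
        (n : ℤ) ≡ b [ZMOD (W₀ : ℤ)] ∧ mem (S ∪ S') n), ArithmeticFunction.vonMangoldt n ≤
      X / Nat.totient W₀ * (lam S * lam S' * ∏ p ∈ S ∪ S', g p) +
        (∏ p ∈ S ∪ S', ((Ω p).card : ℝ)) * apDiscrepancy X (W₀ * ∏ p ∈ S ∪ S', p) := by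
    intro S hS S' hS'
    have hD : ∀ p ∈ S ∪ S', p.Prime ∧ ¬ p ∣ W₀ := fun p hp =>
      hP p (Finset.union_subset (hsub S hS) (hsub S' hS') hp)
    have h := abs_sum_vonMangoldt_sub_le Ω hW hb hD X
    have hl : |lam S * lam S'| ≤ 1 := by
      rw [abs_mul]
      exact mul_le_one₀ (hlam1 S hS) (abs_nonneg _) (hlam1 S' hS')
    have h2 := (le_abs_self _).trans ((abs_mul (lam S * lam S') _).le.trans
      (mul_le_mul hl h (abs_nonneg _) zero_le_one))
    rw [mul_sub, one_mul] at h2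
    have : lam S * lam S' * (X / Nat.totient W₀ * ∏ p ∈ S ∪ S', g p) =
      X / Nat.totient W₀ * (lam S * lam S' * ∏ p ∈ S ∪ S', g p) := by ring
    linarith
  -- Pairs are grouped by their union D. Both members are subsets of D, so at most 4^|D| pairs share
  -- it, and ∏ D ≤ ∏ S · ∏ S' ≤ R².
  have step4 : ∑ S ∈ 𝒟, ∑ S' ∈ 𝒟, (∏ p ∈ S ∪ S', ((Ω p).card : ℝ)) *
      apDiscrepancy X (W₀ * ∏ p ∈ S ∪ S', p) ≤
      ∑ D ∈ boundedSubsets P (R ^ 2), 4 ^ D.card * ((∏ p ∈ D, ((Ω p).card : ℝ)) *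
        apDiscrepancy X (W₀ * ∏ p ∈ D, p)) := by
    rw [← Finset.sum_product' 𝒟 𝒟 (fun S S' => (∏ p ∈ S ∪ S', ((Ω p).card : ℝ)) *
      apDiscrepancy X (W₀ * ∏ p ∈ S ∪ S', p))]
    have hmaps : ∀ x ∈ 𝒟 ×ˢ 𝒟, x.1 ∪ x.2 ∈ boundedSubsets P (R ^ 2) := by
      intro x hx
      rw [Finset.mem_product] at hx
      obtain ⟨hx1, hx2⟩ := hx
      rw [h𝒟, mem_boundedSubsets] at hx1 hx2
      refine mem_boundedSubsets.2 ⟨Finset.union_subset hx1.1 hx2.1, ?_⟩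
      have hle : ∏ p ∈ x.1 ∪ x.2, p ≤ (∏ p ∈ x.1, p) * ∏ p ∈ x.2, p := by
        rw [← Finset.prod_union_inter]
        refine Nat.le_mul_of_pos_right _ (Finset.prod_pos fun p hp => ?_)
        exact hP1 p (hx1.1 (Finset.mem_inter.1 hp).1)
      calc ((∏ p ∈ x.1 ∪ x.2, p : ℕ) : ℝ) ≤ ((∏ p ∈ x.1, p : ℕ) : ℝ) * (∏ p ∈ x.2, p : ℕ) := by
            exact_mod_cast hle
        _ ≤ R * R := mul_le_mul hx1.2 hx2.2 (Nat.cast_nonneg _) (by linarith)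
        _ = R ^ 2 := by ring
    rw [← Finset.sum_fiberwise_of_maps_to hmaps]
    refine Finset.sum_le_sum fun D _ => ?_
    have hnn : 0 ≤ (∏ p ∈ D, ((Ω p).card : ℝ)) * apDiscrepancy X (W₀ * ∏ p ∈ D, p) :=
      mul_nonneg (Finset.prod_nonneg fun _ _ => Nat.cast_nonneg _) (apDiscrepancy_nonneg _ _)
    rw [Finset.sum_congr rfl (g := fun _ => (∏ p ∈ D, ((Ω p).card : ℝ)) *
      apDiscrepancy X (W₀ * ∏ p ∈ D, p)) fun x hx => by rw [(Finset.mem_filter.1 hx).2],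
      Finset.sum_const, nsmul_eq_mul]
    refine mul_le_mul_of_nonneg_right ?_ hnn
    have : (Finset.filter (fun x => x.1 ∪ x.2 = D) (𝒟 ×ˢ 𝒟)).card ≤
        (D.powerset ×ˢ D.powerset).card := by
      refine Finset.card_le_card fun x hx => ?_
      rw [Finset.mem_filter] at hx
      rw [Finset.mem_product, Finset.mem_powerset, Finset.mem_powerset, ← hx.2]
      exact ⟨Finset.subset_union_left, Finset.subset_union_right⟩
    rw [Finset.card_product, Finset.card_powerset, ← mul_pow] at this
    exact_mod_cast this
  calc _ ≤ _ := step1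
    _ = _ := step2
    _ ≤ _ := Finset.sum_le_sum fun S hS => Finset.sum_le_sum fun S' hS' => step3 S hS S' hS'
    _ ≤ _ := by
      simp only [Finset.sum_add_distrib, ← Finset.mul_sum]
      exact add_le_add le_rfl step4

/-! ### The remainder on average over moduli -/

/-- Unique factorisation recovers `D` as the set of prime factors, so sums over sets of primes
become sums over distinct integers. -/
theorem boundedSubsets_prod_injOn {P : Finset ℕ} (hP : ∀ p ∈ P, p.Prime) (y : ℝ) :
    Set.InjOn (fun D : Finset ℕ => ∏ p ∈ D, p) (boundedSubsets P y) := by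
  intro D hD D' hD' h
  have e : ∀ D ∈ boundedSubsets P y, (∏ p ∈ D, p).primeFactors = D := fun D hD =>
    Nat.primeFactors_prod fun p hp => hP p ((mem_boundedSubsets.1 hD).1 hp)
  rw [← e D hD, ← e D' hD', show ∏ p ∈ D, p = ∏ p ∈ D', p from h]

/-- Induction on `k`: (k+1)^|D| is the sum of k^|L| over L ⊆ D, and the pair (L, D \ L) ranges
injectively inside the product of two copies of the family. Each step thus costs a factor ∑ 1/d ≤ 1
+ log y. -/
theorem sum_pow_card_div_prod_le {P : Finset ℕ} (hP : ∀ p ∈ P, p.Prime) {y : ℝ} (hy : 1 ≤ y)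
    (k : ℕ) : ∑ D ∈ boundedSubsets P y, (k : ℝ) ^ D.card / ((∏ p ∈ D, p : ℕ) : ℝ) ≤
      (1 + Real.log y) ^ k := by
  have hP1 : ∀ p ∈ P, 1 ≤ p := fun p hp => (hP p hp).one_le
  have hpos : ∀ D ∈ boundedSubsets P y, 0 < ∏ p ∈ D, p := fun D hD =>
    Finset.prod_pos fun p hp => hP1 p ((mem_boundedSubsets.1 hD).1 hp)
  have hlog : 0 ≤ 1 + Real.log y := by linarith [Real.log_nonneg hy]
  have base : ∑ D ∈ boundedSubsets P y, 1 / ((∏ p ∈ D, p : ℕ) : ℝ) ≤ 1 + Real.log y := by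
    rw [← Finset.sum_image (f := fun n : ℕ => 1 / (n : ℝ)) (boundedSubsets_prod_injOn hP y)]
    have h1 := harmonic_floor_le_one_add_log y hy
    refine le_trans ?_ h1
    rw [harmonic_eq_sum_Icc]
    push_cast
    simp only [one_div]
    refine Finset.sum_le_sum_of_subset_of_nonneg ?_ fun _ _ _ => by positivity
    intro n hn
    obtain ⟨D, hD, rfl⟩ := Finset.mem_image.1 hn
    rw [Finset.mem_Icc]
    exact ⟨hpos D hD, Nat.le_floor (mem_boundedSubsets.1 hD).2⟩
  induction k with
  | zero =>
    rw [pow_zero, Finset.sum_eq_single ∅]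
    · simp
    · intro D _ hD0
      have : D.card ≠ 0 := Finset.card_ne_zero.2 (Finset.nonempty_iff_ne_empty.2 hD0)
      simp [this]
    · exact fun h => absurd (empty_mem_boundedSubsets hy) h
  | succ k ih =>
    rw [pow_succ]
    refine le_trans ?_ (mul_le_mul ih base (Finset.sum_nonneg fun _ _ => by positivity)
      (by positivity))
    rw [Finset.sum_mul_sum, ← Finset.sum_product']
    have expand : ∀ D ∈ boundedSubsets P y, ((k + 1 : ℕ) : ℝ) ^ D.card / ((∏ p ∈ D, p : ℕ) : ℝ) =
        ∑ L ∈ D.powerset, (k : ℝ) ^ L.card / ((∏ p ∈ L, p : ℕ) : ℝ) *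
          (1 / ((∏ p ∈ D \ L, p : ℕ) : ℝ)) := by
      intro D hD
      rw [← Finset.prod_const, Nat.cast_succ, Finset.prod_add, Finset.sum_div]
      refine Finset.sum_congr rfl fun L hL => ?_
      rw [← Finset.prod_sdiff (Finset.mem_powerset.1 hL), Finset.prod_const, Finset.prod_const_one]
      push_cast
      rw [div_mul_div_comm, mul_comm (∏ p ∈ L, (p : ℝ))]
    rw [Finset.sum_congr rfl expand, Finset.sum_sigma']
    have hinj : Set.InjOn (fun x : (_ : Finset ℕ) × Finset ℕ => (x.2, x.1 \ x.2))
        ((boundedSubsets P y).sigma fun D => D.powerset : Finset _) := by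
      rintro ⟨D, L⟩ hx ⟨D', L'⟩ hx' hxx
      simp only [Finset.coe_sigma, Set.mem_sigma_iff, Finset.mem_coe, Finset.mem_powerset,
        Prod.mk.injEq] at hx hx' hxx
      obtain ⟨rfl, hxx⟩ := hxx
      have : D = D' := by
        rw [← Finset.sdiff_union_of_subset hx.2, hxx, Finset.sdiff_union_of_subset hx'.2]
      subst this; rfl
    rw [← Finset.sum_image (f := fun x : Finset ℕ × Finset ℕ =>
      (k : ℝ) ^ x.1.card / ((∏ p ∈ x.1, p : ℕ) : ℝ) * (1 / ((∏ p ∈ x.2, p : ℕ) : ℝ))) hinj]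
    refine Finset.sum_le_sum_of_subset_of_nonneg ?_ fun _ _ _ => by positivity
    intro x hx
    obtain ⟨⟨D, L⟩, hDL, rfl⟩ := Finset.mem_image.1 hx
    rw [Finset.mem_sigma, Finset.mem_powerset] at hDL
    exact Finset.mem_product.2 ⟨boundedSubsets_of_subset hP1 hDL.1 hDL.2,
      boundedSubsets_of_subset hP1 hDL.1 Finset.sdiff_subset⟩

/-- With E the discrepancy, (∑ (4κ)^|D| E)² ≤ ∑ (16κ²)^|D| E · ∑ E. The first factor loses powers of
log X by the trivial bound, and the level of distribution saves more in the second. The bound has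
constant 1, so `κ` enters only through the thresholds. -/
theorem sum_apDiscrepancy_boundedSubsets_le {θ : ℝ} (hLD : HasLevelOfDistribution θ) {κ : ℝ}
    (hκ : 0 ≤ κ) {A : ℝ} (hA : 0 < A) :
    ∃ B₁ X₁ : ℝ, ∀ X : ℝ, X₁ ≤ X → ∀ (W₀ : ℕ) (Y : ℝ) (P : Finset ℕ) (Ω : ObstructionPattern),
      0 < W₀ → 1 ≤ Y → (W₀ : ℝ) * Y ≤ X ^ θ / Real.log X ^ B₁ → (W₀ : ℝ) * Y ≤ X →
      (∀ p ∈ P, p.Prime ∧ ¬ p ∣ W₀) → (∀ p ∈ P, ((Ω p).card : ℝ) ≤ κ) →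
      ∑ D ∈ boundedSubsets P Y, 4 ^ D.card * ((∏ p ∈ D, ((Ω p).card : ℝ)) *
        apDiscrepancy X (W₀ * ∏ p ∈ D, p)) ≤ X / Real.log X ^ A := by
  -- Here 32κ² = 2 · 16κ², the extra 2 per prime coming from d/φ(d) ≤ 2^|D|.
  obtain ⟨K, hK⟩ := exists_nat_ge (32 * κ ^ 2)
  -- The trivial bound costs K + 1 logarithms, the square root doubles `A`, and the last logarithm
  -- absorbs the constant 7|C|2^K for large `X`.
  obtain ⟨B, C, hBC⟩ := hLD (2 * A + K + 2) (by positivity)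
  refine ⟨B, max 3 (Real.exp (7 * |C| * 2 ^ K)), fun X hX W₀ Y P Ω hW hY hQ hQX hP hω => ?_⟩
  have hX3 : 3 ≤ X := (le_max_left _ _).trans hX
  have hX0 : 0 < X := by linarith
  set ℓ := Real.log X with hℓ
  have hℓ1 : 1 ≤ ℓ := by
    rw [hℓ, Real.le_log_iff_exp_le hX0]
    linarith [Real.exp_one_lt_d9]
  have hℓ0 : 0 < ℓ := by linarith
  have hℓC : 7 * |C| * 2 ^ K ≤ ℓ := by
    rw [hℓ, Real.le_log_iff_exp_le hX0]
    exact (le_max_right _ _).trans hX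
  have hPp : ∀ p ∈ P, p.Prime := fun p hp => (hP p hp).1
  have hsub : ∀ D ∈ boundedSubsets P Y, D ⊆ P := fun D hD => (mem_boundedSubsets.1 hD).1
  have hppos : ∀ D ∈ boundedSubsets P Y, 0 < ∏ p ∈ D, p := fun D hD =>
    Finset.prod_pos fun p hp => (hPp p (hsub D hD hp)).pos
  have hW1 : (1 : ℝ) ≤ W₀ := by exact_mod_cast hW
  have hqle : ∀ D ∈ boundedSubsets P Y, ((W₀ * ∏ p ∈ D, p : ℕ) : ℝ) ≤ W₀ * Y := fun D hD => by
    rw [Nat.cast_mul]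
    exact mul_le_mul_of_nonneg_left (mem_boundedSubsets.1 hD).2 (by positivity)
  have hYX : Y ≤ X := le_trans (by nlinarith) hQX
  have hlogY : 1 + Real.log Y ≤ 2 * ℓ := by
    have := Real.log_le_log (by linarith) hYX
    linarith
  set E : Finset ℕ → ℝ := fun D => apDiscrepancy X (W₀ * ∏ p ∈ D, p) with hE
  have hE0 : ∀ D, 0 ≤ E D := fun D => apDiscrepancy_nonneg _ _
  have hcs := Finset.sum_sq_le_sum_mul_sum_of_sq_le_mul (boundedSubsets P Y)
    (r := fun D => (4 * κ) ^ D.card * E D) (f := fun D => (16 * κ ^ 2) ^ D.card * E D) (g := E)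
    (fun D _ => mul_nonneg (by positivity) (hE0 D)) (fun D _ => hE0 D) (fun D _ => by
      refine le_of_eq ?_
      rw [mul_pow, ← pow_mul, mul_comm D.card, pow_mul]; ring)
  have hS2 : ∑ D ∈ boundedSubsets P Y, E D ≤ |C| * (X / ℓ ^ (2 * A + K + 2)) := by
    refine le_trans ?_ ((hBC X hX3 (W₀ * Y) hQ).trans
      (mul_le_mul_of_nonneg_right (le_abs_self C) (by positivity)))
    have hinj : Set.InjOn (fun D : Finset ℕ => W₀ * ∏ p ∈ D, p) (boundedSubsets P Y) :=
      fun D hD D' hD' h => boundedSubsets_prod_injOn hPp Y hD hD' (Nat.eq_of_mul_eq_mul_left hW h)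
    have hsum := Finset.sum_image (f := apDiscrepancy X) hinj
    simp only [hE]
    rw [← hsum]
    refine Finset.sum_le_sum_of_subset_of_nonneg ?_ fun q _ _ => apDiscrepancy_nonneg X q
    intro q hq
    obtain ⟨D, hD, rfl⟩ := Finset.mem_image.1 hq
    exact Finset.mem_Icc.2 ⟨Nat.mul_pos hW (hppos D hD), Nat.le_floor (hqle D hD)⟩
  have hS1 : ∑ D ∈ boundedSubsets P Y, (16 * κ ^ 2) ^ D.card * E D ≤
      7 * (X * ℓ) * (2 * ℓ) ^ K := by
    have h1 := (sum_pow_card_div_prod_le hPp hY K).trans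
      (pow_le_pow_left₀ (by linarith [Real.log_nonneg hY]) hlogY K)
    refine le_trans ?_ (mul_le_mul_of_nonneg_left h1 (by positivity))
    rw [Finset.mul_sum]
    refine Finset.sum_le_sum fun D hD => ?_
    have hφ := apDiscrepancy_le hX3 (Nat.mul_pos hW (hppos D hD)) ((hqle D hD).trans hQX)
    have hDp : ∀ p ∈ D, (2 : ℝ) ≤ p := fun p hp => by
      exact_mod_cast (hPp p (hsub D hD hp)).two_le
    have htot : ((∏ p ∈ D, p : ℕ) : ℝ) ≤ 2 ^ D.card * Nat.totient (W₀ * ∏ p ∈ D, p) := by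
      rw [totient_mul_prod_primes fun p hp => hP p (hsub D hD hp)]
      have h2 : ((∏ p ∈ D, p : ℕ) : ℝ) ≤ 2 ^ D.card * ∏ p ∈ D, ((p : ℝ) - 1) := by
        rw [← Finset.prod_const, ← Finset.prod_mul_distrib]
        push_cast
        exact Finset.prod_le_prod (fun p hp => by linarith [hDp p hp])
          fun p hp => by linarith [hDp p hp]
      have h3 : (1 : ℝ) ≤ Nat.totient W₀ := by exact_mod_cast Nat.totient_pos.2 hW
      have h4 : 0 ≤ 2 ^ D.card * ∏ p ∈ D, ((p : ℝ) - 1) :=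
        mul_nonneg (by positivity) (Finset.prod_nonneg fun p hp => by linarith [hDp p hp])
      nlinarith
    have hd0 : (0 : ℝ) < ((∏ p ∈ D, p : ℕ) : ℝ) := by exact_mod_cast hppos D hD
    have ht0 : (0 : ℝ) < Nat.totient (W₀ * ∏ p ∈ D, p) := by
      exact_mod_cast Nat.totient_pos.2 (Nat.mul_pos hW (hppos D hD))
    have hinv : 1 / (Nat.totient (W₀ * ∏ p ∈ D, p) : ℝ) ≤
        2 ^ D.card / ((∏ p ∈ D, p : ℕ) : ℝ) := by
      rw [div_le_div_iff₀ ht0 hd0]; linarith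
    calc (16 * κ ^ 2) ^ D.card * E D
        ≤ (16 * κ ^ 2) ^ D.card * (7 * (X * ℓ) * (2 ^ D.card / ((∏ p ∈ D, p : ℕ) : ℝ))) := by
          refine mul_le_mul_of_nonneg_left (hφ.trans ?_) (by positivity)
          rw [div_eq_mul_one_div]
          exact mul_le_mul_of_nonneg_left hinv (by positivity)
      _ = 7 * (X * ℓ) * ((32 * κ ^ 2) ^ D.card / ((∏ p ∈ D, p : ℕ) : ℝ)) := by
          rw [show 32 * κ ^ 2 = (16 * κ ^ 2) * 2 by ring, mul_pow (16 * κ ^ 2) 2]; ring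
      _ ≤ 7 * (X * ℓ) * ((K : ℝ) ^ D.card / ((∏ p ∈ D, p : ℕ) : ℝ)) := by
          gcongr
  have hfin : ∑ D ∈ boundedSubsets P Y, (4 * κ) ^ D.card * E D ≤ X / ℓ ^ A := by
    refine le_of_sq_le_sq ?_ (by positivity)
    refine hcs.trans ((mul_le_mul hS1 hS2 (Finset.sum_nonneg fun D _ => hE0 D)
      (by positivity)).trans ?_)
    have e1 : ℓ ^ (2 * A + K + 2) = (ℓ ^ A) ^ 2 * ℓ ^ K * ℓ ^ 2 := by
      rw [Real.rpow_add hℓ0, Real.rpow_add hℓ0, mul_comm 2 A, Real.rpow_mul hℓ0.le]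
      norm_cast
    have hA0 : 0 < ℓ ^ A := Real.rpow_pos_of_pos hℓ0 A
    rw [e1]
    have e2 : 7 * (X * ℓ) * (2 * ℓ) ^ K * (|C| * (X / ((ℓ ^ A) ^ 2 * ℓ ^ K * ℓ ^ 2))) =
        (X / ℓ ^ A) ^ 2 * ((7 * |C| * 2 ^ K) / ℓ) := by
      rw [mul_pow]; field_simp
    rw [e2]
    exact mul_le_of_le_one_right (by positivity) ((div_le_one hℓ0).2 hℓC)
  refine le_trans (Finset.sum_le_sum fun D hD => ?_) hfin
  rw [← mul_assoc, mul_pow]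
  refine mul_le_mul_of_nonneg_right (mul_le_mul_of_nonneg_left ?_ (by positivity)) (hE0 D)
  rw [← Finset.prod_const]
  exact Finset.prod_le_prod (fun _ _ => Nat.cast_nonneg _) fun p hp => hω p (hsub D hD hp)

/-! ### Mertens' first theorem -/

/-- The primes up to `z`. -/
noncomputable def primesUpTo (z : ℝ) : Finset ℕ := (Finset.Icc 1 ⌊z⌋₊).filter Nat.Prime

theorem mem_primesUpTo {z : ℝ} {p : ℕ} : p ∈ primesUpTo z ↔ p.Prime ∧ (p : ℝ) ≤ z := by
  rw [primesUpTo, Finset.mem_filter, Finset.mem_Icc]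
  constructor
  · rintro ⟨⟨h1, h2⟩, h3⟩
    exact ⟨h3, (Nat.le_floor_iff' (by omega)).1 h2⟩
  · rintro ⟨h1, h2⟩
    exact ⟨⟨h1.one_le, Nat.le_floor h2⟩, h1⟩

/-- An upper bound for `∑ log n / n ^ 2`. -/
theorem exists_sum_log_div_sq_le :
    ∃ S : ℝ, 0 ≤ S ∧ ∀ s : Finset ℕ, ∑ n ∈ s, Real.log n / (n : ℝ) ^ 2 ≤ S := by
  have hsum : Summable fun n : ℕ => 2 * (n : ℝ) ^ (-(3 / 2) : ℝ) :=
    (Real.summable_nat_rpow.2 (by norm_num)).mul_left 2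
  refine ⟨∑' n : ℕ, 2 * (n : ℝ) ^ (-(3 / 2) : ℝ), tsum_nonneg fun n => by positivity,
    fun s => le_trans (Finset.sum_le_sum fun n _ => ?_)
      (hsum.sum_le_tsum s fun n _ => by positivity)⟩
  rcases Nat.eq_zero_or_pos n with rfl | hn
  · simp
  have hn0 : (0 : ℝ) < n := by exact_mod_cast hn
  rw [div_le_iff₀ (by positivity), ← Real.rpow_natCast (n : ℝ) 2, mul_assoc,
    ← Real.rpow_add hn0]
  have := Real.log_le_rpow_div hn0.le (show (0 : ℝ) < 1 / 2 by norm_num)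
  norm_num at this ⊢
  linarith

theorem log_factorial_eq_sum (n : ℕ) : Real.log (n.factorial) =
    ∑ p ∈ primesUpTo n, (padicValNat p n.factorial : ℝ) * Real.log p := by
  conv_lhs => rw [← Nat.prod_factorization_pow_eq_self n.factorial_ne_zero]
  rw [Finsupp.prod_of_support_subset (s := primesUpTo n)]
  · push_cast
    rw [Real.log_prod]
    · refine Finset.sum_congr rfl fun p hp => ?_
      rw [Real.log_pow, Nat.factorization_def _ (mem_primesUpTo.1 hp).1]
    · intro p hp
      have := (mem_primesUpTo.1 hp).1.pos
      positivity
  · intro p hp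
    rw [Nat.support_factorization, Nat.mem_primeFactors] at hp
    rw [mem_primesUpTo]
    exact ⟨hp.1, by exact_mod_cast (Nat.Prime.dvd_factorial hp.1).1 hp.2.1⟩
  · simp

theorem log_factorial_le (n : ℕ) : Real.log n.factorial ≤ n * Real.log n := by
  rw [← Real.log_pow]
  refine Real.log_le_log (by exact_mod_cast n.factorial_pos) ?_
  exact_mod_cast Nat.factorial_le_pow n

theorem le_log_factorial {n : ℕ} (hn : 0 < n) : n * Real.log n - n ≤ Real.log n.factorial := by
  have hn0 : (0 : ℝ) < n := by exact_mod_cast hn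
  have h := Real.pow_div_factorial_le_exp (n : ℝ) hn0.le n
  have hf : (0 : ℝ) < n.factorial := by exact_mod_cast n.factorial_pos
  have h2 := Real.log_le_log (by positivity) h
  rw [Real.log_exp, Real.log_div (by positivity) hf.ne', Real.log_pow] at h2
  linarith

/-- Mertens' first theorem. -/
theorem exists_abs_sum_log_div_sub_log_le :
    ∃ C : ℝ, 0 ≤ C ∧ ∀ x : ℝ, 1 ≤ x →
      |∑ p ∈ primesUpTo x, Real.log p / p - Real.log x| ≤ C := by
  obtain ⟨S, hS0, hS⟩ := exists_sum_log_div_sq_le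
  -- Compare log n! = n log n + O(n) with ∑ v_p(n!) log p, where n/p - 1 ≤ v_p(n!) ≤ n/(p-1).
  -- Replacing p - 1 by p costs a multiple of ∑ log p / p².
  have hnat : ∀ n : ℕ, 0 < n →
      |∑ p ∈ primesUpTo n, Real.log p / p - Real.log n| ≤ 1 + 2 * S + Real.log 4 := by
    intro n hn
    have hn0 : (0 : ℝ) < n := by exact_mod_cast hn
    have hlog4 : 0 ≤ Real.log 4 := Real.log_nonneg (by norm_num)
    have hlogp : ∀ p ∈ primesUpTo n, 0 ≤ Real.log p := fun p _ => Real.log_natCast_nonneg p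
    have hpos : ∀ p ∈ primesUpTo n, (2 : ℝ) ≤ p := fun p hp => by
      exact_mod_cast (mem_primesUpTo.1 hp).1.two_le
    have hfac := log_factorial_eq_sum n
    have hup : Real.log n.factorial ≤
        n * (∑ p ∈ primesUpTo n, Real.log p / p + 2 * S) := by
      rw [hfac]
      have hle : ∀ p ∈ primesUpTo n, (padicValNat p n.factorial : ℝ) * Real.log p ≤
          n * (Real.log p / p + 2 * (Real.log p / (p : ℝ) ^ 2)) := by
        intro p hp
        have hp2 := hpos p hp
        have : Fact p.Prime := ⟨(mem_primesUpTo.1 hp).1⟩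
        have h1 : (p - 1) * padicValNat p n.factorial ≤ n := by
          rw [sub_one_mul_padicValNat_factorial]; exact Nat.sub_le _ _
        have h2 : ((p : ℝ) - 1) * padicValNat p n.factorial ≤ n := by
          have h3 : (((p - 1) * padicValNat p n.factorial : ℕ) : ℝ) ≤ n := by exact_mod_cast h1
          rwa [Nat.cast_mul, Nat.cast_pred this.out.pos] at h3
        have h3 : (padicValNat p n.factorial : ℝ) ≤ n / ((p : ℝ) - 1) := by
          rw [le_div_iff₀ (by linarith)]; linarith
        have h4 : 1 / ((p : ℝ) - 1) ≤ 1 / p + 2 / (p : ℝ) ^ 2 := by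
          rw [div_add_div _ _ (by positivity) (by positivity), div_le_div_iff₀ (by linarith)
            (by positivity)]
          nlinarith
        calc (padicValNat p n.factorial : ℝ) * Real.log p
            ≤ n / ((p : ℝ) - 1) * Real.log p := mul_le_mul_of_nonneg_right h3 (hlogp p hp)
          _ = (n * Real.log p) * (1 / ((p : ℝ) - 1)) := by ring
          _ ≤ (n * Real.log p) * (1 / p + 2 / (p : ℝ) ^ 2) :=
            mul_le_mul_of_nonneg_left h4 (mul_nonneg hn0.le (hlogp p hp))
          _ = _ := by ring
      refine (Finset.sum_le_sum hle).trans ?_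
      rw [← Finset.mul_sum, Finset.sum_add_distrib, ← Finset.mul_sum]
      have := hS (primesUpTo n)
      gcongr
    have hlow : n * ∑ p ∈ primesUpTo n, Real.log p / p - Real.log 4 * n ≤
        Real.log n.factorial := by
      -- Chebyshev's bound pays for the -1 in v_p(n!) ≥ n/p - 1.
      have hθ : ∑ p ∈ primesUpTo n, Real.log p ≤ Real.log 4 * n := by
        refine le_trans (le_of_eq ?_) (Chebyshev.theta_le_log4_mul_x hn0.le)
        rw [Chebyshev.theta_eq_sum_Icc, primesUpTo]
        refine Finset.sum_congr (Finset.ext fun p => ?_) fun _ _ => rfl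
        simp only [Finset.mem_filter, Finset.mem_Icc]
        exact ⟨fun h => ⟨⟨zero_le, h.1.2⟩, h.2⟩, fun h => ⟨⟨h.2.one_le, h.1.2⟩, h.2⟩⟩
      refine le_trans (sub_le_sub_left hθ _) ?_
      rw [hfac, Finset.mul_sum, ← Finset.sum_sub_distrib]
      refine Finset.sum_le_sum fun p hp => ?_
      have : Fact p.Prime := ⟨(mem_primesUpTo.1 hp).1⟩
      have hv : n / p ≤ padicValNat p n.factorial := by
        rw [padicValNat_factorial (Nat.lt_succ_of_lt (Nat.lt_succ_self (Nat.log p n)))]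
        have := Finset.single_le_sum (f := fun i => n / p ^ i) (fun _ _ => zero_le)
          (show 1 ∈ Finset.Ico 1 (Nat.log p n).succ.succ by simp)
        simpa using this
      have hv' : (n : ℝ) / p - 1 ≤ padicValNat p n.factorial := by
        have h1 : (n : ℝ) / p < (n / p : ℕ) + 1 := by
          rw [← Nat.floor_div_eq_div (K := ℝ)]; exact Nat.lt_floor_add_one _
        have h2 : ((n / p : ℕ) : ℝ) ≤ padicValNat p n.factorial := by exact_mod_cast hv
        linarith
      have := mul_le_mul_of_nonneg_right hv' (hlogp p hp)
      calc _ = ((n : ℝ) / p - 1) * Real.log p := by ring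
        _ ≤ _ := this
    have h1 := log_factorial_le n
    have h2 := le_log_factorial hn
    set M := ∑ p ∈ primesUpTo n, Real.log p / p
    rw [abs_le]
    constructor
    · have : n * (Real.log n - 1) ≤ n * (M + 2 * S) := by linarith
      have := le_of_mul_le_mul_left this hn0
      linarith
    · have : n * M ≤ n * (Real.log n + Real.log 4) := by linarith
      have := le_of_mul_le_mul_left this hn0
      linarith
  -- The additional log 2 covers the passage from ⌊x⌋ to x.
  refine ⟨1 + 2 * S + Real.log 4 + Real.log 2, by
    have := Real.log_nonneg (show (1 : ℝ) ≤ 4 by norm_num)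
    have := Real.log_nonneg (show (1 : ℝ) ≤ 2 by norm_num)
    positivity, fun x hx => ?_⟩
  have hn : 0 < ⌊x⌋₊ := Nat.floor_pos.2 hx
  have hn0 : (1 : ℝ) ≤ ⌊x⌋₊ := by exact_mod_cast hn
  have e : primesUpTo x = primesUpTo (⌊x⌋₊ : ℝ) := by simp [primesUpTo]
  have h1 : Real.log ⌊x⌋₊ ≤ Real.log x :=
    Real.log_le_log (by linarith) (Nat.floor_le (by linarith))
  have h2 : Real.log x ≤ Real.log 2 + Real.log ⌊x⌋₊ := by
    rw [← Real.log_mul (by norm_num) (by linarith)]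
    refine Real.log_le_log (by linarith) ?_
    have := Nat.lt_floor_add_one x
    linarith
  have h3 := abs_le.1 (hnat _ hn)
  have h4 := Real.log_nonneg (show (1 : ℝ) ≤ 2 by norm_num)
  rw [e, abs_le]
  constructor <;> linarith

/-! ### The exponential integral and sums over primes -/

/-- The integral `∫₀¹ e^{-uv} dv = (1 - e^{-u}) / u`. -/
noncomputable def expMean (u : ℝ) : ℝ := ∫ v in (0 : ℝ)..1, Real.exp (-(u * v))

/-- The entire exponential integral `∫₀ˣ (1 - e^{-u}) / u du`. -/
noncomputable def expEin (x : ℝ) : ℝ := ∫ u in (0 : ℝ)..x, expMean u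

theorem continuous_expMean : Continuous expMean :=
  intervalIntegral.continuous_parametric_intervalIntegral_of_continuous' (by fun_prop) _ _

theorem integral_exp_neg_mul {c : ℝ} (hc : c ≠ 0) (a b : ℝ) :
    ∫ v in a..b, Real.exp (-(c * v)) = (Real.exp (-(c * a)) - Real.exp (-(c * b))) / c := by
  have h : ∀ v ∈ Set.uIcc a b, HasDerivAt (fun v => -(Real.exp (-(c * v)) / c))
      (Real.exp (-(c * v))) v := by
    intro v _
    have h1 : HasDerivAt (fun v => -(c * v)) (-c) v := by
      simpa using ((hasDerivAt_id' v).const_mul c).fun_neg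
    convert! (h1.exp.div_const c).neg using 1
    field_simp
  rw [intervalIntegral.integral_eq_sub_of_hasDerivAt h
    ((by fun_prop : Continuous fun v => Real.exp (-(c * v))).intervalIntegrable _ _)]
  ring

theorem expMean_eq {u : ℝ} (hu : u ≠ 0) : expMean u = (1 - Real.exp (-u)) / u := by
  rw [expMean, integral_exp_neg_mul hu]; simp

theorem hasDerivAt_expEin (x : ℝ) : HasDerivAt expEin (expMean x) x :=
  intervalIntegral.integral_hasDerivAt_right (continuous_expMean.intervalIntegrable _ _)
    continuous_expMean.stronglyMeasurable.stronglyMeasurableAtFilter continuous_expMean.continuousAt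

theorem intervalIntegrable_mul_indicator_le {f : ℝ → ℝ} (hf : Continuous f) (t a b : ℝ) :
    IntervalIntegrable (fun v => f v * if t ≤ v then 1 else 0) MeasureTheory.volume a b := by
  have : (fun v => f v * if t ≤ v then 1 else 0) = Set.indicator (Set.Ici t) f := by
    ext v; by_cases h : t ≤ v <;> simp [h]
  rw [this]
  rw [intervalIntegrable_iff]
  exact ((intervalIntegrable_iff.1 (hf.intervalIntegrable a b))).indicator measurableSet_Ici

theorem integral_mul_indicator_le {u t : ℝ} (ht0 : 0 ≤ t) (ht1 : t ≤ 1) :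
    ∫ v in (0 : ℝ)..1, (u * Real.exp (-(u * v))) * (if t ≤ v then 1 else 0) =
      Real.exp (-(u * t)) - Real.exp (-u) := by
  have hc : Continuous fun v => u * Real.exp (-(u * v)) := by fun_prop
  rw [← intervalIntegral.integral_add_adjacent_intervals
    (intervalIntegrable_mul_indicator_le hc t 0 t) (intervalIntegrable_mul_indicator_le hc t t 1)]
  have h1 : ∫ v in (0 : ℝ)..t, (u * Real.exp (-(u * v))) * (if t ≤ v then 1 else 0) = 0 := by
    rw [intervalIntegral.integral_of_le ht0, MeasureTheory.integral_Ioc_eq_integral_Ioo]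
    rw [MeasureTheory.setIntegral_congr_fun (g := fun _ => (0 : ℝ)) measurableSet_Ioo]
    · simp
    · intro v hv
      simp [not_le.2 hv.2]
  have h2 : ∫ v in t..1, (u * Real.exp (-(u * v))) * (if t ≤ v then 1 else 0) =
      ∫ v in t..1, u * Real.exp (-(u * v)) := by
    refine intervalIntegral.integral_congr fun v hv => ?_
    rw [Set.uIcc_of_le ht1] at hv
    simp [hv.1]
  rw [h1, h2, zero_add, intervalIntegral.integral_const_mul]
  rcases eq_or_ne u 0 with rfl | hu
  · simp
  · rw [integral_exp_neg_mul hu]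
    field_simp

theorem integral_mul_exp_mul_self (u : ℝ) :
    ∫ v in (0 : ℝ)..1, (u * Real.exp (-(u * v))) * v = expMean u - Real.exp (-u) := by
  have h : ∀ v ∈ Set.uIcc (0 : ℝ) 1, HasDerivAt (fun v => -(Real.exp (-(u * v)) * v))
      ((u * Real.exp (-(u * v))) * v - Real.exp (-(u * v))) v := by
    intro v _
    have h1 : HasDerivAt (fun v => -(u * v)) (-u) v := by
      simpa using ((hasDerivAt_id' v).const_mul u).fun_neg
    convert! (h1.exp.mul (hasDerivAt_id v)).neg using 1
    simp only [id]; ring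
  have h2 := intervalIntegral.integral_eq_sub_of_hasDerivAt h
    (Continuous.intervalIntegrable (by fun_prop) _ _)
  rw [intervalIntegral.integral_sub (Continuous.intervalIntegrable (by fun_prop) _ _)
    (Continuous.intervalIntegrable (by fun_prop) _ _)] at h2
  rw [expMean]
  simp at h2
  linarith

/-- By Mertens at z^v, the masses log p/(p log z) at the points log p/log z have distribution
function N(v) = v + O(1/log z) on [0, 1]. Partial summation against e^{-uv} gives errors weighted by
e^{-u} at the endpoint and 1 - e^{-u} in the integral. These add to 1, so the bound is uniform in u.
-/
theorem exists_abs_weighted_sum_sub_expMean_le : ∃ C : ℝ, 0 ≤ C ∧ ∀ z : ℝ, 2 ≤ z → ∀ u : ℝ, 0 ≤ u →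
    |∑ p ∈ primesUpTo z, Real.log p / p / Real.log z * Real.exp (-(u * (Real.log p / Real.log z)))
      - expMean u| ≤ C / Real.log z := by
  obtain ⟨C, hC0, hC⟩ := exists_abs_sum_log_div_sub_log_le
  refine ⟨C, hC0, fun z hz u hu => ?_⟩
  set L := Real.log z with hL
  have hL0 : 0 < L := Real.log_pos (by linarith)
  have hz0 : 0 < z := by linarith
  have ht : ∀ p ∈ primesUpTo z, 0 ≤ Real.log p / L ∧ Real.log p / L ≤ 1 := by
    intro p hp
    rw [mem_primesUpTo] at hp
    have hp0 : (0 : ℝ) < p := by exact_mod_cast hp.1.pos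
    exact ⟨div_nonneg (Real.log_natCast_nonneg p) hL0.le,
      (div_le_one hL0).2 (Real.log_le_log hp0 hp.2)⟩
  set N : ℝ → ℝ := fun v => ∑ p ∈ primesUpTo z,
    Real.log p / p / L * (if Real.log p / L ≤ v then 1 else 0) with hN
  have hNv : ∀ v, 0 ≤ v → v ≤ 1 → |N v - v| ≤ C / L := by
    intro v hv0 hv1
    have h1 := hC (z ^ v) (Real.one_le_rpow (by linarith) hv0)
    rw [Real.log_rpow hz0, ← hL] at h1
    have h2 : N v = (∑ p ∈ primesUpTo (z ^ v), Real.log p / p) / L := by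
      have hs : primesUpTo (z ^ v) = (primesUpTo z).filter fun p : ℕ => Real.log p / L ≤ v := by
        ext p
        rw [Finset.mem_filter, mem_primesUpTo, mem_primesUpTo, div_le_iff₀ hL0]
        have hzv : z ^ v ≤ z := by
          simpa using Real.rpow_le_rpow_of_exponent_le (show 1 ≤ z by linarith) hv1
        constructor
        · rintro ⟨hp, hpz⟩
          have hp0 : (0 : ℝ) < p := by exact_mod_cast hp.pos
          refine ⟨⟨hp, hpz.trans hzv⟩, ?_⟩
          rw [hL, ← Real.log_rpow hz0]
          exact Real.log_le_log hp0 hpz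
        · rintro ⟨⟨hp, -⟩, hpv⟩
          have hp0 : (0 : ℝ) < p := by exact_mod_cast hp.pos
          refine ⟨hp, ?_⟩
          rw [hL, ← Real.log_rpow hz0] at hpv
          exact (Real.log_le_log_iff hp0 (Real.rpow_pos_of_pos hz0 v)).1 hpv
      rw [hs, Finset.sum_filter, Finset.sum_div]
      refine Finset.sum_congr rfl fun p _ => ?_
      split_ifs <;> simp
    rw [h2, show (∑ p ∈ primesUpTo (z ^ v), Real.log p / p) / L - v =
      (∑ p ∈ primesUpTo (z ^ v), Real.log p / p - v * L) / L by field_simp, abs_div,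
      abs_of_pos hL0]
    exact div_le_div_of_nonneg_right h1 hL0.le
  have hcont : Continuous fun v => u * Real.exp (-(u * v)) := by fun_prop
  have hNint : IntervalIntegrable (fun v => (u * Real.exp (-(u * v))) * N v)
      MeasureTheory.volume 0 1 := by
    have : (fun v => (u * Real.exp (-(u * v))) * N v) = ∑ p ∈ primesUpTo z, fun v =>
        (Real.log p / p / L) * ((u * Real.exp (-(u * v))) *
          (if Real.log p / L ≤ v then 1 else 0)) := by
      ext v
      simp only [hN, Finset.sum_apply, Finset.mul_sum]
      exact Finset.sum_congr rfl fun p _ => by ring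
    rw [this]
    exact IntervalIntegrable.sum _ fun p _ =>
      (intervalIntegrable_mul_indicator_le hcont _ _ _).const_mul _
  have hlayer : ∑ p ∈ primesUpTo z, Real.log p / p / L * Real.exp (-(u * (Real.log p / L))) =
      Real.exp (-u) * N 1 + ∫ v in (0 : ℝ)..1, (u * Real.exp (-(u * v))) * N v := by
    have e1 : ∫ v in (0 : ℝ)..1, (u * Real.exp (-(u * v))) * N v = ∑ p ∈ primesUpTo z,
        (Real.log p / p / L) * (Real.exp (-(u * (Real.log p / L))) - Real.exp (-u)) := by
      simp only [hN, Finset.mul_sum]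
      rw [intervalIntegral.integral_finsetSum]
      · refine Finset.sum_congr rfl fun p hp => ?_
        rw [← integral_mul_indicator_le (ht p hp).1 (ht p hp).2,
          ← intervalIntegral.integral_const_mul]
        congr 1
        ext v; ring
      · intro p _
        have := (intervalIntegrable_mul_indicator_le hcont (Real.log p / L) 0 1).const_mul
          (Real.log p / p / L)
        refine this.congr_ae (Filter.Eventually.of_forall fun v => ?_)
        simp only; ring
    have e2 : N 1 = ∑ p ∈ primesUpTo z, Real.log p / p / L := by
      refine Finset.sum_congr rfl fun p hp => ?_
      rw [if_pos (ht p hp).2, mul_one]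
    rw [e1, e2, Finset.mul_sum, ← Finset.sum_add_distrib]
    refine Finset.sum_congr rfl fun p _ => by ring
  have hmean : expMean u = Real.exp (-u) * 1 +
      ∫ v in (0 : ℝ)..1, (u * Real.exp (-(u * v))) * v := by
    rw [integral_mul_exp_mul_self]; ring
  have hidint : IntervalIntegrable (fun v => (u * Real.exp (-(u * v))) * v)
      MeasureTheory.volume 0 1 := Continuous.intervalIntegrable (by fun_prop) _ _
  rw [hlayer, hmean, add_sub_add_comm, ← mul_sub, ← intervalIntegral.integral_sub hNint hidint]
  have hI : |∫ v in (0 : ℝ)..1, ((u * Real.exp (-(u * v))) * N v - (u * Real.exp (-(u * v))) * v)|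
      ≤ (1 - Real.exp (-u)) * (C / L) := by
    have hval : ∫ v in (0 : ℝ)..1, (u * Real.exp (-(u * v))) * (C / L) =
        (1 - Real.exp (-u)) * (C / L) := by
      rw [intervalIntegral.integral_mul_const, intervalIntegral.integral_const_mul]
      rcases eq_or_ne u 0 with rfl | hu
      · simp
      · rw [integral_exp_neg_mul hu]; field_simp; simp; ring
    rw [← hval, ← Real.norm_eq_abs]
    refine intervalIntegral.norm_integral_le_of_norm_le zero_le_one ?_
      (Continuous.intervalIntegrable (by fun_prop) _ _)
    refine Filter.Eventually.of_forall fun v hv => ?_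
    rw [← mul_sub, Real.norm_eq_abs, abs_mul, abs_of_nonneg (by positivity)]
    exact mul_le_mul_of_nonneg_left (hNv v hv.1.le hv.2) (by positivity)
  have h1 := hNv 1 zero_le_one le_rfl
  have hadd := abs_add_le (Real.exp (-u) * (N 1 - 1))
    (∫ v in (0 : ℝ)..1, ((u * Real.exp (-(u * v))) * N v - (u * Real.exp (-(u * v))) * v))
  rw [abs_mul, abs_of_pos (Real.exp_pos _)] at hadd
  have h2 := mul_le_mul_of_nonneg_left h1 (Real.exp_pos (-u)).le
  calc _ ≤ _ := hadd
    _ ≤ Real.exp (-u) * (C / L) + (1 - Real.exp (-u)) * (C / L) := add_le_add h2 hI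
    _ = C / L := by ring

/-- Integrate the previous estimate over 0 ≤ u ≤ m: with t = log p/log z, the integral of t e^{-ut}
is 1 - e^{-mt}, and `expMean` integrates to `expEin`. -/
theorem exists_abs_sum_one_sub_exp_sub_expEin_le : ∃ C : ℝ, 0 ≤ C ∧ ∀ z : ℝ, 2 ≤ z →
    ∀ m : ℝ, 0 ≤ m →
    |∑ p ∈ primesUpTo z, (1 - Real.exp (-(m * (Real.log p / Real.log z)))) / p - expEin m| ≤
      C / Real.log z * m := by
  obtain ⟨C, hC0, hC⟩ := exists_abs_weighted_sum_sub_expMean_le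
  refine ⟨C, hC0, fun z hz m hm => ?_⟩
  set L := Real.log z with hL
  have hL0 : 0 < L := Real.log_pos (by linarith)
  have e : ∑ p ∈ primesUpTo z, (1 - Real.exp (-(m * (Real.log p / L)))) / p =
      ∫ u in (0 : ℝ)..m, ∑ p ∈ primesUpTo z,
        Real.log p / p / L * Real.exp (-(u * (Real.log p / L))) := by
    rw [intervalIntegral.integral_finsetSum
      fun p _ => Continuous.intervalIntegrable (by fun_prop) _ _]
    refine Finset.sum_congr rfl fun p hp => ?_
    have hp := (mem_primesUpTo.1 hp).1
    have hlog : 0 < Real.log p := Real.log_pos (by exact_mod_cast hp.one_lt)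
    have hp0 : (p : ℝ) ≠ 0 := by exact_mod_cast hp.ne_zero
    rw [intervalIntegral.integral_const_mul]
    have : ∫ u in (0 : ℝ)..m, Real.exp (-(u * (Real.log p / L))) =
        (1 - Real.exp (-(m * (Real.log p / L)))) / (Real.log p / L) := by
      simp_rw [mul_comm _ (Real.log p / L)]
      rw [integral_exp_neg_mul (by positivity)]; simp
    rw [this]
    field_simp
  rw [e, expEin, ← intervalIntegral.integral_sub (Continuous.intervalIntegrable (by fun_prop) _ _)
    (continuous_expMean.intervalIntegrable _ _)]
  have := intervalIntegral.norm_integral_le_of_norm_le_const (a := (0 : ℝ)) (b := m) (C := C / L)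
    (f := fun u => ∑ p ∈ primesUpTo z, Real.log p / p / L * Real.exp (-(u * (Real.log p / L)))
      - expMean u) fun u hu => by
        rw [Set.uIoc_of_le hm] at hu
        exact hC z hz u hu.1.le
  simpa [abs_of_nonneg hm] using this

/-! ### The Laplace transform of the extremal random product -/

/-- The largest admissible sieve probabilities in dimension `κ`: `1` for `p ≤ N` and `κ / (p - 1)`
for larger `p`. -/
noncomputable def extremalProb (κ : ℝ) (N p : ℕ) : ℝ := if p ≤ N then 1 else κ / ((p : ℝ) - 1)

theorem extremalProb_mem {κ : ℝ} (hκ : 0 ≤ κ) {N : ℕ} (hN : 2 * κ + 2 ≤ N) (p : ℕ) :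
    0 ≤ extremalProb κ N p ∧ extremalProb κ N p ≤ 1 := by
  rw [extremalProb]
  split_ifs with h
  · norm_num
  · have : (N : ℝ) < p := by exact_mod_cast not_le.1 h
    refine ⟨div_nonneg hκ (by linarith), ?_⟩
    rw [div_le_one (by linarith)]; linarith

theorem abs_log_one_sub_add_le {u : ℝ} (h0 : 0 ≤ u) (h1 : u ≤ 1 / 2) :
    |Real.log (1 - u) + u| ≤ 2 * u ^ 2 := by
  have h := Real.abs_log_sub_add_sum_range_le (x := u) (by rw [abs_of_nonneg h0]; linarith) 1
  simp [abs_of_nonneg h0] at h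
  rw [add_comm]
  refine h.trans ?_
  rw [div_le_iff₀ (by linarith)]
  nlinarith [sq_nonneg u]

/-- For p > N one has g ≤ 1/2, so log(1 - gx) = -gx + O(g²x²), and g differs from κ/p by O(κ/p²).
For p ≤ N everything is O(y), absorbed by N²/p² ≥ 1. In the application y is proportional to log
p/log z, so the errors sum to O(1/log z). -/
theorem abs_log_one_sub_extremalProb_add_le {κ : ℝ} (hκ : 0 ≤ κ) {N : ℕ} (hN : 2 * κ + 2 ≤ N)
    {p : ℕ} (hp : p.Prime) {y : ℝ} (hy : 0 ≤ y) :
    0 < 1 - extremalProb κ N p * (1 - Real.exp (-y)) ∧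
    |Real.log (1 - extremalProb κ N p * (1 - Real.exp (-y))) + κ * ((1 - Real.exp (-y)) / p)| ≤
      ((1 + κ) * (N : ℝ) ^ 2 + 2 * κ + 8 * κ ^ 2) * (y / (p : ℝ) ^ 2) := by
  have hp2 : (2 : ℝ) ≤ p := by exact_mod_cast hp.two_le
  set x := 1 - Real.exp (-y) with hx
  have hx0 : 0 ≤ x := by
    have : Real.exp (-y) ≤ 1 := Real.exp_le_one_iff.2 (by linarith)
    linarith
  have hx1 : x < 1 := by linarith [Real.exp_pos (-y)]
  have hxy : x ≤ y := by linarith [Real.add_one_le_exp (-y)]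
  have hyp : 0 ≤ y / (p : ℝ) ^ 2 := by positivity
  rw [extremalProb]
  split_ifs with h
  · have hpN : (p : ℝ) ≤ N := by exact_mod_cast h
    have e : 1 - 1 * x = Real.exp (-y) := by rw [hx]; ring
    rw [e, Real.log_exp]
    refine ⟨Real.exp_pos _, ?_⟩
    have h1 : κ * (x / p) ≤ κ * y := by
      refine mul_le_mul_of_nonneg_left ?_ hκ
      exact (div_le_self hx0 (by linarith)).trans hxy
    have h0 : 0 ≤ κ * (x / p) := by positivity
    have h2 : y ≤ (N : ℝ) ^ 2 * (y / (p : ℝ) ^ 2) := by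
      rw [mul_div_assoc', le_div_iff₀ (by positivity), mul_comm]
      exact mul_le_mul_of_nonneg_right (pow_le_pow_left₀ (by linarith) hpN 2) hy
    have h3 : (1 + κ) * y ≤ (1 + κ) * ((N : ℝ) ^ 2 * (y / (p : ℝ) ^ 2)) :=
      mul_le_mul_of_nonneg_left h2 (by linarith)
    have h4 : 0 ≤ (2 * κ + 8 * κ ^ 2) * (y / (p : ℝ) ^ 2) := by positivity
    rw [abs_le]
    constructor <;> nlinarith
  · have hNp : (N : ℝ) < p := by exact_mod_cast not_le.1 h
    have hp1 : (0 : ℝ) < (p : ℝ) - 1 := by linarith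
    set g := κ / ((p : ℝ) - 1) with hg
    have hg0 : 0 ≤ g := by positivity
    have hg2 : g ≤ 1 / 2 := by
      rw [hg, div_le_div_iff₀ hp1 (by norm_num)]; linarith
    have hgx : g * x ≤ 1 / 2 := by nlinarith
    have hgx0 : 0 ≤ g * x := by positivity
    refine ⟨by linarith, ?_⟩
    have h1 := abs_log_one_sub_add_le hgx0 hgx
    have hgp : g ≤ 2 * κ / p := by
      rw [hg, div_le_div_iff₀ hp1 (by positivity)]; nlinarith
    have h2 : 2 * (g * x) ^ 2 ≤ 8 * κ ^ 2 * (y / (p : ℝ) ^ 2) := by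
      have h3 : g ^ 2 ≤ (2 * κ / p) ^ 2 := pow_le_pow_left₀ hg0 hgp 2
      have h4 : x ^ 2 ≤ y := by nlinarith
      calc 2 * (g * x) ^ 2 = 2 * (g ^ 2 * x ^ 2) := by ring
        _ ≤ 2 * ((2 * κ / p) ^ 2 * y) := by gcongr
        _ = _ := by field_simp; ring
    have h3 : |g * x - κ * (x / p)| ≤ 2 * κ * (y / (p : ℝ) ^ 2) := by
      have e : g * x - κ * (x / p) = κ * x * (1 / (((p : ℝ) - 1) * p)) := by
        rw [hg]; field_simp; ring
      rw [e, abs_of_nonneg (by positivity)]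
      have h5 : 1 / (((p : ℝ) - 1) * p) ≤ 2 / (p : ℝ) ^ 2 := by
        rw [div_le_div_iff₀ (by positivity) (by positivity)]; nlinarith
      calc κ * x * (1 / (((p : ℝ) - 1) * p)) ≤ κ * y * (2 / (p : ℝ) ^ 2) := by gcongr
        _ = _ := by ring
    have h4 : 0 ≤ (1 + κ) * (N : ℝ) ^ 2 * (y / (p : ℝ) ^ 2) := by positivity
    have h5 : Real.log (1 - g * x) + κ * (x / p) =
        (Real.log (1 - g * x) + g * x) - (g * x - κ * (x / p)) := by ring
    rw [h5]
    refine (abs_sub _ _).trans ?_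
    nlinarith

/-- The limit of the Laplace transform of `log (∏ p) / log z` for the extremal random set of
primes up to `z`. -/
theorem tendsto_prod_one_sub_extremalProb {κ : ℝ} (hκ : 0 ≤ κ) {N : ℕ} (hN : 2 * κ + 2 ≤ N)
    {m : ℝ} (hm : 0 ≤ m) :
    Tendsto (fun z : ℝ => ∏ p ∈ primesUpTo z,
      (1 - extremalProb κ N p * (1 - Real.exp (-(m * (Real.log p / Real.log z)))))) atTop
      (𝓝 (Real.exp (-(κ * expEin m)))) := by
  obtain ⟨S, hS0, hS⟩ := exists_sum_log_div_sq_le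
  obtain ⟨C, hC0, hC⟩ := exists_abs_sum_one_sub_exp_sub_expEin_le
  set K := (1 + κ) * (N : ℝ) ^ 2 + 2 * κ + 8 * κ ^ 2 with hK
  have hK0 : 0 ≤ K := by positivity
  have hpos : ∀ z : ℝ, 2 ≤ z → ∀ p ∈ primesUpTo z, 0 ≤ m * (Real.log p / Real.log z) := by
    intro z hz p _
    have := Real.log_pos (show (1 : ℝ) < z by linarith)
    have := Real.log_natCast_nonneg p
    positivity
  have hbound : ∀ z : ℝ, 2 ≤ z → |Real.log (∏ p ∈ primesUpTo z,
      (1 - extremalProb κ N p * (1 - Real.exp (-(m * (Real.log p / Real.log z)))))) +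
      κ * expEin m| ≤ (K * m * S + κ * C * m) / Real.log z := by
    intro z hz
    have hL := Real.log_pos (show (1 : ℝ) < z by linarith)
    rw [Real.log_prod fun p hp => (abs_log_one_sub_extremalProb_add_le hκ hN
      (mem_primesUpTo.1 hp).1 (hpos z hz p hp)).1.ne']
    have h1 : |∑ p ∈ primesUpTo z, (Real.log (1 - extremalProb κ N p *
        (1 - Real.exp (-(m * (Real.log p / Real.log z))))) +
        κ * ((1 - Real.exp (-(m * (Real.log p / Real.log z)))) / p))| ≤
        K * m * S / Real.log z := by
      refine (Finset.abs_sum_le_sum_abs _ _).trans ((Finset.sum_le_sum fun p hp =>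
        (abs_log_one_sub_extremalProb_add_le hκ hN (mem_primesUpTo.1 hp).1
          (hpos z hz p hp)).2).trans ?_)
      have e : ∀ p : ℕ, K * (m * (Real.log p / Real.log z) / (p : ℝ) ^ 2) =
        K * m / Real.log z * (Real.log p / (p : ℝ) ^ 2) := fun p => by ring
      rw [Finset.sum_congr rfl fun p _ => e p, ← Finset.mul_sum]
      calc _ ≤ K * m / Real.log z * S := mul_le_mul_of_nonneg_left (hS _) (by positivity)
        _ = _ := by ring
    have h2 := hC z hz m hm
    rw [Finset.sum_add_distrib, ← Finset.mul_sum] at h1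
    set U := ∑ p ∈ primesUpTo z, (1 - Real.exp (-(m * (Real.log p / Real.log z)))) / p
    set V := ∑ p ∈ primesUpTo z, Real.log (1 - extremalProb κ N p *
        (1 - Real.exp (-(m * (Real.log p / Real.log z)))))
    have e : V + κ * expEin m = (V + κ * U) - κ * (U - expEin m) := by ring
    rw [e]
    refine (abs_sub _ _).trans ?_
    rw [abs_mul, abs_of_nonneg hκ, add_div]
    refine add_le_add h1 ((mul_le_mul_of_nonneg_left h2 hκ).trans (le_of_eq ?_))
    ring
  have hlog : Tendsto (fun z : ℝ => Real.log (∏ p ∈ primesUpTo z,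
      (1 - extremalProb κ N p * (1 - Real.exp (-(m * (Real.log p / Real.log z))))))) atTop
      (𝓝 (-(κ * expEin m))) := by
    rw [tendsto_iff_norm_sub_tendsto_zero]
    refine squeeze_zero' (Eventually.of_forall fun _ => norm_nonneg _) ?_
      (Tendsto.const_div_atTop Real.tendsto_log_atTop (K * m * S + κ * C * m))
    filter_upwards [eventually_ge_atTop 2] with z hz
    rw [sub_neg_eq_add, Real.norm_eq_abs]
    exact hbound z hz
  refine ((Real.continuous_exp.tendsto _).comp hlog).congr' ?_
  filter_upwards [eventually_ge_atTop 2] with z hz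
  exact Real.exp_log (Finset.prod_pos fun p hp => (abs_log_one_sub_extremalProb_add_le hκ hN
    (mem_primesUpTo.1 hp).1 (hpos z hz p hp)).1)

open MeasureTheory in
theorem integral_exp_mul_indicator_le {m d : ℝ} (hm : 0 < m) (hd : 0 ≤ d) :
    IntegrableOn (fun s => Real.exp (-(m * s)) * if d ≤ s then 1 else 0) (Set.Ioi 0) ∧
    ∫ s in Set.Ioi 0, Real.exp (-(m * s)) * (if d ≤ s then 1 else 0) =
      Real.exp (-(m * d)) / m := by
  have e : (fun s => Real.exp (-(m * s)) * if d ≤ s then 1 else 0) =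
      Set.indicator (Set.Ici d) fun s => Real.exp (-m * s) := by
    ext s; by_cases h : d ≤ s <;> simp [h]
  have hint : IntegrableOn (fun s => Real.exp (-m * s)) (Set.Ioi d) :=
    integrableOn_exp_mul_Ioi (neg_lt_zero.2 hm) d
  rw [e]
  constructor
  · exact (integrableOn_exp_mul_Ioi (neg_lt_zero.2 hm) 0).indicator measurableSet_Ici
  · rw [setIntegral_indicator measurableSet_Ici]
    have : ∫ s in Set.Ioi 0 ∩ Set.Ici d, Real.exp (-m * s) = ∫ s in Set.Ioi d,
        Real.exp (-m * s) := by
      rcases hd.eq_or_lt with rfl | hd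
      · rw [Set.inter_eq_left.2 Set.Ioi_subset_Ici_self]
      · rw [Set.inter_eq_right.2 (Set.Ici_subset_Ioi.2 hd), integral_Ici_eq_integral_Ioi]
    rw [this, integral_exp_mul_Ioi (neg_lt_zero.2 hm)]
    rw [neg_div_neg_eq, neg_mul]

open MeasureTheory in
-- The integrand contains the distribution function of D = log(∏ p)/log z, so its transform at m is
-- E[e^{-mD}]/m. Since e^{-mD} factors over the chosen primes, the expectation is a product.
theorem integral_exp_mul_productProb {g : ℕ → ℝ} {z : ℝ} (hz : 2 ≤ z) {m : ℝ} (hm : 0 < m) :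
    ∫ s in Set.Ioi 0, Real.exp (-(m * s)) * productProb g (primesUpTo z) (z ^ s) =
      (∏ p ∈ primesUpTo z, (1 - g p * (1 - Real.exp (-(m * (Real.log p / Real.log z)))))) / m := by
  have hL := Real.log_pos (show (1 : ℝ) < z by linarith)
  have hz0 : 0 < z := by linarith
  have hpos : ∀ T ⊆ primesUpTo z, (1 : ℝ) ≤ (∏ p ∈ T, p : ℕ) := fun T hT => by
    exact_mod_cast Finset.prod_pos fun p hp => (mem_primesUpTo.1 (hT hp)).1.pos
  set w : Finset ℕ → ℝ := fun T => (∏ p ∈ T, g p) * ∏ p ∈ primesUpTo z \ T, (1 - g p) with hw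
  set d : Finset ℕ → ℝ := fun T => Real.log ((∏ p ∈ T, p : ℕ) : ℝ) / Real.log z with hd
  have hd0 : ∀ T ⊆ primesUpTo z, 0 ≤ d T := fun T hT =>
    div_nonneg (Real.log_nonneg (hpos T hT)) hL.le
  have hiff : ∀ T ⊆ primesUpTo z, ∀ s, ((∏ p ∈ T, p : ℕ) : ℝ) ≤ z ^ s ↔ d T ≤ s := by
    intro T hT s
    rw [hd, div_le_iff₀ hL, ← Real.log_rpow hz0, Real.log_le_log_iff
      (by linarith [hpos T hT]) (Real.rpow_pos_of_pos hz0 s)]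
  have e1 : ∀ s, Real.exp (-(m * s)) * productProb g (primesUpTo z) (z ^ s) =
      ∑ T ∈ (primesUpTo z).powerset,
        w T * (Real.exp (-(m * s)) * if d T ≤ s then 1 else 0) := by
    intro s
    rw [productProb, bernoulliSum, Finset.mul_sum]
    refine Finset.sum_congr rfl fun T hT => ?_
    simp only [hiff T (Finset.mem_powerset.1 hT) s, hw]
    ring
  simp_rw [e1]
  rw [integral_finsetSum _ fun T hT =>
    (integral_exp_mul_indicator_le hm (hd0 T (Finset.mem_powerset.1 hT))).1.const_mul _]
  have e2 : ∀ T ∈ (primesUpTo z).powerset, ∫ s in Set.Ioi 0,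
      w T * (Real.exp (-(m * s)) * if d T ≤ s then 1 else 0) =
      w T * (∏ p ∈ primesUpTo z, if p ∈ T then Real.exp (-(m * (Real.log p / Real.log z)))
        else 1) / m := by
    intro T hT
    rw [Finset.mem_powerset] at hT
    rw [integral_const_mul, (integral_exp_mul_indicator_le hm (hd0 T hT)).2, Finset.prod_ite_mem,
      Finset.inter_eq_right.2 hT, ← Real.exp_sum, mul_div_assoc]
    congr 3
    rw [hd]
    push_cast
    rw [Real.log_prod fun p hp => by
      have := (mem_primesUpTo.1 (hT hp)).1.pos
      positivity, Finset.sum_div, Finset.mul_sum, Finset.sum_neg_distrib]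
  rw [Finset.sum_congr rfl e2, ← Finset.sum_div]
  congr 1
  have := bernoulliSum_prod g (fun p => Real.exp (-(m * (Real.log p / Real.log z)))) (fun _ => 1)
    (primesUpTo z)
  rw [bernoulliSum] at this
  simp only [hw]
  rw [this]
  exact Finset.prod_congr rfl fun p _ => by ring

/-! ### The delay function j_κ: continuity, delay equation, growth -/

/-- The constant `e^{-γκ} / Γ(κ + 1)`. -/
noncomputable def selbergConst (κ : ℝ) : ℝ :=
  Real.exp (-(κ * Real.eulerMascheroniConstant)) / Real.Gamma (κ + 1)

theorem selbergConst_pos {κ : ℝ} (hκ : 0 ≤ κ) : 0 < selbergConst κ :=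
  div_pos (Real.exp_pos _) (Real.Gamma_pos_of_pos (by linarith))

theorem selbergStep_zero_eq {κ : ℝ} (hκ : 0 < κ) (s : ℝ) :
    selbergStep κ 0 s = (max s 0) ^ κ * selbergConst κ := by
  rw [selbergStep]
  split_ifs with h
  · rw [max_eq_right h, Real.zero_rpow hκ.ne', zero_mul]
  · rw [max_eq_left (not_le.1 h).le, selbergConst, mul_comm]

/-- Truncation by `max` removes the case distinction, so continuity can be proved by composition.
Positivity of `κ` matters: it makes 0^κ vanish. -/
theorem selbergStep_succ_eq {κ : ℝ} (hκ : 0 < κ) (n : ℕ) (s : ℝ) :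
    selbergStep κ (n + 1) s = (max s 0) ^ κ * (selbergConst κ -
      κ * ∫ t in (1 : ℝ)..max s 1, (max t 1) ^ (-κ - 1) * selbergStep κ n (t - 1)) := by
  rw [selbergStep]
  split_ifs with h h1
  · rw [max_eq_right h, Real.zero_rpow hκ.ne', zero_mul]
  · rw [max_eq_left (not_le.1 h).le, max_eq_right h1, intervalIntegral.integral_same,
      selbergConst]
    ring
  · rw [max_eq_left (not_le.1 h).le, max_eq_left (not_le.1 h1).le, selbergConst]
    congr 3
    refine intervalIntegral.integral_congr fun t ht => ?_
    rw [Set.uIcc_of_le (not_le.1 h1).le] at ht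
    simp only [max_eq_left ht.1]

theorem continuous_max_one_rpow (a : ℝ) : Continuous fun t : ℝ => (max t 1) ^ a :=
  (continuous_id.max continuous_const).rpow_const fun t =>
    Or.inl (lt_of_lt_of_le one_pos (le_max_right t 1)).ne'

theorem continuous_max_zero_rpow {a : ℝ} (ha : 0 ≤ a) : Continuous fun t : ℝ => (max t 0) ^ a :=
  (continuous_id.max continuous_const).rpow_const fun _ => Or.inr ha

theorem continuous_selbergStep {κ : ℝ} (hκ : 0 < κ) (n : ℕ) : Continuous (selbergStep κ n) := by
  induction n with
  | zero =>
    rw [funext (selbergStep_zero_eq hκ)]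
    exact (continuous_max_zero_rpow hκ.le).mul continuous_const
  | succ n ih =>
    rw [funext (selbergStep_succ_eq hκ n)]
    have hF : Continuous fun t : ℝ => (max t 1) ^ (-κ - 1) * selbergStep κ n (t - 1) :=
      (continuous_max_one_rpow _).mul (ih.comp (by fun_prop))
    have hI : Continuous fun s : ℝ =>
        ∫ t in (1 : ℝ)..s, (max t 1) ^ (-κ - 1) * selbergStep κ n (t - 1) :=
      intervalIntegral.continuous_primitive (fun a b => hF.intervalIntegrable a b) 1
    exact (continuous_max_zero_rpow hκ.le).mul
      (continuous_const.sub (continuous_const.mul (hI.comp (continuous_id.max continuous_const))))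

/-- The recursion at `s` only uses arguments up to `s - 1`, so each stage extends the range of
agreement by one unit. -/
theorem selbergStep_succ_eq_self {κ : ℝ} (hκ : 0 < κ) (n : ℕ) {s : ℝ} (hs : s ≤ n + 1) :
    selbergStep κ (n + 1) s = selbergStep κ n s := by
  induction n generalizing s with
  | zero =>
    rw [selbergStep_succ_eq hκ, selbergStep_zero_eq hκ, max_eq_right (by simpa using hs : s ≤ 1)]
    simp
  | succ n ih =>
    rw [selbergStep_succ_eq hκ, selbergStep_succ_eq hκ n]
    congr 3
    refine intervalIntegral.integral_congr fun t ht => ?_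
    rw [Set.uIcc_of_le (le_max_right _ _)] at ht
    rw [ih]
    have h1 : max s 1 ≤ n + 2 := max_le (by push_cast at hs; linarith) (by linarith [(Nat.cast_nonneg n : (0 : ℝ) ≤ n)])
    linarith [ht.2]

theorem selbergStep_eq_of_le {κ : ℝ} (hκ : 0 < κ) {n k : ℕ} (hnk : n ≤ k) {s : ℝ}
    (hs : s ≤ n + 1) : selbergStep κ k s = selbergStep κ n s := by
  induction k, hnk using Nat.le_induction with
  | base => rfl
  | succ k hk ih =>
    rw [selbergStep_succ_eq_self hκ k, ih]
    have : (n : ℝ) ≤ k := by exact_mod_cast hk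
    linarith

theorem selbergJ_eq_selbergStep {κ : ℝ} (hκ : 0 < κ) {n : ℕ} {s : ℝ} (hs : s ≤ n + 1) :
    selbergJ κ s = selbergStep κ n s := by
  rw [selbergJ]
  rcases le_total n ⌈s⌉₊ with h | h
  · exact selbergStep_eq_of_le hκ h hs
  · exact (selbergStep_eq_of_le hκ h (by linarith [Nat.le_ceil s])).symm

theorem continuous_selbergJ {κ : ℝ} (hκ : 0 < κ) : Continuous (selbergJ κ) := by
  refine continuous_iff_continuousAt.2 fun s => ?_
  refine (continuous_selbergStep hκ ⌈s⌉₊).continuousAt.congr ?_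
  have hs : s < (⌈s⌉₊ : ℝ) + 1 := by linarith [Nat.le_ceil s]
  filter_upwards [Iio_mem_nhds hs] with t ht
  exact (selbergJ_eq_selbergStep hκ (le_of_lt ht)).symm

theorem selbergJ_of_nonpos (κ : ℝ) {s : ℝ} (hs : s ≤ 0) : selbergJ κ s = 0 := by
  rw [selbergJ, Nat.ceil_eq_zero.2 hs, selbergStep, if_pos hs]

theorem selbergJ_of_le_one {κ : ℝ} (hκ : 0 < κ) {s : ℝ} (hs : s ≤ 1) :
    selbergJ κ s = (max s 0) ^ κ * selbergConst κ := by
  rw [selbergJ_eq_selbergStep hκ (n := 0) (by simpa using hs), selbergStep_zero_eq hκ]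

/-- The integrated form of the differential-delay equation. -/
theorem selbergJ_eq {κ : ℝ} (hκ : 0 < κ) {s : ℝ} (hs : 0 ≤ s) :
    selbergJ κ s = s ^ κ * (selbergConst κ -
      κ * ∫ t in (1 : ℝ)..s, (max t 1) ^ (-κ - 1) * selbergJ κ (t - 1)) := by
  rcases le_total s 1 with h1 | h1
  · rw [selbergJ_of_le_one hκ h1, max_eq_left hs]
    have : ∫ t in (1 : ℝ)..s, (max t 1) ^ (-κ - 1) * selbergJ κ (t - 1) =
        ∫ t in (1 : ℝ)..s, 0 := by
      refine intervalIntegral.integral_congr fun t ht => ?_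
      rw [Set.uIcc_of_ge h1] at ht
      rw [selbergJ_of_nonpos κ (by linarith [ht.2]), mul_zero]
    rw [this]; simp
  · rw [selbergJ_eq_selbergStep hκ (n := ⌈s⌉₊ + 1)
      (by push_cast; linarith [Nat.le_ceil s]), selbergStep_succ_eq hκ, max_eq_left hs,
      max_eq_left h1]
    congr 3
    refine intervalIntegral.integral_congr fun t ht => ?_
    rw [Set.uIcc_of_le h1] at ht
    rw [selbergJ_eq_selbergStep hκ (n := ⌈s⌉₊) (by linarith [Nat.le_ceil s, ht.2])]

/-- One formula also covers (0, 1], because j_κ(s - 1) = 0 there; in particular there is no corner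
at s = 1. -/
theorem hasDerivAt_selbergJ {κ : ℝ} (hκ : 0 < κ) {s : ℝ} (hs : 0 < s) :
    HasDerivAt (selbergJ κ) (κ * (selbergJ κ s - selbergJ κ (s - 1)) / s) s := by
  have hF : Continuous fun t : ℝ => (max t 1) ^ (-κ - 1) * selbergJ κ (t - 1) :=
    (continuous_max_one_rpow _).mul ((continuous_selbergJ hκ).comp (by fun_prop))
  have hI : HasDerivAt (fun s : ℝ => ∫ t in (1 : ℝ)..s, (max t 1) ^ (-κ - 1) * selbergJ κ (t - 1))
      ((max s 1) ^ (-κ - 1) * selbergJ κ (s - 1)) s :=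
    intervalIntegral.integral_hasDerivAt_right (hF.intervalIntegrable _ _)
      hF.stronglyMeasurable.stronglyMeasurableAtFilter hF.continuousAt
  have h1 := (Real.hasDerivAt_rpow_const (p := κ) (Or.inl hs.ne')).mul
    ((hI.const_mul κ).const_sub (selbergConst κ))
  refine (h1.congr_of_eventuallyEq ?_).congr_deriv ?_
  · filter_upwards [Ioi_mem_nhds hs] with t ht
    exact selbergJ_eq hκ (le_of_lt ht)
  · have e1 : (max s 1) ^ (-κ - 1) * selbergJ κ (s - 1) =
        s ^ (-κ - 1) * selbergJ κ (s - 1) := by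
      rcases le_total s 1 with h | h
      · rw [selbergJ_of_nonpos κ (by linarith : s - 1 ≤ 0)]; simp
      · rw [max_eq_left h]
    rw [e1, selbergJ_eq hκ hs.le]
    have e2 : s ^ κ * s ^ (-κ - 1) = 1 / s := by
      rw [← Real.rpow_add hs, show κ + (-κ - 1) = -1 by ring, Real.rpow_neg_one, one_div]
    rw [Real.rpow_sub_one hs.ne']
    set Q := selbergConst κ - κ * ∫ t in (1 : ℝ)..s, (max t 1) ^ (-κ - 1) * selbergJ κ (t - 1)
    calc κ * (s ^ κ / s) * Q + s ^ κ * -(κ * (s ^ (-κ - 1) * selbergJ κ (s - 1)))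
        = κ * (s ^ κ / s) * Q - κ * (s ^ κ * s ^ (-κ - 1)) * selbergJ κ (s - 1) := by ring
      _ = _ := by rw [e2]; ring

/-- The bound reproduces itself: inserting it into the integral gives at most c(S^κ - 1)/κ, with c =
`selbergConst κ` and S = max(s, 1), and κ times this plus the initial constant c is exactly cS^κ.
Being uniform in `n`, it gives polynomial growth of j_κ. -/
theorem abs_selbergStep_le {κ : ℝ} (hκ : 0 < κ) (n : ℕ) (s : ℝ) :
    |selbergStep κ n s| ≤ selbergConst κ * ((max s 0) ^ κ * (max s 1) ^ κ) := by
  have hc := selbergConst_pos hκ.le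
  have h1 : ∀ s : ℝ, (1 : ℝ) ≤ (max s 1) ^ κ := fun s => Real.one_le_rpow (le_max_right _ _) hκ.le
  have h0 : ∀ s : ℝ, (0 : ℝ) ≤ (max s 0) ^ κ := fun s => Real.rpow_nonneg (le_max_right _ _) _
  induction n generalizing s with
  | zero =>
    rw [selbergStep_zero_eq hκ, abs_of_nonneg (mul_nonneg (h0 s) hc.le), mul_comm]
    exact mul_le_mul_of_nonneg_left (le_mul_of_one_le_right (h0 s) (h1 s)) hc.le
  | succ n ih =>
    rw [selbergStep_succ_eq hκ, abs_mul, abs_of_nonneg (h0 s)]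
    set S := max s 1 with hS
    have hS1 : 1 ≤ S := le_max_right _ _
    have hint : |∫ t in (1 : ℝ)..S, (max t 1) ^ (-κ - 1) * selbergStep κ n (t - 1)| ≤
        selbergConst κ * ((S ^ κ - 1) / κ) := by
      have hval : ∫ t in (1 : ℝ)..S, selbergConst κ * t ^ (κ - 1) =
          selbergConst κ * ((S ^ κ - 1) / κ) := by
        rw [intervalIntegral.integral_const_mul, integral_rpow (Or.inl (by linarith))]
        simp
      rw [← hval, ← Real.norm_eq_abs]
      refine intervalIntegral.norm_integral_le_of_norm_le hS1 ?_ ?_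
      · refine Eventually.of_forall fun t ht => ?_
        have ht0 : 0 < t := by linarith [ht.1]
        rw [max_eq_left ht.1.le, Real.norm_eq_abs, abs_mul, abs_of_pos (Real.rpow_pos_of_pos ht0 _)]
        have hb : (max (t - 1) 0) ^ κ * (max (t - 1) 1) ^ κ ≤ t ^ κ * t ^ κ := by
          refine mul_le_mul ?_ ?_ ?_ (by positivity)
          · exact Real.rpow_le_rpow (le_max_right _ _) (max_le (by linarith) ht0.le) hκ.le
          · exact Real.rpow_le_rpow (by positivity) (max_le (by linarith) ht.1.le) hκ.le
          · exact Real.rpow_nonneg (le_trans zero_le_one (le_max_right _ _)) _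
        calc t ^ (-κ - 1) * |selbergStep κ n (t - 1)|
            ≤ t ^ (-κ - 1) * (selbergConst κ * (t ^ κ * t ^ κ)) := by
              refine mul_le_mul_of_nonneg_left ((ih _).trans ?_) (by positivity)
              exact mul_le_mul_of_nonneg_left hb hc.le
          _ = selbergConst κ * t ^ (κ - 1) := by
              rw [← Real.rpow_add ht0, mul_left_comm, ← Real.rpow_add ht0]
              congr 2; ring
      · refine ContinuousOn.intervalIntegrable ?_
        rw [Set.uIcc_of_le hS1]
        refine ContinuousOn.mul continuousOn_const (ContinuousOn.rpow_const continuousOn_id ?_)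
        exact fun t ht => Or.inl (lt_of_lt_of_le one_pos ht.1).ne'
    have h3 : |selbergConst κ - κ * ∫ t in (1 : ℝ)..S,
        (max t 1) ^ (-κ - 1) * selbergStep κ n (t - 1)| ≤ selbergConst κ * S ^ κ := by
      refine (abs_sub _ _).trans ?_
      rw [abs_mul, abs_of_pos hc, abs_of_pos hκ]
      have := mul_le_mul_of_nonneg_left hint hκ.le
      have e : κ * (selbergConst κ * ((S ^ κ - 1) / κ)) = selbergConst κ * S ^ κ - selbergConst κ := by
        field_simp
      linarith
    calc _ ≤ (max s 0) ^ κ * (selbergConst κ * S ^ κ) := mul_le_mul_of_nonneg_left h3 (h0 s)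
      _ = _ := by ring

/-- A function is polynomially bounded on `[0, ∞)`. -/
def PolyBounded (f : ℝ → ℝ) : Prop := ∃ (D : ℝ) (M : ℕ), ∀ s, 0 ≤ s → |f s| ≤ D * (1 + s) ^ M

theorem polyBounded_selbergJ {κ : ℝ} (hκ : 0 < κ) : PolyBounded (selbergJ κ) := by
  obtain ⟨M, hM⟩ := exists_nat_ge (2 * κ)
  refine ⟨selbergConst κ, M, fun s hs => ?_⟩
  rw [selbergJ]
  refine (abs_selbergStep_le hκ _ s).trans ?_
  refine mul_le_mul_of_nonneg_left ?_ (selbergConst_pos hκ.le).le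
  calc (max s 0) ^ κ * (max s 1) ^ κ ≤ (1 + s) ^ κ * (1 + s) ^ κ := by
        refine mul_le_mul ?_ ?_ ?_ (by positivity)
        · exact Real.rpow_le_rpow (le_max_right _ _) (max_le (by linarith) (by linarith)) hκ.le
        · exact Real.rpow_le_rpow (le_trans zero_le_one (le_max_right _ _))
            (max_le (by linarith) (by linarith)) hκ.le
        · exact Real.rpow_nonneg (le_trans zero_le_one (le_max_right _ _)) _
    _ = (1 + s) ^ (2 * κ) := by rw [← Real.rpow_add (by linarith)]; congr 1; ring
    _ ≤ (1 + s) ^ (M : ℝ) := Real.rpow_le_rpow_of_exponent_le (by linarith) hM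
    _ = (1 + s) ^ M := Real.rpow_natCast _ _

/-! ### The Laplace transform of j_κ -/

/-- The Laplace transform on `[0, ∞)`. -/
noncomputable def laplaceTransform (f : ℝ → ℝ) (x : ℝ) : ℝ :=
  ∫ s in Set.Ioi 0, Real.exp (-(x * s)) * f s

theorem PolyBounded.mul {f g : ℝ → ℝ} (hf : PolyBounded f) (hg : PolyBounded g) :
    PolyBounded fun s => f s * g s := by
  obtain ⟨D, M, hD⟩ := hf
  obtain ⟨D', M', hD'⟩ := hg
  refine ⟨D * D', M + M', fun s hs => ?_⟩
  rw [abs_mul, pow_add]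
  calc |f s| * |g s| ≤ (D * (1 + s) ^ M) * (D' * (1 + s) ^ M') :=
        mul_le_mul (hD s hs) (hD' s hs) (abs_nonneg _) ((abs_nonneg _).trans (hD s hs))
    _ = _ := by ring

theorem PolyBounded.add {f g : ℝ → ℝ} (hf : PolyBounded f) (hg : PolyBounded g) :
    PolyBounded fun s => f s + g s := by
  obtain ⟨D, M, hD⟩ := hf
  obtain ⟨D', M', hD'⟩ := hg
  refine ⟨|D| + |D'|, M + M', fun s hs => (abs_add_le _ _).trans ?_⟩
  have h1 : (1 : ℝ) ≤ 1 + s := by linarith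
  have a1 : (1 + s) ^ M ≤ (1 + s) ^ (M + M') := pow_le_pow_right₀ h1 (by omega)
  have a2 : (1 + s) ^ M' ≤ (1 + s) ^ (M + M') := pow_le_pow_right₀ h1 (by omega)
  have b1 : D * (1 + s) ^ M ≤ |D| * (1 + s) ^ (M + M') :=
    mul_le_mul (le_abs_self D) a1 (by positivity) (abs_nonneg _)
  have b2 : D' * (1 + s) ^ M' ≤ |D'| * (1 + s) ^ (M + M') :=
    mul_le_mul (le_abs_self D') a2 (by positivity) (abs_nonneg _)
  linarith [hD s hs, hD' s hs]

theorem polyBounded_const (c : ℝ) : PolyBounded fun _ => c :=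
  ⟨|c|, 0, fun s _ => by simp⟩

theorem polyBounded_id : PolyBounded fun s => s :=
  ⟨1, 1, fun s hs => by rw [abs_of_nonneg hs]; linarith⟩

theorem PolyBounded.isBigO {f : ℝ → ℝ} (hf : PolyBounded f) {b : ℝ} (hb : 0 < b) :
    f =O[atTop] fun s => Real.exp (b * s) := by
  obtain ⟨D, M, hD⟩ := hf
  have h1 : f =O[atTop] fun s : ℝ => s ^ M := by
    refine Asymptotics.IsBigO.of_bound (|D| * 2 ^ M) ?_
    filter_upwards [eventually_ge_atTop 1] with s hs
    rw [Real.norm_eq_abs, norm_pow, Real.norm_eq_abs, abs_of_nonneg (by linarith : (0 : ℝ) ≤ s),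
      mul_assoc, ← mul_pow]
    refine (hD s (by linarith)).trans (mul_le_mul (le_abs_self D) ?_ (by positivity)
      (abs_nonneg _))
    exact pow_le_pow_left₀ (by linarith) (by linarith) M
  exact h1.trans (isLittleO_pow_exp_pos_mul_atTop M hb).isBigO

open MeasureTheory in
theorem PolyBounded.integrableOn {f : ℝ → ℝ} (hf : PolyBounded f) (hc : Continuous f) {x : ℝ}
    (hx : 0 < x) : IntegrableOn (fun s => Real.exp (-(x * s)) * f s) (Set.Ioi 0) := by
  refine integrable_of_isBigO_exp_neg (b := x / 2) (by linarith)
    (Continuous.continuousOn (by fun_prop)) ?_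
  have h := (Asymptotics.isBigO_refl (fun s => Real.exp (-(x * s))) atTop).mul
    (hf.isBigO (show 0 < x / 2 by linarith))
  refine h.congr_right fun s => ?_
  rw [← Real.exp_add]; congr 1; ring

theorem PolyBounded.tendsto_zero {f : ℝ → ℝ} (hf : PolyBounded f) {x : ℝ} (hx : 0 < x) :
    Tendsto (fun s => Real.exp (-(x * s)) * f s) atTop (𝓝 0) := by
  have h := (Asymptotics.isBigO_refl (fun s => Real.exp (-(x * s))) atTop).mul
    (hf.isBigO (show 0 < x / 2 by linarith))
  refine h.trans_tendsto ?_
  have h2 : Tendsto (fun s : ℝ => (x / 2) * s) atTop atTop :=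
    tendsto_id.const_mul_atTop (by linarith)
  refine (Real.tendsto_exp_neg_atTop_nhds_zero.comp h2).congr fun s => ?_
  simp only [Function.comp]
  rw [← Real.exp_add]; congr 1; ring

open MeasureTheory in
theorem hasDerivAt_laplaceTransform {f : ℝ → ℝ} (hf : PolyBounded f) (hc : Continuous f) {x : ℝ}
    (hx : 0 < x) : HasDerivAt (laplaceTransform f) (-laplaceTransform (fun s => s * f s) x) x := by
  have hsf : PolyBounded fun s => s * f s := polyBounded_id.mul hf
  have hm : ∀ y : ℝ, AEStronglyMeasurable (fun s => Real.exp (-(y * s)) * f s)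
      (volume.restrict (Set.Ioi 0)) := fun y =>
    (Continuous.aestronglyMeasurable (by fun_prop))
  have h := hasDerivAt_integral_of_dominated_loc_of_deriv_le (𝕜 := ℝ)
    (μ := volume.restrict (Set.Ioi (0 : ℝ)))
    (F := fun y s => Real.exp (-(y * s)) * f s)
    (F' := fun y s => -(Real.exp (-(y * s)) * (s * f s)))
    (bound := fun s => |Real.exp (-(x / 2 * s)) * (s * f s)|) (x₀ := x) (s := Set.Ioi (x / 2))
    (Ioi_mem_nhds (by linarith)) (Eventually.of_forall hm) (hf.integrableOn hc hx)
    (Continuous.aestronglyMeasurable (by fun_prop)) ?_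
    (hsf.integrableOn (by fun_prop) (by linarith : 0 < x / 2)).abs ?_
  · have h2 := h.2
    rw [integral_neg] at h2
    exact h2
  · refine (ae_restrict_mem measurableSet_Ioi).mono fun s hs y hy => ?_
    rw [norm_neg, Real.norm_eq_abs, abs_mul, abs_mul (Real.exp _), abs_of_pos (Real.exp_pos _),
      abs_of_pos (Real.exp_pos _)]
    refine mul_le_mul_of_nonneg_right (Real.exp_le_exp.2 ?_) (abs_nonneg _)
    have hs0 : (0 : ℝ) < s := hs
    have : x / 2 < y := hy
    nlinarith
  · refine Eventually.of_forall fun s y _ => ?_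
    have h1 : HasDerivAt (fun y : ℝ => -(y * s)) (-s) y := by
      simpa using ((hasDerivAt_id' y).mul_const s).fun_neg
    refine (h1.exp.mul_const (f s)).congr_deriv ?_
    ring

theorem laplaceTransform_add {f g : ℝ → ℝ} (hf : PolyBounded f) (hfc : Continuous f)
    (hg : PolyBounded g) (hgc : Continuous g) {x : ℝ} (hx : 0 < x) :
    laplaceTransform (fun s => f s + g s) x = laplaceTransform f x + laplaceTransform g x := by
  rw [laplaceTransform, laplaceTransform, laplaceTransform,
    ← MeasureTheory.integral_add (hf.integrableOn hfc hx) (hg.integrableOn hgc hx)]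
  simp only [mul_add]

theorem laplaceTransform_const_mul (c : ℝ) (f : ℝ → ℝ) (x : ℝ) :
    laplaceTransform (fun s => c * f s) x = c * laplaceTransform f x := by
  rw [laplaceTransform, laplaceTransform, ← MeasureTheory.integral_const_mul]
  congr 1
  ext s; ring

/-- The primitive `∫₀ˢ j_κ` of `j_κ`. -/
noncomputable def selbergPrimitive (κ s : ℝ) : ℝ := ∫ t in (0 : ℝ)..s, selbergJ κ t

theorem hasDerivAt_selbergPrimitive {κ : ℝ} (hκ : 0 < κ) (s : ℝ) :
    HasDerivAt (selbergPrimitive κ) (selbergJ κ s) s :=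
  intervalIntegral.integral_hasDerivAt_right ((continuous_selbergJ hκ).intervalIntegrable _ _)
    (continuous_selbergJ hκ).stronglyMeasurable.stronglyMeasurableAtFilter
    (continuous_selbergJ hκ).continuousAt

theorem continuous_selbergPrimitive {κ : ℝ} (hκ : 0 < κ) : Continuous (selbergPrimitive κ) :=
  continuous_iff_continuousAt.2 fun s => (hasDerivAt_selbergPrimitive hκ s).continuousAt

theorem selbergPrimitive_of_nonpos (κ : ℝ) {s : ℝ} (hs : s ≤ 0) : selbergPrimitive κ s = 0 := by
  rw [selbergPrimitive, intervalIntegral.integral_congr (g := fun _ => (0 : ℝ))]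
  · simp
  · intro t ht
    rw [Set.uIcc_of_ge hs] at ht
    exact selbergJ_of_nonpos κ ht.2

theorem polyBounded_selbergPrimitive {κ : ℝ} (hκ : 0 < κ) : PolyBounded (selbergPrimitive κ) := by
  obtain ⟨D, M, hD⟩ := polyBounded_selbergJ hκ
  have hD0 : 0 ≤ D := by
    have := (abs_nonneg _).trans (hD 0 le_rfl)
    simpa using this
  refine ⟨D, M + 1, fun s hs => ?_⟩
  have h := intervalIntegral.norm_integral_le_of_norm_le_const (a := (0 : ℝ)) (b := s)
    (C := D * (1 + s) ^ M) (f := selbergJ κ) fun t ht => by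
      rw [Set.uIoc_of_le hs] at ht
      refine (hD t ht.1.le).trans (mul_le_mul_of_nonneg_left ?_ hD0)
      exact pow_le_pow_left₀ (by linarith [ht.1]) (by linarith [ht.2]) M
  rw [Real.norm_eq_abs, sub_zero, abs_of_nonneg hs] at h
  refine h.trans ?_
  rw [pow_succ, ← mul_assoc]
  exact mul_le_mul_of_nonneg_left (by linarith) (by positivity)

theorem polyBounded_selbergPrimitive_sub_one {κ : ℝ} (hκ : 0 < κ) :
    PolyBounded fun s => selbergPrimitive κ (s - 1) := by
  obtain ⟨D, M, hD⟩ := polyBounded_selbergPrimitive hκ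
  have hD0 : 0 ≤ D := by
    have := (abs_nonneg _).trans (hD 0 le_rfl)
    simpa using this
  refine ⟨D, M, fun s hs => ?_⟩
  rcases le_total s 1 with h | h
  · simp only
    rw [selbergPrimitive_of_nonpos κ (by linarith), abs_zero]; positivity
  · refine (hD _ (by linarith)).trans (mul_le_mul_of_nonneg_left ?_ hD0)
    exact pow_le_pow_left₀ (by linarith) (by linarith) M

/-- Both sides vanish at 0 and, by the delay equation, have the same derivative. This integrated
form avoids transforming the derivative of j_κ. -/
theorem mul_selbergJ_eq {κ : ℝ} (hκ : 0 < κ) {s : ℝ} (hs : 0 ≤ s) :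
    s * selbergJ κ s = (1 + κ) * selbergPrimitive κ s - κ * selbergPrimitive κ (s - 1) := by
  rcases hs.eq_or_lt with rfl | hs
  · rw [selbergPrimitive_of_nonpos κ le_rfl, selbergPrimitive_of_nonpos κ (by norm_num)]; simp
  have hcJ := continuous_selbergJ hκ
  have hcK := continuous_selbergPrimitive hκ
  obtain ⟨c, _, hc⟩ := exists_hasDerivAt_eq_slope
    (fun s => s * selbergJ κ s - ((1 + κ) * selbergPrimitive κ s - κ * selbergPrimitive κ (s - 1)))
    (fun _ => 0) hs (Continuous.continuousOn (by fun_prop)) fun t ht => by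
      have h1 := (hasDerivAt_id' t).mul (hasDerivAt_selbergJ hκ ht.1)
      have h2 := (hasDerivAt_selbergPrimitive hκ t).const_mul (1 + κ)
      have h3 := ((hasDerivAt_selbergPrimitive hκ (t - 1)).comp_sub_const t 1).const_mul κ
      refine (h1.sub (h2.sub h3)).congr_deriv ?_
      have : t ≠ 0 := ht.1.ne'
      field_simp
      ring
  rw [eq_comm, sub_zero, div_eq_zero_iff, or_iff_left hs.ne',
    selbergPrimitive_of_nonpos κ le_rfl,
    selbergPrimitive_of_nonpos κ (by norm_num : (0 : ℝ) - 1 ≤ 0)] at hc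
  linarith

open MeasureTheory in
theorem laplaceTransform_selbergPrimitive {κ : ℝ} (hκ : 0 < κ) {x : ℝ} (hx : 0 < x) :
    x * laplaceTransform (selbergPrimitive κ) x = laplaceTransform (selbergJ κ) x := by
  have hJ := (polyBounded_selbergJ hκ).integrableOn (continuous_selbergJ hκ) hx
  have hK := (polyBounded_selbergPrimitive hκ).integrableOn (continuous_selbergPrimitive hκ) hx
  have hcK := continuous_selbergPrimitive hκ
  have h := integral_Ioi_of_hasDerivAt_of_tendsto (a := (0 : ℝ))
    (f := fun s => Real.exp (-(x * s)) * selbergPrimitive κ s)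
    (f' := fun s => Real.exp (-(x * s)) * selbergJ κ s -
      x * (Real.exp (-(x * s)) * selbergPrimitive κ s))
    (Continuous.continuousWithinAt (by fun_prop)) (fun s _ => by
      have h1 : HasDerivAt (fun s : ℝ => -(x * s)) (-x) s := by
        simpa using ((hasDerivAt_id' s).const_mul x).fun_neg
      refine (h1.exp.mul (hasDerivAt_selbergPrimitive hκ s)).congr_deriv ?_
      ring) (hJ.sub (hK.const_mul x)) ((polyBounded_selbergPrimitive hκ).tendsto_zero hx)
  rw [integral_sub hJ (hK.const_mul x), integral_const_mul,
    selbergPrimitive_of_nonpos κ le_rfl] at h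
  simp only [laplaceTransform]
  linarith

open MeasureTheory in
theorem laplaceTransform_selbergPrimitive_sub_one (κ x : ℝ) :
    laplaceTransform (fun s => selbergPrimitive κ (s - 1)) x =
      Real.exp (-x) * laplaceTransform (selbergPrimitive κ) x := by
  have h1 : laplaceTransform (fun s => selbergPrimitive κ (s - 1)) x =
      ∫ s, Real.exp (-(x * s)) * selbergPrimitive κ (s - 1) :=
    setIntegral_eq_integral_of_forall_compl_eq_zero fun s hs => by
      rw [Set.mem_Ioi, not_lt] at hs
      simp only
      rw [selbergPrimitive_of_nonpos κ (by linarith), mul_zero]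
  have h2 : laplaceTransform (selbergPrimitive κ) x =
      ∫ s, Real.exp (-(x * s)) * selbergPrimitive κ s :=
    setIntegral_eq_integral_of_forall_compl_eq_zero fun s hs => by
      rw [Set.mem_Ioi, not_lt] at hs
      rw [selbergPrimitive_of_nonpos κ hs, mul_zero]
  rw [h1, h2, ← integral_const_mul, ← integral_sub_right_eq_self
    (fun s => Real.exp (-x) * (Real.exp (-(x * s)) * selbergPrimitive κ s)) (1 : ℝ)]
  congr 1
  ext s
  rw [← mul_assoc, ← Real.exp_add]
  congr 2; ring

/-- Transform the integrated delay equation; the unit shift contributes e^{-x}. Since the transform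
of s j_κ(s) is minus the derivative of that of j_κ, this is a first-order linear differential
equation. -/
theorem laplaceTransform_mul_selbergJ {κ : ℝ} (hκ : 0 < κ) {x : ℝ} (hx : 0 < x) :
    x * laplaceTransform (fun s => s * selbergJ κ s) x =
      (1 + κ * (1 - Real.exp (-x))) * laplaceTransform (selbergJ κ) x := by
  have hcK := continuous_selbergPrimitive hκ
  have e : laplaceTransform (fun s => s * selbergJ κ s) x = laplaceTransform (fun s =>
      (1 + κ) * selbergPrimitive κ s + (-κ) * selbergPrimitive κ (s - 1)) x := by
    refine MeasureTheory.setIntegral_congr_fun measurableSet_Ioi fun s hs => ?_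
    simp only
    rw [mul_selbergJ_eq hκ (le_of_lt hs)]
    ring
  rw [e, laplaceTransform_add ((polyBounded_const _).mul (polyBounded_selbergPrimitive hκ))
    (by fun_prop) ((polyBounded_const _).mul (polyBounded_selbergPrimitive_sub_one hκ))
    (by fun_prop) hx, laplaceTransform_const_mul, laplaceTransform_const_mul,
    laplaceTransform_selbergPrimitive_sub_one, ← laplaceTransform_selbergPrimitive hκ hx]
  ring

/-- The quantity `x J(x) exp(κ Ein x)`, `J` the Laplace transform of `j_κ`, does not depend
on `x`. -/
theorem laplaceTransform_selbergJ_const {κ : ℝ} (hκ : 0 < κ) {x y : ℝ} (hx : 0 < x)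
    (hxy : x < y) : x * laplaceTransform (selbergJ κ) x * Real.exp (κ * expEin x) =
      y * laplaceTransform (selbergJ κ) y * Real.exp (κ * expEin y) := by
  have hder : ∀ t, 0 < t → HasDerivAt
      (fun t => t * laplaceTransform (selbergJ κ) t * Real.exp (κ * expEin t)) 0 t := by
    intro t ht
    have h1 := (hasDerivAt_id' t).mul (hasDerivAt_laplaceTransform (polyBounded_selbergJ hκ)
      (continuous_selbergJ hκ) ht)
    have h2 := ((hasDerivAt_expEin t).const_mul κ).exp
    refine (h1.mul h2).congr_deriv ?_
    have h3 := laplaceTransform_mul_selbergJ hκ ht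
    have h4 : t * expMean t = 1 - Real.exp (-t) := by
      rw [expMean_eq ht.ne']; field_simp
    set E := Real.exp (κ * expEin t)
    set J := laplaceTransform (selbergJ κ) t
    set J' := laplaceTransform (fun s => s * selbergJ κ s) t
    simp only [Pi.mul_apply]
    linear_combination (-E) * h3 + κ * E * J * h4
  obtain ⟨c, _, hc⟩ := exists_hasDerivAt_eq_slope
    (fun t => t * laplaceTransform (selbergJ κ) t * Real.exp (κ * expEin t)) (fun _ => 0) hxy
    (fun t ht => (hder t (by linarith [ht.1])).continuousAt.continuousWithinAt)
    fun t ht => hder t (by linarith [ht.1])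
  rw [eq_comm, div_eq_zero_iff, or_iff_left (by linarith : y - x ≠ 0)] at hc
  linarith

open MeasureTheory in
-- Large x sees only small s. The power law valid on (0, 1], extended to all s > 0, gives the limit
-- exactly through the Gamma integral, and the difference vanishes for s ≤ 1.
theorem tendsto_rpow_mul_laplaceTransform_selbergJ {κ : ℝ} (hκ : 0 < κ) :
    Tendsto (fun x => x ^ (κ + 1) * laplaceTransform (selbergJ κ) x) atTop
      (𝓝 (Real.exp (-(κ * Real.eulerMascheroniConstant)))) := by
  set c := selbergConst κ with hc
  have hpc : Continuous fun s : ℝ => (max s 0) ^ κ * c :=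
    (continuous_max_zero_rpow hκ.le).mul continuous_const
  have hpp : PolyBounded fun s : ℝ => (max s 0) ^ κ * c := by
    obtain ⟨M, hM⟩ := exists_nat_ge κ
    refine PolyBounded.mul ⟨1, M, fun s hs => ?_⟩ (polyBounded_const c)
    simp only
    rw [max_eq_left hs, abs_of_nonneg (by positivity), one_mul]
    calc s ^ κ ≤ (1 + s) ^ κ := Real.rpow_le_rpow hs (by linarith) hκ.le
      _ ≤ (1 + s) ^ (M : ℝ) := Real.rpow_le_rpow_of_exponent_le (by linarith) hM
      _ = _ := Real.rpow_natCast _ _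
  set r : ℝ → ℝ := fun s => selbergJ κ s + -1 * ((max s 0) ^ κ * c) with hr
  have hrc : Continuous r := (continuous_selbergJ hκ).add (continuous_const.mul hpc)
  have hrp : PolyBounded r := (polyBounded_selbergJ hκ).add ((polyBounded_const _).mul hpp)
  have hr0 : ∀ s ≤ 1, r s = 0 := fun s hs => by
    simp only [hr]
    rw [selbergJ_of_le_one hκ hs]; ring
  have hmain : ∀ x, 0 < x → x ^ (κ + 1) * laplaceTransform (fun s : ℝ => (max s 0) ^ κ * c) x =
      Real.exp (-(κ * Real.eulerMascheroniConstant)) := by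
    intro x hx
    have e : laplaceTransform (fun s : ℝ => (max s 0) ^ κ * c) x =
        c * ∫ s in Set.Ioi 0, s ^ (κ + 1 - 1) * Real.exp (-(x * s)) := by
      rw [laplaceTransform, ← integral_const_mul]
      refine setIntegral_congr_fun measurableSet_Ioi fun s hs => ?_
      rw [max_eq_left (le_of_lt hs), add_sub_cancel_right]
      ring
    rw [e, Real.integral_rpow_mul_exp_neg_mul_Ioi (by linarith) hx, hc, selbergConst]
    have hG : Real.Gamma (κ + 1) ≠ 0 := (Real.Gamma_pos_of_pos (by linarith)).ne'
    rw [one_div, Real.inv_rpow hx.le]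
    have : x ^ (κ + 1) ≠ 0 := (Real.rpow_pos_of_pos hx _).ne'
    field_simp
  have hrem : Tendsto (fun x => x ^ (κ + 1) * laplaceTransform r x) atTop (𝓝 0) := by
    set I := ∫ s in Set.Ioi 0, |Real.exp (-(1 * s)) * r s| with hI
    have hint := (hrp.integrableOn hrc one_pos)
    have hlim : Tendsto (fun x : ℝ => x ^ (κ + 1) * Real.exp (-1 * x) * (Real.exp 1 * I)) atTop
        (𝓝 0) := by
      simpa using (tendsto_rpow_mul_exp_neg_mul_atTop_nhds_zero (κ + 1) 1 one_pos).mul_const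
        (Real.exp 1 * I)
    refine squeeze_zero_norm' ?_ hlim
    filter_upwards [eventually_ge_atTop 1] with x hx
    have hx0 : 0 < x := by linarith
    rw [norm_mul, Real.norm_of_nonneg (by positivity), mul_assoc]
    refine mul_le_mul_of_nonneg_left ?_ (by positivity)
    rw [← mul_assoc, ← Real.exp_add, hI, ← integral_const_mul]
    refine norm_integral_le_of_norm_le (hint.abs.const_mul _) ?_
    refine (ae_restrict_mem measurableSet_Ioi).mono fun s _ => ?_
    rcases le_total s 1 with h | h
    · rw [hr0 s h]; simp
    · rw [norm_mul, Real.norm_eq_abs, Real.norm_eq_abs, abs_mul, abs_of_pos (Real.exp_pos _),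
        abs_of_pos (Real.exp_pos _), ← mul_assoc, ← Real.exp_add]
      refine mul_le_mul_of_nonneg_right (Real.exp_le_exp.2 ?_) (abs_nonneg _)
      -- For x, s ≥ 1 the inequality (x - 1)(s - 1) ≥ 0 gives e^{-xs} ≤ e^{1-x} e^{-s}.
      nlinarith
  have hsum : Tendsto (fun x : ℝ => Real.exp (-(κ * Real.eulerMascheroniConstant)) +
      x ^ (κ + 1) * laplaceTransform r x) atTop
      (𝓝 (Real.exp (-(κ * Real.eulerMascheroniConstant)) + 0)) := tendsto_const_nhds.add hrem
  rw [add_zero] at hsum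
  refine hsum.congr' ?_
  filter_upwards [eventually_gt_atTop 0] with x hx
  rw [← hmain x hx, ← mul_add, ← laplaceTransform_add hpp hpc hrp hrc hx]
  congr 2
  ext s
  simp only [hr]; ring

open MeasureTheory in
-- Differentiating the Gamma integral at 1 gives this integral, and Γ'(1) = -γ.
theorem integral_log_mul_exp_neg :
    ∫ t in Set.Ioi (0 : ℝ), Real.log t * Real.exp (-t) = -Real.eulerMascheroniConstant := by
  have h1 := Complex.hasDerivAt_GammaIntegral (s := 1) (by simp)
  have h2 : HasDerivAt Complex.GammaIntegral (-(Real.eulerMascheroniConstant : ℂ)) 1 := by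
    refine Complex.hasDerivAt_Gamma_one.congr_of_eventuallyEq ?_
    have : ∀ᶠ s : ℂ in 𝓝 1, 0 < s.re :=
      (isOpen_lt continuous_const Complex.continuous_re).mem_nhds (by simp)
    filter_upwards [this] with s hs
    exact (Complex.Gamma_eq_integral hs).symm
  have h3 := h1.unique h2
  have h4 : ∫ t in Set.Ioi (0 : ℝ), (t : ℂ) ^ ((1 : ℂ) - 1) * (Real.log t * Real.exp (-t)) =
      ((∫ t in Set.Ioi (0 : ℝ), Real.log t * Real.exp (-t) : ℝ) : ℂ) := by
    rw [← integral_complex_ofReal]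
    simp
  rw [h4] at h3
  exact_mod_cast h3

open MeasureTheory in
-- A nonintegrable function has integral 0 by convention, whereas the value just found is -γ ≠ 0.
theorem integrableOn_log_mul_exp_neg :
    IntegrableOn (fun t => Real.log t * Real.exp (-t)) (Set.Ioi 0) := by
  by_contra h
  have h1 := integral_log_mul_exp_neg
  rw [integral_undef h] at h1
  linarith [Real.one_half_lt_eulerMascheroniConstant]

open MeasureTheory in
-- Integration by parts gives Ein(x) = (1 - e^{-x}) log x - ∫₀ˣ e^{-t} log t dt, and the last
-- integral tends to -γ.
theorem tendsto_expEin_sub_log :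
    Tendsto (fun x => expEin x - Real.log x) atTop (𝓝 Real.eulerMascheroniConstant) := by
  have hii : ∀ a b : ℝ, 0 ≤ a → 0 ≤ b →
      IntervalIntegrable (fun t => Real.log t * Real.exp (-t)) volume a b := by
    intro a b ha hb
    refine integrableOn_log_mul_exp_neg.mono_set ?_ |> intervalIntegrable_iff.2
    intro t ht
    exact lt_of_le_of_lt (le_min ha hb) ht.1
  have key : ∀ x, 0 < x → expEin x - Real.log x =
      -(∫ t in (0 : ℝ)..x, Real.log t * Real.exp (-t)) - x ^ (-1 + 1 : ℝ) * Real.exp (-x) *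
        Real.log x := by
    intro x hx
    -- The term (1 - e^{-x}) log x is written as `expMean x * (x * log x)` so that continuity at 0
    -- is visible; the whole function has derivative 0 and starts at 0.
    have hcont : ContinuousOn (fun x => expEin x - expMean x * (x * Real.log x) +
        ∫ t in (0 : ℝ)..x, Real.log t * Real.exp (-t)) (Set.Icc 0 x) := by
      have c1 : Continuous expEin :=
        continuous_iff_continuousAt.2 fun s => (hasDerivAt_expEin s).continuousAt
      refine ContinuousOn.add (Continuous.continuousOn
        (c1.sub (continuous_expMean.mul Real.continuous_mul_log))) ?_
      have := intervalIntegral.continuousOn_primitive_interval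
        (f := fun t => Real.log t * Real.exp (-t)) (a := 0) (b := x) (μ := volume)
        (by rw [← intervalIntegrable_iff' (by rw [min_eq_left hx.le]; simp)]; exact hii 0 x le_rfl hx.le)
      rwa [Set.uIcc_of_le hx.le] at this
    obtain ⟨c, hcx, hc⟩ := exists_hasDerivAt_eq_slope _ (fun _ => 0) hx hcont fun t ht => by
      have ht0 : 0 < t := ht.1
      have h1 := hasDerivAt_expEin t
      have h2 : HasDerivAt (fun x => expMean x * (x * Real.log x))
          (Real.exp (-t) * Real.log t + (1 - Real.exp (-t)) * t⁻¹) t := by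
        have h3 : HasDerivAt (fun x : ℝ => 1 - Real.exp (-x)) (Real.exp (-t)) t := by
          refine ((hasDerivAt_neg' t).exp.const_sub 1).congr_deriv ?_
          ring
        refine (h3.mul (Real.hasDerivAt_log ht0.ne')).congr_of_eventuallyEq ?_
        filter_upwards [Ioi_mem_nhds ht0] with y hy
        have hy0 : y ≠ 0 := ne_of_gt hy
        simp only [Pi.mul_apply]
        rw [expMean_eq hy0]; field_simp
      have h4 : HasDerivAt (fun x => ∫ t in (0 : ℝ)..x, Real.log t * Real.exp (-t))
          (Real.log t * Real.exp (-t)) t := by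
        have hca : ContinuousAt (fun t => Real.log t * Real.exp (-t)) t :=
          (Real.continuousAt_log ht0.ne').mul (by fun_prop)
        refine intervalIntegral.integral_hasDerivAt_right (hii 0 t le_rfl ht0.le) ?_ hca
        exact StronglyMeasurable.stronglyMeasurableAtFilter
          (Measurable.stronglyMeasurable (by fun_prop))
      refine ((h1.sub h2).add h4).congr_deriv ?_
      rw [expMean_eq ht0.ne']
      ring
    rw [eq_comm, div_eq_zero_iff, or_iff_left (by linarith : x - 0 ≠ 0)] at hc
    simp only [expEin, intervalIntegral.integral_same, zero_mul, mul_zero, sub_zero,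
      add_zero] at hc
    rw [expMean_eq hx.ne'] at hc
    have e : (1 - Real.exp (-x)) / x * (x * Real.log x) = (1 - Real.exp (-x)) * Real.log x := by
      field_simp
    rw [e] at hc
    rw [expEin]
    norm_num
    linarith
  have h1 : Tendsto (fun x => ∫ t in (0 : ℝ)..x, Real.log t * Real.exp (-t)) atTop
      (𝓝 (-Real.eulerMascheroniConstant)) := by
    rw [← integral_log_mul_exp_neg]
    exact intervalIntegral_tendsto_integral_Ioi 0 integrableOn_log_mul_exp_neg tendsto_id
  have h2 : Tendsto (fun x : ℝ => x ^ (-1 + 1 : ℝ) * Real.exp (-x) * Real.log x) atTop (𝓝 0) := by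
    have h3 := tendsto_rpow_mul_exp_neg_mul_atTop_nhds_zero 1 1 one_pos
    refine squeeze_zero' ?_ ?_ h3
    · filter_upwards [eventually_ge_atTop 1] with x hx
      have := Real.log_nonneg hx
      positivity
    · filter_upwards [eventually_ge_atTop 1] with x hx
      norm_num
      rw [mul_comm]
      exact mul_le_mul_of_nonneg_right (Real.log_le_self (by linarith)) (Real.exp_pos _).le
  have h5 := h1.neg.sub h2
  rw [neg_neg, sub_zero] at h5
  refine h5.congr' ?_
  filter_upwards [eventually_gt_atTop 0] with x hx
  exact (key x hx).symm

/-- The Laplace transform of `j_κ`. -/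
theorem laplaceTransform_selbergJ {κ : ℝ} (hκ : 0 < κ) {x : ℝ} (hx : 0 < x) :
    laplaceTransform (selbergJ κ) x = Real.exp (-(κ * expEin x)) / x := by
  -- The factor e^{-κγ} from y^{κ+1} J(y), J being the transform of j_κ, cancels e^{κγ} from
  -- exp(κ(Ein(y) - log y)); this is what the normalisation of j_κ is for.
  have hlim : Tendsto (fun y => y * laplaceTransform (selbergJ κ) y * Real.exp (κ * expEin y)) atTop
      (𝓝 1) := by
    have h1 := (tendsto_rpow_mul_laplaceTransform_selbergJ hκ).mul
      ((Real.continuous_exp.tendsto _).comp (tendsto_expEin_sub_log.const_mul κ))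
    rw [← Real.exp_add, neg_add_cancel, Real.exp_zero] at h1
    refine h1.congr' ?_
    filter_upwards [eventually_gt_atTop 0] with y hy
    simp only [Function.comp]
    rw [mul_sub, Real.exp_sub, mul_comm κ (Real.log y), ← Real.rpow_def_of_pos hy,
      Real.rpow_add_one hy.ne']
    have := (Real.rpow_pos_of_pos hy κ).ne'
    field_simp
  have hconst : x * laplaceTransform (selbergJ κ) x * Real.exp (κ * expEin x) = 1 := by
    refine tendsto_nhds_unique (tendsto_const_nhds.congr' ?_) hlim
    filter_upwards [eventually_gt_atTop x] with y hy
    exact laplaceTransform_selbergJ_const hκ hx hy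
  rw [Real.exp_neg]
  have := (Real.exp_pos (κ * expEin x)).ne'
  field_simp
  linarith

/-! ### A continuity theorem for Laplace transforms -/

open MeasureTheory in
theorem integrableOn_exp_neg_mul_comp {f G : ℝ → ℝ} (hf : Continuous f)
    (hG : IntegrableOn (fun s => Real.exp (-s) * G s) (Set.Ioi 0)) :
    IntegrableOn (fun s => f (Real.exp (-s)) * (Real.exp (-s) * G s)) (Set.Ioi 0) := by
  obtain ⟨C, hC⟩ := isCompact_Icc.exists_bound_of_continuousOn
    (hf.continuousOn (s := Set.Icc (0 : ℝ) 1))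
  refine Integrable.bdd_mul (c := C) hG
    (Continuous.aestronglyMeasurable (by fun_prop)) ?_
  refine (ae_restrict_mem measurableSet_Ioi).mono fun s hs => hC _ ⟨(Real.exp_pos _).le, ?_⟩
  exact Real.exp_le_one_iff.2 (by linarith [show (0 : ℝ) < s from hs])

open MeasureTheory in
/-- Convergence of the Laplace transforms at the positive integers implies convergence against
continuous functions of `e^{-s}`. -/
theorem tendsto_integral_of_tendsto_laplaceTransform {F : ℝ → ℝ → ℝ} {j : ℝ → ℝ}
    (hF : ∀ᶠ z in atTop, IntegrableOn (fun s => Real.exp (-s) * F z s) (Set.Ioi 0) ∧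
      ∫ s in Set.Ioi 0, |Real.exp (-s) * F z s| ≤ 1)
    (hj : IntegrableOn (fun s => Real.exp (-s) * j s) (Set.Ioi 0))
    (hlim : ∀ m : ℕ, 1 ≤ m → Tendsto (fun z => laplaceTransform (F z) m) atTop
      (𝓝 (laplaceTransform j m))) {f : ℝ → ℝ} (hf : Continuous f) :
    Tendsto (fun z => ∫ s in Set.Ioi 0, f (Real.exp (-s)) * (Real.exp (-s) * F z s)) atTop
      (𝓝 (∫ s in Set.Ioi 0, f (Real.exp (-s)) * (Real.exp (-s) * j s))) := by
  -- A monomial of degree i in e^{-s}, with the extra weight e^{-s}, gives the transform at i + 1.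
  -- Weierstrass approximation on [0, 1] then passes to continuous functions.
  have hpoly_eq : ∀ (p : Polynomial ℝ) (G : ℝ → ℝ),
      IntegrableOn (fun s => Real.exp (-s) * G s) (Set.Ioi 0) →
      ∫ s in Set.Ioi 0, p.eval (Real.exp (-s)) * (Real.exp (-s) * G s) =
        ∑ i ∈ Finset.range (p.natDegree + 1), p.coeff i * laplaceTransform G ((i + 1 : ℕ) : ℝ) := by
    intro p G hG
    simp_rw [Polynomial.eval_eq_sum_range, Finset.sum_mul]
    rw [integral_finsetSum]
    · refine Finset.sum_congr rfl fun i _ => ?_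
      rw [laplaceTransform, ← integral_const_mul]
      congr 1
      ext s
      rw [mul_assoc, ← mul_assoc (_ ^ i), ← Real.exp_nat_mul, ← Real.exp_add]
      congr 3
      push_cast; ring
    · intro i _
      exact integrableOn_exp_neg_mul_comp (f := fun y => p.coeff i * y ^ i) (by fun_prop) hG
  have hpoly : ∀ p : Polynomial ℝ,
      Tendsto (fun z => ∫ s in Set.Ioi 0, p.eval (Real.exp (-s)) * (Real.exp (-s) * F z s)) atTop
      (𝓝 (∫ s in Set.Ioi 0, p.eval (Real.exp (-s)) * (Real.exp (-s) * j s))) := by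
    intro p
    rw [hpoly_eq p j hj]
    have := tendsto_finsetSum (Finset.range (p.natDegree + 1)) fun i _ =>
      (hlim (i + 1) (by omega)).const_mul (p.coeff i)
    refine this.congr' ?_
    filter_upwards [hF] with z hz
    exact (hpoly_eq p (F z) hz.1).symm
  have hclose : ∀ (p : Polynomial ℝ) (ε : ℝ), (∀ y ∈ Set.Icc (0 : ℝ) 1, |p.eval y - f y| < ε) →
      ∀ G : ℝ → ℝ, IntegrableOn (fun s => Real.exp (-s) * G s) (Set.Ioi 0) →
      |(∫ s in Set.Ioi 0, p.eval (Real.exp (-s)) * (Real.exp (-s) * G s)) -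
        ∫ s in Set.Ioi 0, f (Real.exp (-s)) * (Real.exp (-s) * G s)| ≤
      ε * ∫ s in Set.Ioi 0, |Real.exp (-s) * G s| := by
    intro p ε hp G hG
    rw [← integral_sub (integrableOn_exp_neg_mul_comp p.continuous hG)
      (integrableOn_exp_neg_mul_comp hf hG), ← integral_const_mul, ← Real.norm_eq_abs]
    refine norm_integral_le_of_norm_le (hG.abs.const_mul ε) ?_
    refine (ae_restrict_mem measurableSet_Ioi).mono fun s hs => ?_
    rw [← sub_mul, norm_mul, Real.norm_eq_abs, Real.norm_eq_abs]
    refine mul_le_mul_of_nonneg_right (hp _ ⟨(Real.exp_pos _).le, ?_⟩).le (abs_nonneg _)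
    exact Real.exp_le_one_iff.2 (by linarith [show (0 : ℝ) < s from hs])
  set J := ∫ s in Set.Ioi 0, |Real.exp (-s) * j s| with hJ
  have hJ0 : 0 ≤ J := integral_nonneg fun _ => abs_nonneg _
  rw [Metric.tendsto_nhds]
  intro δ hδ
  -- The errors are ε for `F z`, ε for the polynomial limit and εJ for `j`, together δ/2.
  set ε := δ / (2 * (2 + J)) with hε
  have hε0 : 0 < ε := by positivity
  obtain ⟨p, hp⟩ := exists_polynomial_near_of_continuousOn 0 1 f hf.continuousOn ε hε0
  filter_upwards [hF, Metric.tendsto_nhds.1 (hpoly p) ε hε0] with z hz hzp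
  rw [Real.dist_eq] at hzp ⊢
  have h1 := hclose p ε hp (F z) hz.1
  have h2 := hclose p ε hp j hj
  have h3 : ε * ∫ s in Set.Ioi 0, |Real.exp (-s) * F z s| ≤ ε := mul_le_of_le_one_right hε0.le hz.2
  have h4 : ε * (2 + J) = δ / 2 := by rw [hε]; field_simp
  rw [← hJ] at h2
  rw [abs_le] at h1 h2
  rw [abs_lt] at hzp ⊢
  constructor <;> nlinarith

open MeasureTheory in
/-- A continuity theorem for the Laplace transforms of distribution functions on `[0, ∞)`. -/
theorem tendsto_of_tendsto_laplaceTransform {F : ℝ → ℝ → ℝ} {j : ℝ → ℝ}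
    (hF : ∀ᶠ z in atTop, Monotone (F z) ∧ ∀ s, 0 ≤ F z s ∧ F z s ≤ 1)
    (hjc : Continuous j) (hjp : PolyBounded j)
    (hlim : ∀ m : ℕ, 1 ≤ m → Tendsto (fun z => laplaceTransform (F z) m) atTop
      (𝓝 (laplaceTransform j m))) {s : ℝ} (hs : 0 < s) :
    Tendsto (fun z => F z s) atTop (𝓝 (j s)) := by
  have hexp : IntegrableOn (fun s : ℝ => Real.exp (-s)) (Set.Ioi 0) := integrableOn_exp_neg_Ioi 0
  have hexp1 : IntegrableOn (fun s : ℝ => Real.exp (-s) * 1) (Set.Ioi 0) := by simpa using hexp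
  have hFint : ∀ᶠ z in atTop, IntegrableOn (fun s => Real.exp (-s) * F z s) (Set.Ioi 0) ∧
      ∫ s in Set.Ioi 0, |Real.exp (-s) * F z s| ≤ 1 := by
    filter_upwards [hF] with z hz
    have hle : ∀ s, ‖Real.exp (-s) * F z s‖ ≤ Real.exp (-s) := fun s => by
      rw [norm_mul, Real.norm_of_nonneg (Real.exp_pos _).le, Real.norm_of_nonneg (hz.2 s).1]
      exact mul_le_of_le_one_right (Real.exp_pos _).le (hz.2 s).2
    have hint : IntegrableOn (fun s => Real.exp (-s) * F z s) (Set.Ioi 0) :=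
      Integrable.mono' hexp ((by fun_prop : Continuous fun s : ℝ =>
        Real.exp (-s)).measurable.mul hz.1.measurable).aestronglyMeasurable
        (Eventually.of_forall hle)
    refine ⟨hint, (integral_mono hint.abs hexp hle).trans (le_of_eq ?_)⟩
    rw [integral_exp_neg_Ioi_zero]
  have hjint : IntegrableOn (fun s => Real.exp (-s) * j s) (Set.Ioi 0) := by
    simpa using hjp.integrableOn hjc one_pos
  -- Test against a bump supported on a < s < b. By monotonicity the average of `F z` lies between
  -- `F z a` and `F z b`, while its limit, the average of `j`, lies between `lo` and `hi`.
  have key : ∀ a b lo hi : ℝ, 0 < a → a < b → (∀ t ∈ Set.Icc a b, lo ≤ j t ∧ j t ≤ hi) →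
      ∀ δ, 0 < δ → ∀ᶠ z in atTop, F z a < hi + δ ∧ lo - δ < F z b := by
    intro a b lo hi ha hab hj δ hδ
    set f : ℝ → ℝ := fun y => max 0 ((Real.exp (-a) - y) * (y - Real.exp (-b))) with hf
    have hfc : Continuous f := by fun_prop
    have hf0 : ∀ y, 0 ≤ f y := fun y => le_max_left _ _
    have hfz : ∀ s, s ∉ Set.Ioo a b → f (Real.exp (-s)) = 0 := by
      intro s hs
      refine max_eq_left ?_
      rw [Set.mem_Ioo, not_and_or, not_lt, not_lt] at hs
      have hba : Real.exp (-b) < Real.exp (-a) := Real.exp_lt_exp.2 (by linarith)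
      rcases hs with h | h
      · have := Real.exp_le_exp.2 (neg_le_neg h)
        exact mul_nonpos_of_nonpos_of_nonneg (by linarith) (by linarith)
      · have := Real.exp_le_exp.2 (neg_le_neg h)
        exact mul_nonpos_of_nonneg_of_nonpos (by linarith) (by linarith)
    have hfpos : ∀ s ∈ Set.Ioo a b, 0 < f (Real.exp (-s)) := by
      intro s hs
      refine lt_max_of_lt_right (mul_pos ?_ ?_)
      · exact sub_pos.2 (Real.exp_lt_exp.2 (neg_lt_neg hs.1))
      · exact sub_pos.2 (Real.exp_lt_exp.2 (neg_lt_neg hs.2))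
    set I := ∫ s in Set.Ioi 0, f (Real.exp (-s)) * (Real.exp (-s) * 1) with hI
    have hint1 := integrableOn_exp_neg_mul_comp hfc hexp1
    have hI0 : 0 < I := by
      rw [hI, setIntegral_pos_iff_support_of_nonneg_ae (Eventually.of_forall fun s =>
        mul_nonneg (hf0 _) (by positivity)) hint1]
      refine lt_of_lt_of_le ?_ (measure_mono (s := Set.Ioo a b) fun s hs =>
        ⟨?_, lt_trans ha hs.1⟩)
      · simp [hab]
      · rw [Function.mem_support]
        have := hfpos s hs
        positivity
    have hbound : ∀ (G : ℝ → ℝ) (lo hi : ℝ), (∀ t ∈ Set.Ioo a b, lo ≤ G t ∧ G t ≤ hi) →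
        IntegrableOn (fun s => Real.exp (-s) * G s) (Set.Ioi 0) →
        lo * I ≤ ∫ s in Set.Ioi 0, f (Real.exp (-s)) * (Real.exp (-s) * G s) ∧
        ∫ s in Set.Ioi 0, f (Real.exp (-s)) * (Real.exp (-s) * G s) ≤ hi * I := by
      intro G lo hi hG hGint
      rw [hI, ← integral_const_mul, ← integral_const_mul]
      have hGf := integrableOn_exp_neg_mul_comp hfc hGint
      constructor
      · refine integral_mono (hint1.const_mul lo) hGf fun s => ?_
        by_cases hs : s ∈ Set.Ioo a b
        · have h1 := (hG s hs).1
          have h2 : 0 ≤ f (Real.exp (-s)) * Real.exp (-s) :=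
            mul_nonneg (hf0 _) (Real.exp_pos _).le
          simp only
          nlinarith
        · simp [hfz s hs]
      · refine integral_mono hGf (hint1.const_mul hi) fun s => ?_
        by_cases hs : s ∈ Set.Ioo a b
        · have h1 := (hG s hs).2
          have h2 : 0 ≤ f (Real.exp (-s)) * Real.exp (-s) :=
            mul_nonneg (hf0 _) (Real.exp_pos _).le
          simp only
          nlinarith
        · simp [hfz s hs]
    have hjb := hbound j lo hi (fun t ht => hj t (Set.Ioo_subset_Icc_self ht)) hjint
    have hconv := tendsto_integral_of_tendsto_laplaceTransform hFint hjint hlim hfc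
    filter_upwards [hF, hFint, Metric.tendsto_nhds.1 hconv (δ * I) (by positivity)]
      with z hz hzi hzc
    have hzb := hbound (F z) (F z a) (F z b)
      (fun t ht => ⟨hz.1 ht.1.le, hz.1 ht.2.le⟩) hzi.1
    rw [Real.dist_eq, abs_lt] at hzc
    constructor
    · refine lt_of_mul_lt_mul_right ?_ hI0.le
      linarith [hzb.1, hjb.2, hzc.2]
    · refine lt_of_mul_lt_mul_right ?_ hI0.le
      linarith [hzb.2, hjb.1, hzc.1]
  rw [Metric.tendsto_nhds]
  intro ε hε
  obtain ⟨η, hη, hηj⟩ := Metric.continuous_iff.1 hjc s (ε / 2) (by linarith)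
  have hη2 : 0 < min (η / 2) (s / 2) := by positivity
  set r := min (η / 2) (s / 2) with hr
  have hr1 : r ≤ η / 2 := min_le_left _ _
  have hr2 : r ≤ s / 2 := min_le_right _ _
  have hjr : ∀ t, |t - s| ≤ r → j s - ε / 2 ≤ j t ∧ j t ≤ j s + ε / 2 := by
    intro t ht
    have := hηj t (by rw [Real.dist_eq]; linarith)
    rw [Real.dist_eq, abs_lt] at this
    constructor <;> linarith
  -- The interval to the right of s bounds `F z s` above, the one to the left bounds it below.
  filter_upwards [key s (s + r) _ _ hs (by linarith) (fun t ht => hjr t (by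
      rw [abs_le]; constructor <;> linarith [ht.1, ht.2])) (ε / 2) (by linarith),
    key (s - r) s _ _ (by linarith) (by linarith) (fun t ht => hjr t (by
      rw [abs_le]; constructor <;> linarith [ht.1, ht.2])) (ε / 2) (by linarith)] with z h1 h2
  rw [Real.dist_eq, abs_lt]
  constructor <;> linarith [h1.1, h2.2]

/-! ### Uniform lower bounds for the random product -/

theorem eventually_productProb_extremalProb {κ : ℝ} (hκ : 0 ≤ κ) {N : ℕ} (hN : 2 * κ + 2 ≤ N) :
    ∀ᶠ z : ℝ in atTop,
      Monotone (fun s : ℝ => productProb (extremalProb κ N) (primesUpTo z) (z ^ s)) ∧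
      ∀ s : ℝ, 0 ≤ productProb (extremalProb κ N) (primesUpTo z) (z ^ s) ∧
        productProb (extremalProb κ N) (primesUpTo z) (z ^ s) ≤ 1 := by
  have h0 : ∀ z : ℝ, ∀ p ∈ primesUpTo z, 0 ≤ extremalProb κ N p := fun _ p _ =>
    (extremalProb_mem hκ hN p).1
  have h1 : ∀ z : ℝ, ∀ p ∈ primesUpTo z, extremalProb κ N p ≤ 1 := fun _ p _ =>
    (extremalProb_mem hκ hN p).2
  filter_upwards [eventually_ge_atTop 1] with z hz
  refine ⟨fun s t hst => ?_, fun s => ⟨productProb_nonneg (h0 z) (h1 z) _,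
    productProb_le_one (h0 z) (h1 z) _⟩⟩
  exact productProb_mono (h0 z) (h1 z) (Real.rpow_le_rpow_of_exponent_le hz hst)

/-- The limiting distribution of the extremal random product of primes is `j_κ`. -/
theorem tendsto_productProb_extremalProb {κ : ℝ} (hκ : 0 < κ) {N : ℕ} (hN : 2 * κ + 2 ≤ N) {s : ℝ}
    (hs : 0 < s) : Tendsto (fun z : ℝ => productProb (extremalProb κ N) (primesUpTo z) (z ^ s))
      atTop (𝓝 (selbergJ κ s)) := by
  refine tendsto_of_tendsto_laplaceTransform (eventually_productProb_extremalProb hκ.le hN)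
    (continuous_selbergJ hκ) (polyBounded_selbergJ hκ) (fun m hm => ?_) hs
  have hm0 : (0 : ℝ) < m := by exact_mod_cast hm
  rw [laplaceTransform_selbergJ hκ hm0]
  refine ((tendsto_prod_one_sub_extremalProb hκ.le hN hm0.le).div_const (m : ℝ)).congr' ?_
  filter_upwards [eventually_ge_atTop 2] with z hz
  exact (integral_exp_mul_productProb hz hm0).symm

/-- As a limit of distribution functions, j_κ is nondecreasing on s > 0, and at s = 1 it is an
explicit positive constant. -/
theorem selbergJ_pos {κ s : ℝ} (hκ : 0 < κ) (hs : 1 ≤ s) : 0 < selbergJ κ s := by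
  obtain ⟨N, hN⟩ := exists_nat_ge (2 * κ + 2)
  have h1 := tendsto_productProb_extremalProb hκ hN one_pos
  have h2 := tendsto_productProb_extremalProb hκ hN (show 0 < s by linarith)
  have h3 : selbergJ κ 1 ≤ selbergJ κ s := by
    refine le_of_tendsto_of_tendsto h1 h2 ?_
    filter_upwards [eventually_productProb_extremalProb hκ.le hN] with z hz
    exact hz.1 hs
  refine lt_of_lt_of_le ?_ h3
  rw [selbergJ_of_le_one hκ le_rfl]
  have := selbergConst_pos hκ.le
  simpa using this

/-- Dimension zero is treated apart: this function jumps at 0, so the continuity theorem does not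
apply. -/
theorem selbergJ_zero_left {s : ℝ} (hs : 0 < s) : selbergJ 0 s = 1 := by
  rw [selbergJ]
  cases ⌈s⌉₊ with
  | zero => simp [selbergStep, not_le.2 hs]
  | succ n => simp [selbergStep, not_le.2 hs]

theorem one_le_productProb_of_eq_zero {g : ℕ → ℝ} {P : Finset ℕ} (hg : ∀ p ∈ P, g p = 0) {y : ℝ}
    (hy : 1 ≤ y) : 1 ≤ productProb g P y := by
  rw [productProb_eq_sum]
  have h := Finset.single_le_sum (f := fun T => (∏ p ∈ T, g p) * ∏ p ∈ P \ T, (1 - g p))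
    (fun T hT => ?_) (empty_mem_boundedSubsets (P := P) hy)
  · refine le_trans (le_of_eq ?_) h
    rw [Finset.prod_empty, one_mul, Finset.sdiff_empty]
    exact (Finset.prod_eq_one fun p hp => by rw [hg p hp, sub_zero]).symm
  · refine mul_nonneg (Finset.prod_nonneg fun p hp => ?_) (Finset.prod_nonneg fun p hp => ?_)
    · exact (hg p ((mem_boundedSubsets.1 hT).1 hp)).ge
    · rw [hg p (Finset.mem_sdiff.1 hp).1]; norm_num

theorem selbergJ_pos_of_nonneg {κ s : ℝ} (hκ : 0 ≤ κ) (hs : 1 ≤ s) : 0 < selbergJ κ s := by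
  rcases hκ.eq_or_lt with rfl | hκ
  · rw [selbergJ_zero_left (by linarith)]; norm_num
  · exact selbergJ_pos hκ hs

theorem selbergJ_le_one {κ s : ℝ} (hκ : 0 ≤ κ) (hs : 0 < s) : selbergJ κ s ≤ 1 := by
  rcases hκ.eq_or_lt with rfl | hκ
  · rw [selbergJ_zero_left hs]
  · obtain ⟨N, hN⟩ := exists_nat_ge (2 * κ + 2)
    refine le_of_tendsto (tendsto_productProb_extremalProb hκ hN hs) ?_
    filter_upwards [eventually_productProb_extremalProb hκ.le hN] with z hz
    exact (hz.2 s).2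

/-- Sieve probabilities of dimension `κ` on a set of primes. -/
def IsSieveProb (κ : ℝ) (P : Finset ℕ) (g : ℕ → ℝ) : Prop :=
  ∀ p ∈ P, 0 ≤ g p ∧ g p ≤ 1 ∧ g p ≤ κ / ((p : ℝ) - 1)

/-- Every admissible model on primes up to z is dominated by the extremal one on all of them. The
threshold therefore depends only on `κ`, `s` and `δ`. -/
theorem exists_selbergJ_sub_le_productProb {κ s : ℝ} (hκ : 0 ≤ κ) (hs : 0 < s) {δ : ℝ}
    (hδ : 0 < δ) : ∃ z₀ : ℝ, 1 ≤ z₀ ∧ ∀ z : ℝ, z₀ ≤ z → ∀ P ⊆ primesUpTo z, ∀ g : ℕ → ℝ,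
      IsSieveProb κ P g → selbergJ κ s - δ ≤ productProb g P (z ^ s) := by
  rcases hκ.eq_or_lt with rfl | hκ'
  · refine ⟨1, le_rfl, fun z hz P _ g hg => ?_⟩
    rw [selbergJ_zero_left hs]
    have h := one_le_productProb_of_eq_zero (P := P) (g := g) (fun p hp => le_antisymm (by
      have := (hg p hp).2.2
      rwa [zero_div] at this) (hg p hp).1) (Real.one_le_rpow hz hs.le)
    linarith
  · obtain ⟨N, hN⟩ := exists_nat_ge (2 * κ + 2)
    obtain ⟨z₀, hz₀⟩ := eventually_atTop.1 ((tendsto_productProb_extremalProb hκ' hN hs).eventually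
      (lt_mem_nhds (show selbergJ κ s - δ < selbergJ κ s by linarith)))
    refine ⟨max z₀ 1, le_max_right _ _, fun z hz P hP g hg => ?_⟩
    refine (hz₀ z ((le_max_left _ _).trans hz)).le.trans ?_
    refine productProb_anti (fun p hp => (mem_primesUpTo.1 hp).1.pos) hP (fun p hp => (hg p hp).1)
      (fun p hp => ?_) (fun p _ => (extremalProb_mem hκ hN p).1)
      (fun p _ => (extremalProb_mem hκ hN p).2) _
    rw [extremalProb]
    split_ifs
    · exact (hg p hp).2.1
    · exact (hg p hp).2.2

/-- Increasing the level by a factor `log X` makes the lower bound uniform in all `z ≥ 2`. -/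
theorem eventually_selbergJ_sub_le_productProb {κ s : ℝ} (hκ : 0 ≤ κ) (hs : 0 < s) {δ : ℝ}
    (hδ : 0 < δ) : ∀ᶠ X : ℝ in atTop, ∀ z : ℝ, 2 ≤ z → ∀ P ⊆ primesUpTo z, ∀ g : ℕ → ℝ,
      IsSieveProb κ P g → selbergJ κ s - δ ≤ productProb g P (z ^ s * Real.log X) := by
  obtain ⟨z₀, hz₀1, hz₀⟩ := exists_selbergJ_sub_le_productProb hκ hs hδ
  filter_upwards [Real.tendsto_log_atTop.eventually_ge_atTop
    (max 1 ((∏ p ∈ primesUpTo z₀, p : ℕ) : ℝ))] with X hX z hz P hP g hg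
  have hX1 : 1 ≤ Real.log X := (le_max_left _ _).trans hX
  have hzs : 1 ≤ z ^ s := Real.one_le_rpow (by linarith) hs.le
  rcases le_total z₀ z with h | h
  · exact (hz₀ z h P hP g hg).trans (productProb_mono (fun p hp => (hg p hp).1)
      (fun p hp => (hg p hp).2.1) (by nlinarith))
  -- For z ≤ z₀ the level exceeds log X, hence the product of all primes up to z₀, and the
  -- probability is 1.
  · rw [productProb_eq_one (fun p hp => (mem_primesUpTo.1 (hP hp)).1.one_le)]
    · linarith [selbergJ_le_one hκ hs]
    · have hPz : P ⊆ primesUpTo z₀ := fun p hp => by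
        have := mem_primesUpTo.1 (hP hp)
        exact mem_primesUpTo.2 ⟨this.1, this.2.trans h⟩
      have h1 : ((∏ p ∈ P, p : ℕ) : ℝ) ≤ (∏ p ∈ primesUpTo z₀, p : ℕ) := by
        exact_mod_cast Finset.prod_le_prod_of_subset_of_one_le' hPz
          fun p hp _ => (mem_primesUpTo.1 hp).1.one_le
      have h2 := (le_max_right _ _).trans hX
      nlinarith

/-- Taking as error the infimum of all nonnegative constants that work at `X` turns the statements
for each fixed δ into one function ε(X) → 0; the infimum itself still works. -/
theorem exists_upperSieveFunction_bound {κ s : ℝ} (hκ : 0 ≤ κ) (hs : 1 ≤ s) :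
    ∃ ε : ℝ → ℝ, Tendsto ε atTop (𝓝 0) ∧ ∀ᶠ X : ℝ in atTop, ∀ z : ℝ, 2 ≤ z →
      ∀ P ⊆ primesUpTo z, ∀ g : ℕ → ℝ, IsSieveProb κ P g →
        1 / productProb g P (z ^ s * Real.log X) ≤ upperSieveFunction κ s + ε X := by
  have hj := selbergJ_pos_of_nonneg hκ hs
  set j := selbergJ κ s with hjdef
  let Q : ℝ → Set ℝ := fun X => {e | 0 ≤ e ∧ ∀ z : ℝ, 2 ≤ z → ∀ P ⊆ primesUpTo z, ∀ g : ℕ → ℝ,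
    IsSieveProb κ P g → 1 / productProb g P (z ^ s * Real.log X) ≤ upperSieveFunction κ s + e}
  have hQ : ∀ δ : ℝ, 0 < δ → ∀ᶠ X in atTop, δ ∈ Q X := by
    intro δ hδ
    -- One needs 1/(j - η) ≤ 1/j + δ, that is η ≤ δ j (j - η), and j - η ≥ j/2.
    set η := min (j / 2) (δ * j ^ 2 / 2) with hη
    have hη0 : 0 < η := by positivity
    have h1 : η ≤ j / 2 := min_le_left _ _
    have h2 : η ≤ δ * j ^ 2 / 2 := min_le_right _ _
    filter_upwards [eventually_selbergJ_sub_le_productProb hκ (show 0 < s by linarith) hη0]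
      with X hX
    refine ⟨hδ.le, fun z hz P hP g hg => ?_⟩
    refine (one_div_le_one_div_of_le (by linarith) (hX z hz P hP g hg)).trans ?_
    rw [upperSieveFunction, ← hjdef, div_add' _ _ _ hj.ne', div_le_div_iff₀ (by linarith) hj]
    nlinarith [mul_nonneg hδ.le hj.le, mul_nonneg (mul_nonneg hδ.le hj.le) (sub_nonneg.2 h1)]
  have hbdd : ∀ X, BddBelow (Q X) := fun X => ⟨0, fun e he => he.1⟩
  refine ⟨fun X => sInf (Q X), ?_, ?_⟩
  · rw [Metric.tendsto_nhds]
    intro δ hδ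
    filter_upwards [hQ (δ / 2) (by linarith)] with X hX
    have h1 : sInf (Q X) ≤ δ / 2 := csInf_le (hbdd X) hX
    have h2 : 0 ≤ sInf (Q X) := Real.sInf_nonneg fun e he => he.1
    rw [Real.dist_eq, sub_zero, abs_of_nonneg h2]
    linarith
  · filter_upwards [hQ 1 one_pos] with X hX z hz P hP g hg
    have : 1 / productProb g P (z ^ s * Real.log X) - upperSieveFunction κ s ≤ sInf (Q X) :=
      le_csInf ⟨1, hX⟩ fun e he => by linarith [he.2 z hz P hP g hg]
    linarith

/-! ### From Λ to primes, and the final assembly -/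

theorem mem_sievingPrimes {W₀ : ℕ} {z : ℝ} {p : ℕ} (hp : p ∈ sievingPrimes W₀ z) :
    p.Prime ∧ ¬ p ∣ W₀ ∧ (p : ℝ) ≤ z := by
  rw [sievingPrimes, Finset.mem_filter, Finset.mem_Icc] at hp
  exact ⟨hp.2.1, hp.2.2, (Nat.le_floor_iff' (by omega)).1 hp.1.2⟩

open Classical in
-- The 1 accounts for n = X, present in the closed interval but not in (X, 2X]. Each other prime has
-- weight at least log X, and dropping the remaining nonnegative weights gives the bound.
theorem sievedPrimeCount_le (Ω : ObstructionPattern) {X : ℝ} (hX : 3 ≤ X) (W₀ : ℕ) (b : ℤ)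
    (z : ℝ) : (sievedPrimeCount Ω X W₀ b z : ℝ) ≤ 1 +
      (∑ n ∈ (Finset.Ioc ⌊X⌋₊ ⌊2 * X⌋₊).filter (fun n : ℕ => (n : ℤ) ≡ b [ZMOD (W₀ : ℤ)] ∧
        ∀ p ∈ sievingPrimes W₀ z, ∀ u ∈ Ω p, (n : ZMod p) ≠ (u : ZMod p)),
          ArithmeticFunction.vonMangoldt n) / Real.log X := by
  have hlog : 0 < Real.log X := Real.log_pos (by linarith)
  set S := (Finset.Ioc ⌊X⌋₊ ⌊2 * X⌋₊).filter (fun n : ℕ => (n : ℤ) ≡ b [ZMOD (W₀ : ℤ)] ∧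
        ∀ p ∈ sievingPrimes W₀ z, ∀ u ∈ Ω p, (n : ZMod p) ≠ (u : ZMod p)) with hS
  have hsub : {n : ℕ | n.Prime ∧ n ∈ siftedSet Ω X W₀ b z} ⊆
      ((insert ⌊X⌋₊ (S.filter Nat.Prime) : Finset ℕ) : Set ℕ) := by
    rintro n ⟨hn, h1, h2, h3, h4⟩
    simp only [Finset.coe_insert, Set.mem_insert_iff, Finset.mem_coe, hS, Finset.mem_filter,
      Finset.mem_Ioc]
    rcases lt_or_ge ⌊X⌋₊ n with h | h
    · exact Or.inr ⟨⟨⟨h, Nat.le_floor h2⟩, h3, h4⟩, hn⟩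
    · refine Or.inl (le_antisymm h ?_)
      exact_mod_cast (Nat.floor_le (by linarith)).trans h1
  have hcard : (sievedPrimeCount Ω X W₀ b z : ℝ) ≤ 1 + ((S.filter Nat.Prime).card : ℝ) := by
    have h := Set.ncard_le_ncard hsub (Finset.finite_toSet _)
    rw [Set.ncard_coe_finset] at h
    have h2 := h.trans (Finset.card_insert_le _ _)
    rw [sievedPrimeCount, add_comm]
    exact_mod_cast h2
  refine hcard.trans (add_le_add le_rfl ?_)
  rw [le_div_iff₀ hlog]
  refine le_trans ?_ (Finset.sum_le_sum_of_subset_of_nonneg (Finset.filter_subset Nat.Prime S)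
    fun _ _ _ => ArithmeticFunction.vonMangoldt_nonneg)
  rw [← nsmul_eq_mul]
  refine Finset.card_nsmul_le_sum _ _ _ fun n hn => ?_
  rw [Finset.mem_filter, hS, Finset.mem_filter, Finset.mem_Ioc] at hn
  rw [ArithmeticFunction.vonMangoldt_apply_prime hn.2]
  exact Real.log_le_log (by linarith) ((Nat.floor_lt (by linarith)).1 hn.1.1.1).le

theorem card_obstruction_le (Ω : ObstructionPattern) {p : ℕ} (hp : p.Prime) :
    ((Ω p).card : ℝ) ≤ (p : ℝ) - 1 := by
  have : Fact p.Prime := ⟨hp⟩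
  have h := Finset.card_le_univ (Ω p)
  rw [ZMod.card_units_eq_totient, Nat.totient_prime hp] at h
  rw [← Nat.cast_pred hp.pos]
  exact_mod_cast h

/-- All reduced classes modulo p are forbidden, and a prime n ≥ X > z ≥ p lies in one of them. -/
theorem sievedPrimeCount_eq_zero {Ω : ObstructionPattern} {X : ℝ} {W₀ : ℕ} {b : ℤ} {z : ℝ}
    (hz : z < X) {p : ℕ} (hp : p ∈ sievingPrimes W₀ z)
    (hΩ : (p : ℝ) - 1 ≤ ((Ω p).card : ℝ)) : sievedPrimeCount Ω X W₀ b z = 0 := by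
  obtain ⟨hpp, -, hpz⟩ := mem_sievingPrimes hp
  have : Fact p.Prime := ⟨hpp⟩
  have huniv : Ω p = Finset.univ := by
    refine Finset.eq_univ_of_card _ ?_
    rw [ZMod.card_units_eq_totient, Nat.totient_prime hpp]
    have h1 := le_antisymm (card_obstruction_le Ω hpp) hΩ
    rw [← Nat.cast_pred hpp.pos] at h1
    exact_mod_cast h1
  rw [sievedPrimeCount]
  convert Set.ncard_empty ℕ
  refine Set.eq_empty_of_forall_notMem ?_
  rintro n ⟨hn, h1, -, -, h4⟩
  by_cases hnp : (n : ZMod p) = 0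
  · rw [ZMod.natCast_eq_zero_iff] at hnp
    have := (Nat.prime_dvd_prime_iff_eq hpp hn).1 hnp
    rw [← this] at h1
    linarith
  · exact h4 p hp (Units.mk0 (n : ZMod p) hnp) (huniv ▸ Finset.mem_univ _) rfl

theorem localWeakness_nonneg (Ω : ObstructionPattern) (W₀ : ℕ) (z : ℝ) :
    0 ≤ localWeakness Ω W₀ z := by
  refine Finset.prod_nonneg fun p hp => ?_
  have hpp := (mem_sievingPrimes hp).1
  have h2 : (2 : ℝ) ≤ p := by exact_mod_cast hpp.two_le
  rw [sub_nonneg, div_le_one (by linarith)]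
  exact card_obstruction_le Ω hpp

theorem mainTheorem9 (θ : ℝ) (hθ0 : 0 < θ) (hθ1 : θ ≤ 1) (hLD : HasLevelOfDistribution θ) :
    ∃ C : ℝ → ℝ, ∀ κ s : ℝ, 0 ≤ κ → 1 < s →
      ∃ ε : ℝ → ℝ, Tendsto ε atTop (𝓝 0) ∧
        ∀ A : ℝ, 0 < A → ∃ B₀ : ℝ, ∀ B : ℝ, B₀ ≤ B →
          ∀ (X : ℝ) (W₀ : ℕ) (b : ℤ) (z R : ℝ) (Ω : ObstructionPattern),
            3 ≤ X → 1 ≤ W₀ → IsCoprime b (W₀ : ℤ) → 2 ≤ z →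
            (∀ p ∈ sievingPrimes W₀ z, ((Ω p).card : ℝ) ≤ κ) →
            R = z ^ s →
            (W₀ : ℝ) * R ^ 2 ≤ X ^ θ / Real.log X ^ B →
            (sievedPrimeCount Ω X W₀ b z : ℝ) ≤
              (upperSieveFunction κ s + ε X) * localWeakness Ω W₀ z *
                  (X / ((Nat.totient W₀ : ℝ) * Real.log X))
                + C A * (X / Real.log X ^ (A + 1)) := by
  -- One unit is for the remainder, the other for the isolated 1 in the count.
  refine ⟨fun _ => 2, fun κ s hκ hs => ?_⟩
  obtain ⟨ε, hε, hεX⟩ := exists_upperSieveFunction_bound hκ hs.le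
  refine ⟨ε, hε, fun A hA => ?_⟩
  obtain ⟨B₁, X₁, hB₁⟩ := sum_apDiscrepancy_boundedSubsets_le hLD hκ hA
  have hpow : ∀ᶠ X : ℝ in atTop, Real.log X ^ (A + 1) ≤ X := by
    filter_upwards [(isLittleO_log_rpow_rpow_atTop (A + 1) one_pos).bound one_pos,
      eventually_ge_atTop 1] with X hX hX1
    rw [Real.rpow_one, one_mul, Real.norm_of_nonneg (by linarith : (0 : ℝ) ≤ X)] at hX
    exact (le_abs_self _).trans hX
  obtain ⟨X₀, hX₀⟩ := eventually_atTop.1 (hεX.and (hpow.and (eventually_ge_atTop X₁)))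
  have hlog3 : 1 < Real.log 3 := by
    rw [Real.lt_log_iff_exp_lt (by norm_num)]
    linarith [Real.exp_one_lt_d9]
  obtain ⟨M, hM⟩ := pow_unbounded_of_one_lt X₀ hlog3
  -- The 2 pays for the factor (log X)² from enlarging R by log X. The exponent M makes the level
  -- hypothesis impossible for X < X₀: it would force X^θ/(log X)^B < 1 ≤ W₀R².
  refine ⟨max (max B₁ 0 + 2) M, fun B hB X W₀ b z R Ω hX hW hb hz hω hR hlevel => ?_⟩
  subst hR
  have hX0 : 0 < X := by linarith
  set ℓ := Real.log X with hℓ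
  have hℓ3 : Real.log 3 ≤ ℓ := Real.log_le_log (by norm_num) hX
  have hℓ1 : 1 < ℓ := by linarith
  have hℓ0 : 0 < ℓ := by linarith
  have hBM : (M : ℝ) ≤ B := (le_max_right _ _).trans hB
  have hB2 : max B₁ 0 + 2 ≤ B := (le_max_left _ _).trans hB
  have hB1 : B₁ ≤ B - 2 := by linarith [le_max_left B₁ 0]
  have hB0 : 0 ≤ B - 2 := by linarith [le_max_right B₁ 0]
  have hXθ : X ^ θ ≤ X := by
    simpa using Real.rpow_le_rpow_of_exponent_le (by linarith : 1 ≤ X) hθ1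
  have hR1 : 1 ≤ z ^ s := Real.one_le_rpow (by linarith) (by linarith)
  have hzR : z < z ^ s := by
    simpa using Real.rpow_lt_rpow_of_exponent_lt (by linarith : 1 < z) hs
  have hW1 : (1 : ℝ) ≤ W₀ := by exact_mod_cast hW
  have hWR : 1 ≤ (W₀ : ℝ) * (z ^ s) ^ 2 := by nlinarith [one_le_pow₀ hR1 (n := 2)]
  have hXX₀ : X₀ ≤ X := by
    by_contra hlt
    rw [not_le] at hlt
    have h1 : X ^ θ / ℓ ^ B < 1 := by
      rw [div_lt_one (Real.rpow_pos_of_pos hℓ0 _)]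
      calc X ^ θ ≤ X := hXθ
        _ < X₀ := hlt
        _ < Real.log 3 ^ M := hM
        _ ≤ ℓ ^ M := pow_le_pow_left₀ (by linarith) hℓ3 M
        _ = ℓ ^ (M : ℝ) := (Real.rpow_natCast _ _).symm
        _ ≤ ℓ ^ B := Real.rpow_le_rpow_of_exponent_le hℓ1.le hBM
    linarith
  obtain ⟨hεb, hXA, hXX₁⟩ := hX₀ X hXX₀
  set R := z ^ s * ℓ with hRdef
  have hR1' : 1 ≤ R := by nlinarith
  have hWY : (W₀ : ℝ) * R ^ 2 ≤ X ^ θ / ℓ ^ (B - 2) := by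
    have e : ℓ ^ (B - 2) = ℓ ^ B / ℓ ^ 2 := by
      rw [Real.rpow_sub hℓ0]; norm_cast
    rw [e, div_div_eq_mul_div, hRdef, mul_pow, ← mul_assoc, mul_div_right_comm]
    exact mul_le_mul_of_nonneg_right hlevel (by positivity)
  have hWYX : (W₀ : ℝ) * R ^ 2 ≤ X :=
    hWY.trans ((div_le_self (by positivity) (Real.one_le_rpow hℓ1.le hB0)).trans hXθ)
  have hWYB : (W₀ : ℝ) * R ^ 2 ≤ X ^ θ / ℓ ^ B₁ :=
    hWY.trans (div_le_div_of_nonneg_left (by positivity) (Real.rpow_pos_of_pos hℓ0 _)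
      (Real.rpow_le_rpow_of_exponent_le hℓ1.le hB1))
  have hR2 : 1 ≤ R ^ 2 := one_le_pow₀ hR1'
  have hzX : z < X := by nlinarith
  have hP : ∀ p ∈ sievingPrimes W₀ z, p.Prime ∧ ¬ p ∣ W₀ := fun p hp =>
    ⟨(mem_sievingPrimes hp).1, (mem_sievingPrimes hp).2.1⟩
  have herr0 : 0 ≤ X / ℓ ^ (A + 1) := by positivity
  -- Selberg's weights need g(p) < 1. If g(p) = 1 for some p, both the count and the local weakness
  -- vanish.
  by_cases hfull : ∃ p ∈ sievingPrimes W₀ z, (p : ℝ) - 1 ≤ ((Ω p).card : ℝ)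
  · obtain ⟨p, hp, hpΩ⟩ := hfull
    have hp1 : (0 : ℝ) < (p : ℝ) - 1 := by
      have : (2 : ℝ) ≤ p := by exact_mod_cast (hP p hp).1.two_le
      linarith
    have hweak : localWeakness Ω W₀ z = 0 := by
      refine Finset.prod_eq_zero hp ?_
      rw [le_antisymm (card_obstruction_le Ω (hP p hp).1) hpΩ, div_self hp1.ne', sub_self]
    rw [sievedPrimeCount_eq_zero hzX hp hpΩ, hweak]
    simp only [Nat.cast_zero, mul_zero, zero_mul, zero_add]
    positivity
  push Not at hfull
  set g : ℕ → ℝ := fun p => ((Ω p).card : ℝ) / ((p : ℝ) - 1) with hg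
  have hp1 : ∀ p ∈ sievingPrimes W₀ z, (0 : ℝ) < (p : ℝ) - 1 := fun p hp => by
    have : (2 : ℝ) ≤ p := by exact_mod_cast (hP p hp).1.two_le
    linarith
  have hg1 : ∀ p ∈ sievingPrimes W₀ z, g p < 1 := fun p hp =>
    (div_lt_one (hp1 p hp)).2 (hfull p hp)
  have hgs : IsSieveProb κ (sievingPrimes W₀ z) g := fun p hp =>
    ⟨div_nonneg (Nat.cast_nonneg _) (hp1 p hp).le, (hg1 p hp).le,
      div_le_div_of_nonneg_right (hω p hp) (hp1 p hp).le⟩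
  have hPz : sievingPrimes W₀ z ⊆ primesUpTo z := fun p hp =>
    mem_primesUpTo.2 ⟨(hP p hp).1, (mem_sievingPrimes hp).2.2⟩
  have hF := hεb z hz (sievingPrimes W₀ z) hPz g hgs
  have hE := hB₁ X hXX₁ W₀ (R ^ 2) (sievingPrimes W₀ z) Ω hW hR2 hWYB hWYX hP hω
  have hmain := sum_vonMangoldt_sifted_le Ω hW hb hP hg1 (X := X) hR1'
  have hcount := sievedPrimeCount_le Ω hX W₀ b z
  have hφ : (0 : ℝ) < Nat.totient W₀ := by exact_mod_cast Nat.totient_pos.2 hW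
  have hV := localWeakness_nonneg Ω W₀ z
  have hVF : localWeakness Ω W₀ z / productProb g (sievingPrimes W₀ z) R ≤
      (upperSieveFunction κ s + ε X) * localWeakness Ω W₀ z := by
    rw [div_eq_mul_one_div, mul_comm]
    exact mul_le_mul_of_nonneg_right hF hV
  have hsum := hmain.trans (add_le_add (mul_le_mul_of_nonneg_left hVF
    (show 0 ≤ X / (Nat.totient W₀ : ℝ) by positivity)) hE)
  have h1 : 1 ≤ X / ℓ ^ (A + 1) := (one_le_div (Real.rpow_pos_of_pos hℓ0 _)).2 hXA
  refine hcount.trans ((add_le_add le_rfl (div_le_div_of_nonneg_right hsum hℓ0.le)).trans ?_)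
  have e1 : (X / (Nat.totient W₀ : ℝ) * ((upperSieveFunction κ s + ε X) * localWeakness Ω W₀ z) +
      X / ℓ ^ A) / ℓ = (upperSieveFunction κ s + ε X) * localWeakness Ω W₀ z *
        (X / ((Nat.totient W₀ : ℝ) * ℓ)) + X / ℓ ^ (A + 1) := by
    rw [Real.rpow_add_one hℓ0.ne']
    have : ℓ ^ A ≠ 0 := (Real.rpow_pos_of_pos hℓ0 A).ne'
    field_simp
  rw [e1]
  linarith
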